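/- Let $S[1..n]$ be a string over an alphabet of size $\sigma$, and for $0<\tau\le 1$ call a symbol $a$ a *$\tau$-majority* of a range $S[i..j]$ if $a$ occurs at least $\tau\,(j-i+1)$ times in $S[i..j]$. The model is the word RAM, with unit-cost arithmetic, bitwise and comparison operations on $w$-bit words and unit-cost memory access. Write $\ell(\sigma)=\max\{1,\log_2\log_2\sigma\}$ (read as $1$ if $\log_2\log_2\sigma$ is undefined). **Theorem.** There are a constant $c$ and one query program, both independent of $n$, $\sigma$, $S$, $w$ and $\tau$, such that the following holds for all $n$, $\sigma$, all strings $S[1..n]$ over an alphabet of size $\sigma$, and all word lengths $w$ such that a symbol fits in a word ($\sigma\le 2^w$) and $c\,n\,\ell(\sigma)$ words can be addressed ($c\,n\,\ell(\sigma)\le 2^w$). The string $S$ can be stored in a (read-only) data structure that, together with the working memory of the query program, takes at most $c\,n\,\ell(\sigma)=O(n\log\log\sigma)$ words, such that later, given any $1\le i\le j\le n$ and any threshold $0<\tau\le 1$ (as a fraction of two words), the program outputs exactly the $\tau$-majorities of $S[i..j]$, each once, in at most $c/\tau=O(1/\tau)$ time, whatever the initial contents of the working memory. -/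

import Mathlib

/-! A word RAM with `w`-bit words.  The machine has registers, a read-only memory of `s` words
(the stored data structure), a working memory of `m` words, and a write-only output list.
A program is a finite piece of code that does not depend on `w`, `s`, `m`. -/

namespace WordRAM

/-- Unit-cost operations on machine words. -/
inductive BinOp where
  | add | sub | mul | div | mod | and | or | xor | shl | shr | lt | eq

/-- Arithmetic is unsigned and modulo `2 ^ w`; comparisons return the word `1` or `0`. -/
def BinOp.eval {w : ℕ} : BinOp → BitVec w → BitVec w → BitVec w
  | .add, x, y => x + y
  | .sub, x, y => x - y
  | .mul, x, y => x * y
  | .div, x, y => x / y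
  | .mod, x, y => x % y
  | .and, x, y => x &&& y
  | .or, x, y => x ||| y
  | .xor, x, y => x ^^^ y
  | .shl, x, y => x <<< y.toNat
  | .shr, x, y => x >>> y.toNat
  | .lt, x, y => if x.toNat < y.toNat then 1#w else 0#w
  | .eq, x, y => if x = y then 1#w else 0#w

/-- Expressions: literals, registers, words read from the data structure or from the working
memory at a computed address, and word operations. -/
inductive Expr where
  | lit (k : ℕ)
  | reg (r : ℕ)
  | data (addr : Expr)
  | work (addr : Expr)
  | bin (o : BinOp) (x y : Expr)

/-- Programs. The loop and the conditional test whether a word is nonzero. -/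
inductive Prog where
  | skip
  | assign (r : ℕ) (e : Expr)
  | store (addr e : Expr)
  | emit (e : Expr)
  | seq (P Q : Prog)
  | cond (e : Expr) (P Q : Prog)
  | loop (e : Expr) (P : Prog)

/-- The mutable part of a configuration: registers, working memory of `m` words, output. -/
structure State (w m : ℕ) where
  reg : ℕ → BitVec w
  work : Fin m → BitVec w
  out : List (BitVec w)

/-- Read a memory of `s` words; an address outside of the memory yields `0`. -/
def fetch {w s : ℕ} (mem : Fin s → BitVec w) (a : BitVec w) : BitVec w :=
  if h : a.toNat < s then mem ⟨a.toNat, h⟩ else 0#w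

/-- Value of an expression, for the read-only memory `D`. -/
def Expr.eval {w s m : ℕ} (D : Fin s → BitVec w) (st : State w m) : Expr → BitVec w
  | .lit k => BitVec.ofNat w k
  | .reg r => st.reg r
  | .data a => fetch D (a.eval D st)
  | .work a => fetch st.work (a.eval D st)
  | .bin o x y => o.eval (x.eval D st) (y.eval D st)

/-- Time to evaluate an expression: one unit per literal, register access, memory access and
operation. -/
def Expr.cost : Expr → ℕ
  | .lit _ => 1
  | .reg _ => 1
  | .data a => a.cost + 1
  | .work a => a.cost + 1
  | .bin _ x y => x.cost + y.cost + 1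

/-- `Exec D P st t st'`: with the data structure `D` in the read-only memory, the program `P`
started in `st` halts after exactly `t` time units in `st'`.  A store to an address outside of
the working memory has no effect. -/
inductive Exec {w s m : ℕ} (D : Fin s → BitVec w) :
    Prog → State w m → ℕ → State w m → Prop where
  | skip (st : State w m) : Exec D .skip st 1 st
  | assign (st : State w m) (r : ℕ) (e : Expr) :
      Exec D (.assign r e) st (e.cost + 1)
        { st with reg := Function.update st.reg r (e.eval D st) }
  | store (st : State w m) (a e : Expr) :
      Exec D (.store a e) st (a.cost + e.cost + 1)
        { st with work := fun k =>
            if k.val = (a.eval D st).toNat then e.eval D st else st.work k }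
  | emit (st : State w m) (e : Expr) :
      Exec D (.emit e) st (e.cost + 1) { st with out := st.out ++ [e.eval D st] }
  | seq {P Q : Prog} {st st₁ st₂ : State w m} {t₁ t₂ : ℕ} :
      Exec D P st t₁ st₁ → Exec D Q st₁ t₂ st₂ → Exec D (.seq P Q) st (t₁ + t₂) st₂
  | cond_true {e : Expr} {P Q : Prog} {st st₁ : State w m} {t : ℕ} :
      e.eval D st ≠ 0#w → Exec D P st t st₁ → Exec D (.cond e P Q) st (e.cost + 1 + t) st₁
  | cond_false {e : Expr} {P Q : Prog} {st st₁ : State w m} {t : ℕ} :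
      e.eval D st = 0#w → Exec D Q st t st₁ → Exec D (.cond e P Q) st (e.cost + 1 + t) st₁
  | loop_done {e : Expr} {P : Prog} {st : State w m} :
      e.eval D st = 0#w → Exec D (.loop e P) st (e.cost + 1) st
  | loop_step {e : Expr} {P : Prog} {st st₁ st₂ : State w m} {t₁ t₂ : ℕ} :
      e.eval D st ≠ 0#w → Exec D P st t₁ st₁ → Exec D (.loop e P) st₁ t₂ st₂ →
      Exec D (.loop e P) st (e.cost + 1 + t₁ + t₂) st₂

/-- Start of a query: the words of `input` are in registers `0, 1, 2, …`, all other registers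
are `0`, the working memory has the contents `work`, and nothing has been output. -/
def initState {w m : ℕ} (input : List (BitVec w)) (work : Fin m → BitVec w) : State w m where
  reg r := input.getD r 0#w
  work := work
  out := []

end WordRAM

/-- The symbol `a` is a `τ`-majority of the range `S[i..j]` (both endpoints included): its
relative frequency in the range is at least `τ`. -/
def IsRangeMajority {n σ : ℕ} (S : Fin n → Fin σ) (i j : Fin n) (τ : ℝ) (a : Fin σ) : Prop :=
  τ * ((j : ℝ) - (i : ℝ) + 1) ≤ (((Finset.Icc i j).filter (fun k => S k = a)).card : ℝ)

/-- The space bound `n log log σ` (logarithms to base 2), where `log log σ` is read as `1` when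
it is smaller than `1` or undefined. -/
noncomputable def nLogLog (n σ : ℕ) : ℝ :=
  (n : ℝ) * max 1 (Real.logb 2 (Real.logb 2 (σ : ℝ)))

/-! Write L for the length of the range. Fix a frequency 1/2^k and a scale g, and cut the text into
blocks whose length is a multiple of 2^k. For each block, store the symbols that occur at least
2^g/2 times in the window of length 3·2^g·2^k that begins at the block's start y. Counting
occurrences leaves at most 6·2^k of these candidates. A query takes 2^k just below the minimum of
1/τ, L and a cap, and 2^g just below L/2^k. The window of the block that contains i then covers the
range, and every τ-majority is a candidate (`mem_candidates`). It remains to test O(1/τ) candidates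
in O(1/τ) total time.

Testing one candidate a: sort all occurrences as keys `sy p * N + p`, so that occurrences from i on
start at the key number `rank (a * N + i)`. With T the least integer at least τL, a is a majority
iff the key T - 1 places further still has symbol a and position at most j. The rank at y is
obtained from the list. The query moves on to x, which is i rounded down to a multiple of 2^k, by a
search, and from x to i by a linear scan. As x and y are less than b^3·2^k apart, the search can
work with positions divided by 2^k and distances cut to M = b^3. In blocks of M keys the accumulated
distances are below b^6 (`offset_lt_iff`), so b of them fit in one word and a table finds the child
in a b-ary tree of height 3 in constant time (`digitsBelow_node`). Crossing key blocks costs one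
step per M occurrences. Summed over all symbols, crossings and scans cost O(2^k), because different
symbols occupy different positions (`sum_searchCost_le`).

Space: b·log b is of order log n, and each k needs only O(n/b) words
(`Params.Sizes.sum_levelLen_le`). The trees have one word per b keys. Block lengths are capped at
M·2^k, so the many large scales cost n/b^3 words each up to a constant. The lists for 2^g < b are
coded as streams of numbers at most 2^g, and b of these are packed in a word. There are at most
min(log σ, log n) + 1 values of k, up to rounding, hence O(log log σ) times b of them
(`Params.Sizes.levels_le`).

The threshold pL/q for two-word fractions needs a product that overflows a word. It is found by long
division of three digits, with a trial quotient that is off by at most one (`quotient_estimate`).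
Programs are verified against a semantics in natural numbers, in which every intermediate result is
shown to fit in a word. -/

namespace RangeMajority
open WordRAM

set_option linter.unusedSimpArgs false

/-! ### Verification of word RAM programs by natural number semantics -/

/-- The natural number counterpart of a word operation. -/
def natOp : BinOp → ℕ → ℕ → ℕ
  | .add, x, y => x + y
  | .sub, x, y => x - y
  | .mul, x, y => x * y
  | .div, x, y => x / y
  | .mod, x, y => x % y
  | .and, x, y => x &&& y
  | .or, x, y => x ||| y
  | .xor, x, y => x ^^^ y
  | .shl, x, y => x * 2 ^ y
  | .shr, x, y => x / 2 ^ y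
  | .lt, x, y => if x < y then 1 else 0
  | .eq, x, y => if x = y then 1 else 0

/-- The operation neither overflows nor underflows. -/
def OkOp (w : ℕ) : BinOp → ℕ → ℕ → Prop
  | .add, x, y => x + y < 2 ^ w
  | .sub, x, y => y ≤ x
  | .mul, x, y => x * y < 2 ^ w
  | .shl, x, y => x * 2 ^ y < 2 ^ w
  | _, _, _ => True

/-- Value of an expression over the natural numbers. -/
def nev (mem ρ : ℕ → ℕ) : Expr → ℕ
  | .lit k => k
  | .reg r => ρ r
  | .data a => mem (nev mem ρ a)
  | .work _ => 0
  | .bin o x y => natOp o (nev mem ρ x) (nev mem ρ y)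

/-- All intermediate results fit in a word and all addresses are in range. -/
def Ok (w s : ℕ) (mem ρ : ℕ → ℕ) : Expr → Prop
  | .lit k => k < 2 ^ w
  | .reg _ => True
  | .data a => Ok w s mem ρ a ∧ nev mem ρ a < s
  | .work _ => True
  | .bin o x y => Ok w s mem ρ x ∧ Ok w s mem ρ y ∧ OkOp w o (nev mem ρ x) (nev mem ρ y)

/-- The machine state with given register contents and output. -/
def mkState (w : ℕ) (ρ : ℕ → ℕ) (o : List ℕ) : State w 0 where
  reg r := BitVec.ofNat w (ρ r)
  work := fun k => k.elim0
  out := o.map (BitVec.ofNat w)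

/-- The read-only memory with given contents. -/
def mkData (w s : ℕ) (mem : ℕ → ℕ) : Fin s → BitVec w := fun k => BitVec.ofNat w (mem k)

theorem toNat_ofNat_of_lt {w a : ℕ} (h : a < 2 ^ w) : (BitVec.ofNat w a).toNat = a := by
  simp [Nat.mod_eq_of_lt h]

theorem natOp_lt {w : ℕ} (hw : 1 ≤ w) {o : BinOp} {a b : ℕ} (ha : a < 2 ^ w) (hb : b < 2 ^ w)
    (h : OkOp w o a b) : natOp o a b < 2 ^ w := by
  have h1 : 1 < 2 ^ w := Nat.one_lt_two_pow (by omega)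
  cases o <;> simp only [natOp, OkOp] at *
  · exact h
  · omega
  · exact h
  · exact lt_of_le_of_lt (Nat.div_le_self _ _) ha
  · exact lt_of_le_of_lt (Nat.mod_le _ _) ha
  · exact Nat.and_lt_two_pow _ hb
  · exact Nat.or_lt_two_pow ha hb
  · exact Nat.xor_lt_two_pow ha hb
  · exact h
  · exact lt_of_le_of_lt (Nat.div_le_self _ _) ha
  · split <;> omega
  · split <;> omega

theorem eval_natOp {w : ℕ} {o : BinOp} {a b : ℕ} (ha : a < 2 ^ w) (hb : b < 2 ^ w)
    (h : OkOp w o a b) :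
    o.eval (BitVec.ofNat w a) (BitVec.ofNat w b) = BitVec.ofNat w (natOp o a b) := by
  have ha' := toNat_ofNat_of_lt ha
  have hb' := toNat_ofNat_of_lt hb
  cases o <;> simp only [natOp, OkOp, BinOp.eval] at *
  · rw [BitVec.ofNat_add]
  · obtain ⟨c, rfl⟩ := Nat.exists_eq_add_of_le h
    rw [BitVec.ofNat_add]; simp
  · rw [BitVec.ofNat_mul]
  · apply BitVec.eq_of_toNat_eq
    rw [BitVec.toNat_udiv, ha', hb', toNat_ofNat_of_lt]
    exact lt_of_le_of_lt (Nat.div_le_self _ _) ha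
  · apply BitVec.eq_of_toNat_eq
    rw [BitVec.toNat_umod, ha', hb', toNat_ofNat_of_lt]
    exact lt_of_le_of_lt (Nat.mod_le _ _) ha
  · apply BitVec.eq_of_toNat_eq
    rw [BitVec.toNat_and, ha', hb', toNat_ofNat_of_lt]
    exact Nat.and_lt_two_pow _ hb
  · apply BitVec.eq_of_toNat_eq
    rw [BitVec.toNat_or, ha', hb', toNat_ofNat_of_lt]
    exact Nat.or_lt_two_pow ha hb
  · apply BitVec.eq_of_toNat_eq
    rw [BitVec.toNat_xor, ha', hb', toNat_ofNat_of_lt]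
    exact Nat.xor_lt_two_pow ha hb
  · rw [hb']
    apply BitVec.eq_of_toNat_eq
    rw [BitVec.toNat_shiftLeft, ha', toNat_ofNat_of_lt h, Nat.shiftLeft_eq, Nat.mod_eq_of_lt h]
  · rw [hb']
    apply BitVec.eq_of_toNat_eq
    rw [BitVec.toNat_ushiftRight, ha', toNat_ofNat_of_lt, Nat.shiftRight_eq_div_pow]
    exact lt_of_le_of_lt (Nat.div_le_self _ _) ha
  · rw [ha', hb']; split <;> rfl
  · have : BitVec.ofNat w a = BitVec.ofNat w b ↔ a = b := by
      constructor
      · intro h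
        rw [← ha', ← hb', h]
      · rintro rfl; rfl
    simp only [this]; split <;> rfl

/-- `e` evaluates to the number `v`. -/
def Ev (w s : ℕ) (mem ρ : ℕ → ℕ) (e : Expr) (v : ℕ) : Prop :=
  v < 2 ^ w ∧ ∀ o, e.eval (mkData w s mem) (mkState w ρ o) = BitVec.ofNat w v

/-- The memory contents fit in words, and the addresses too. -/
structure MemOk (w s : ℕ) (mem : ℕ → ℕ) : Prop where
  one_le : 1 ≤ w
  size : s ≤ 2 ^ w
  lt : ∀ a < s, mem a < 2 ^ w

variable {w s : ℕ} {mem ρ : ℕ → ℕ} {o : List ℕ}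

/-- This reduces word arithmetic to side conditions in ℕ. Division and remainder need none, as both
semantics agree even for the divisor zero, and reads of the empty working memory give zero. -/
theorem ev_of_ok (hm : MemOk w s mem) (hρ : ∀ r, ρ r < 2 ^ w) {e : Expr}
    (h : Ok w s mem ρ e) : Ev w s mem ρ e (nev mem ρ e) := by
  induction e with
  | lit k => exact ⟨h, fun _ => rfl⟩
  | reg r => exact ⟨hρ r, fun _ => rfl⟩
  | data a ih =>
    obtain ⟨h1, h2⟩ := h
    obtain ⟨h3, h4⟩ := ih h1
    refine ⟨hm.lt _ h2, fun o => ?_⟩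
    simp only [Expr.eval, h4, fetch, toNat_ofNat_of_lt h3, dif_pos h2, mkData, nev]
  | work a ih =>
    exact ⟨Nat.two_pow_pos w, fun o => by simp [Expr.eval, fetch, nev]⟩
  | bin op x y ihx ihy =>
    obtain ⟨h1, h2, h3⟩ := h
    obtain ⟨h4, h5⟩ := ihx h1
    obtain ⟨h6, h7⟩ := ihy h2
    exact ⟨natOp_lt hm.one_le h4 h6 h3, fun o => by
      simp only [Expr.eval, h5, h7, nev, eval_natOp h4 h6 h3]⟩

/-- Started with registers `ρ` and output `o`, the program `P` halts, and the time, the registers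
and the output at the end satisfy `Q`. -/
def Run (w s : ℕ) (mem : ℕ → ℕ) (P : Prog) (ρ : ℕ → ℕ) (o : List ℕ)
    (Q : ℕ → (ℕ → ℕ) → List ℕ → Prop) : Prop :=
  (∀ r, ρ r < 2 ^ w) → ∃ t ρ' o', Exec (mkData w s mem) P (mkState w ρ o) t (mkState w ρ' o') ∧
    (∀ r, ρ' r < 2 ^ w) ∧ Q t ρ' o'

variable {P P' : Prog} {e : Expr} {v r : ℕ} {Q Q' : ℕ → (ℕ → ℕ) → List ℕ → Prop}

theorem Run.mono (h : Run w s mem P ρ o Q) (hQ : ∀ t ρ' o', Q t ρ' o' → Q' t ρ' o') :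
    Run w s mem P ρ o Q' := fun hρ => by
  obtain ⟨t, ρ', o', h1, h2, h3⟩ := h hρ
  exact ⟨t, ρ', o', h1, h2, hQ _ _ _ h3⟩

theorem Run.of_bounded (h : (∀ r, ρ r < 2 ^ w) → Run w s mem P ρ o Q) :
    Run w s mem P ρ o Q := fun hρ => h hρ hρ

theorem Run.skip (h : Q 1 ρ o) : Run w s mem .skip ρ o Q :=
  fun hρ => ⟨1, ρ, o, .skip _, hρ, h⟩

/-- Only the final value is required to fit in a word; this covers the one assignment of the program
whose intermediate products may wrap around. -/
theorem Run.assign_ev (he : Ev w s mem ρ e v)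
    (h : Q (e.cost + 1) (Function.update ρ r v) o) : Run w s mem (.assign r e) ρ o Q := fun hρ => by
  refine ⟨_, Function.update ρ r v, o, ?_, ?_, h⟩
  · have := Exec.assign (D := mkData w s mem) (mkState w ρ o) r e
    rw [he.2] at this
    convert this using 1
    simp only [mkState]
    congr 1
    funext x
    by_cases hx : x = r
    · subst hx; simp
    · simp [Function.update_of_ne hx]
  · intro x
    by_cases hx : x = r
    · subst hx; simpa using he.1
    · simpa [Function.update_of_ne hx] using hρ x

theorem Run.assign (hm : MemOk w s mem) (he : Ok w s mem ρ e)
    (h : Q (e.cost + 1) (Function.update ρ r (nev mem ρ e)) o) :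
    Run w s mem (.assign r e) ρ o Q :=
  .of_bounded fun hρ => .assign_ev (ev_of_ok hm hρ he) h

theorem Run.assign_eq (hm : MemOk w s mem) (he : Ok w s mem ρ e) (hv : nev mem ρ e = v)
    (h : Q (e.cost + 1) (Function.update ρ r v) o) :
    Run w s mem (.assign r e) ρ o Q :=
  .assign hm he (hv ▸ h)

theorem Run.emit (hm : MemOk w s mem) (he : Ok w s mem ρ e)
    (h : Q (e.cost + 1) ρ (o ++ [nev mem ρ e])) : Run w s mem (.emit e) ρ o Q := fun hρ => by
  refine ⟨_, ρ, _, ?_, hρ, h⟩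
  have := Exec.emit (D := mkData w s mem) (mkState w ρ o) e
  rw [(ev_of_ok hm hρ he).2] at this
  convert this using 1
  simp [mkState]

theorem Run.seq (h : Run w s mem P ρ o fun t ρ' o' =>
      Run w s mem P' ρ' o' fun t' ρ'' o'' => Q (t + t') ρ'' o'') :
    Run w s mem (.seq P P') ρ o Q := fun hρ => by
  obtain ⟨t, ρ', o', h1, h2, h3⟩ := h hρ
  obtain ⟨t', ρ'', o'', h4, h5, h6⟩ := h3 h2
  exact ⟨_, _, _, .seq h1 h4, h5, h6⟩

theorem Run.cond (hm : MemOk w s mem) (he : Ok w s mem ρ e)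
    (h1 : nev mem ρ e ≠ 0 → Run w s mem P ρ o fun t ρ' o' => Q (e.cost + 1 + t) ρ' o')
    (h2 : nev mem ρ e = 0 → Run w s mem P' ρ o fun t ρ' o' => Q (e.cost + 1 + t) ρ' o') :
    Run w s mem (.cond e P P') ρ o Q := fun hρ => by
  have hv := ev_of_ok hm hρ he
  by_cases h0 : nev mem ρ e = 0
  · obtain ⟨t, ρ', o', h3, h4, h5⟩ := h2 h0 hρ
    exact ⟨_, _, _, .cond_false (by rw [hv.2, h0]) h3, h4, h5⟩
  · obtain ⟨t, ρ', o', h3, h4, h5⟩ := h1 h0 hρ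
    refine ⟨_, _, _, .cond_true (fun h => h0 ?_) h3, h4, h5⟩
    rw [hv.2] at h
    have := congrArg BitVec.toNat h
    rwa [toNat_ofNat_of_lt hv.1, BitVec.toNat_ofNat, Nat.zero_mod] at this

theorem Run.loop (hm : MemOk w s mem) (he : Ok w s mem ρ e)
    (h1 : nev mem ρ e ≠ 0 → Run w s mem P ρ o fun t ρ' o' =>
      Run w s mem (.loop e P) ρ' o' fun t' ρ'' o'' => Q (e.cost + 1 + t + t') ρ'' o'')
    (h2 : nev mem ρ e = 0 → Q (e.cost + 1) ρ o) :
    Run w s mem (.loop e P) ρ o Q := fun hρ => by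
  have hv := ev_of_ok hm hρ he
  by_cases h0 : nev mem ρ e = 0
  · exact ⟨_, _, _, .loop_done (by rw [hv.2, h0]), hρ, h2 h0⟩
  · obtain ⟨t, ρ', o', h3, h4, h5⟩ := h1 h0 hρ
    obtain ⟨t', ρ'', o'', h6, h7, h8⟩ := h5 h4
    refine ⟨_, _, _, .loop_step (fun h => h0 ?_) h3 h6, h7, h8⟩
    rw [hv.2] at h
    have := congrArg BitVec.toNat h
    rwa [toNat_ofNat_of_lt hv.1, BitVec.toNat_ofNat, Nat.zero_mod] at this

/-! ### Abbreviations for programs -/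

abbrev rg (r : ℕ) : Expr := .reg r
abbrev nm (k : ℕ) : Expr := .lit k
abbrev plus (x y : Expr) : Expr := .bin .add x y
abbrev minus (x y : Expr) : Expr := .bin .sub x y
abbrev times (x y : Expr) : Expr := .bin .mul x y
abbrev quo (x y : Expr) : Expr := .bin .div x y
abbrev rem (x y : Expr) : Expr := .bin .mod x y
abbrev shl (x y : Expr) : Expr := .bin .shl x y
abbrev shr (x y : Expr) : Expr := .bin .shr x y
abbrev less (x y : Expr) : Expr := .bin .lt x y
abbrev same (x y : Expr) : Expr := .bin .eq x y

/-- Entry `e` of the array number `a`; the word at the address `a` is the start of the array. -/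
def entry (a e : Expr) : Expr := .data (.bin .add (.data a) e)

/-- Sequential composition of a list of programs. -/
def block : List Prog → Prog
  | [] => .skip
  | [P] => P
  | P :: Q :: l => .seq P (block (Q :: l))

/-- Entry `e` of the array number `a` can be read and is `v`. -/
def Rd (s : ℕ) (mem : ℕ → ℕ) (a e v : ℕ) : Prop :=
  a < s ∧ mem a + e < s ∧ mem (mem a + e) = v

theorem Rd.nev {a x : Expr} {v : ℕ} (h : Rd s mem (nev mem ρ a) (nev mem ρ x) v) :
    nev mem ρ (entry a x) = v := h.2.2

theorem Rd.ok (hm : MemOk w s mem) {a x : Expr} {v : ℕ} (ha : Ok w s mem ρ a)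
    (hx : Ok w s mem ρ x)
    (h : Rd s mem (RangeMajority.nev mem ρ a) (RangeMajority.nev mem ρ x) v) :
    Ok w s mem ρ (entry a x) :=
  ⟨⟨⟨ha, h.1⟩, hx, lt_of_lt_of_le h.2.1 hm.size⟩, h.2.1⟩

theorem cost_entry (a x : Expr) : (entry a x).cost = a.cost + x.cost + 3 := by
  simp only [entry, Expr.cost]; omega

end RangeMajority

namespace RangeMajority
open WordRAM

set_option linter.unusedSimpArgs false

variable {w s : ℕ} {mem ρ : ℕ → ℕ} {o : List ℕ}

/-! ### Division of a product of two words by a word -/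

section Division

variable {B C q R p l X1 X0 e : ℕ}

/-- Splitting R and p at C keeps both parts of the dividend within a word. Dividing the high part by
the divisor's high part, rounded up, gives a quotient that is too small by at most one, so the true
digit is `e - 1` or `e`. -/
theorem quotient_estimate (hB : 1 ≤ B) (hC : C = 4 * B) (hq : 16 * B * B ≤ q) (hR : R < q)
    (hp : p ≤ q) (hl : l < B) (hX1 : X1 = R / C * B + p / C * l)
    (hX0 : X0 = R % C * B + p % C * l) (he : e = X1 / (q / C + 1) + 1) :
    R * B + p * l = X1 * C + X0 ∧ X0 < 8 * B * B ∧ X1 ≤ q / C * (2 * B) ∧ e ≤ 2 * B ∧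
      (e - 1) * q ≤ R * B + p * l ∧ R * B + p * l < (e + 1) * q := by
  have hC0 : 0 < C := by omega
  have hV : R * B + p * l = X1 * C + X0 := by
    rw [hX1, hX0]
    conv_lhs => rw [← Nat.div_add_mod R C, ← Nat.div_add_mod p C]
    ring
  have hR1 : R / C ≤ q / C := Nat.div_le_div_right hR.le
  have hp1 : p / C ≤ q / C := Nat.div_le_div_right hp
  have hX0' : X0 < 8 * B * B := by
    have h1 : R % C * B < C * B := Nat.mul_lt_mul_of_pos_right (Nat.mod_lt _ hC0) (by omega)
    have h2 : p % C * l ≤ C * B := Nat.mul_le_mul (Nat.mod_lt _ hC0).le hl.le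
    have h3 : C * B = 4 * B * B := by rw [hC]
    have h4 : 4 * B * B = 4 * (B * B) := by ring
    have h5 : 8 * B * B = 8 * (B * B) := by ring
    omega
  have hX1' : X1 ≤ q / C * (2 * B) := by
    have h1 : R / C * B ≤ q / C * B := Nat.mul_le_mul_right _ hR1
    have h2 : p / C * l ≤ q / C * B := Nat.mul_le_mul hp1 hl.le
    have h3 : q / C * (2 * B) = q / C * B + q / C * B := by ring
    omega
  have he1 : e ≤ 2 * B := by
    have : X1 / (q / C + 1) < 2 * B := by
      rw [Nat.div_lt_iff_lt_mul (Nat.succ_pos _)]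
      nlinarith
    omega
  have hqd : C * (q / C) + q % C = q := Nat.div_add_mod q C
  have hqm : q % C < C := Nat.mod_lt _ hC0
  have hXd := Nat.div_add_mod X1 (q / C + 1)
  have hXm : X1 % (q / C + 1) < q / C + 1 := Nat.mod_lt _ (Nat.succ_pos _)
  refine ⟨hV, hX0', hX1', he1, ?_, ?_⟩
  · have h1 : e - 1 = X1 / (q / C + 1) := by rw [he, Nat.add_sub_cancel]
    have h2 : q ≤ C * (q / C + 1) := by nlinarith
    calc (e - 1) * q ≤ (e - 1) * (C * (q / C + 1)) := Nat.mul_le_mul_left _ h2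
      _ = C * ((q / C + 1) * (X1 / (q / C + 1))) := by rw [h1]; ring
      _ ≤ C * X1 := Nat.mul_le_mul_left _ (Nat.mul_div_le _ _)
      _ ≤ _ := by rw [hV]; nlinarith
  -- Two errors arise: `e * C` from rounding the divisor up, and `X0` from dropping the low part.
  -- Each is at most 8B², so together they stay within q.
  · have h1 : X1 < e * (q / C + 1) := by rw [he]; nlinarith
    have h2 : (X1 + 1) * C ≤ e * (q / C + 1) * C := Nat.mul_le_mul_right _ h1
    have h3 : e * C ≤ 2 * B * C := Nat.mul_le_mul_right _ he1
    have h4 : e * (C * (q / C)) ≤ e * q := Nat.mul_le_mul_left _ (by omega)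
    have e1 : (X1 + 1) * C = X1 * C + C := by ring
    have e2 : e * (q / C + 1) * C = e * (C * (q / C)) + e * C := by ring
    have e3 : 2 * B * C = 8 * (B * B) := by rw [hC]; ring
    have e4 : 8 * B * B = 8 * (B * B) := by ring
    have e5 : 16 * B * B = 16 * (B * B) := by ring
    have e6 : (e + 1) * q = e * q + q := by ring
    omega

/-- Once the carries of the low parts are moved up, the order is lexicographic. Both sides may
exceed a word while all four components fit. -/
theorem lex_compare {C x1 x0 y1 y0 : ℕ} (hC : 0 < C) :
    (y1 + y0 / C < x1 + x0 / C ∨ (y1 + y0 / C = x1 + x0 / C ∧ y0 % C < x0 % C + 1)) ↔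
      y1 * C + y0 ≤ x1 * C + x0 := by
  have h1 := Nat.div_add_mod y0 C
  have h2 := Nat.div_add_mod x0 C
  have h3 := Nat.mod_lt y0 hC
  have h4 := Nat.mod_lt x0 hC
  have e1 : y1 * C + y0 = C * (y1 + y0 / C) + y0 % C := by nlinarith
  have e2 : x1 * C + x0 = C * (x1 + x0 / C) + x0 % C := by nlinarith
  rw [e1, e2]
  constructor
  · rintro (h | ⟨h, h'⟩)
    · have : C * (y1 + y0 / C + 1) ≤ C * (x1 + x0 / C) := Nat.mul_le_mul_left _ h
      rw [Nat.mul_add, Nat.mul_one] at this; omega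
    · rw [h]; omega
  · intro h
    rcases lt_trichotomy (y1 + y0 / C) (x1 + x0 / C) with h5 | h5 | h5
    · exact Or.inl h5
    · rw [h5] at h; exact Or.inr ⟨h5, by omega⟩
    · exfalso
      have : C * (x1 + x0 / C + 1) ≤ C * (y1 + y0 / C) := Nat.mul_le_mul_left _ h5
      rw [Nat.mul_add, Nat.mul_one] at this; omega

end Division

/-- One digit of the long division: registers `2, 3` hold `p, q`, register `5` the base, `6, 7` the
quotient and the remainder so far, and `8` the next digit of the multiplier of `p`. -/
def divisionStep : Prog :=
  .cond (less (rg 3) (times (times (nm 16) (rg 5)) (rg 5)))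
    (block [
      .assign 9 (plus (times (rg 7) (rg 5)) (times (rg 2) (rg 8))),
      .assign 6 (plus (times (rg 6) (rg 5)) (quo (rg 9) (rg 3))),
      .assign 7 (rem (rg 9) (rg 3))])
    (block [
      .assign 10 (times (nm 4) (rg 5)),
      .assign 11 (plus (times (quo (rg 7) (rg 10)) (rg 5)) (times (quo (rg 2) (rg 10)) (rg 8))),
      .assign 12 (plus (times (rem (rg 7) (rg 10)) (rg 5)) (times (rem (rg 2) (rg 10)) (rg 8))),
      .assign 13 (plus (quo (rg 11) (plus (quo (rg 3) (rg 10)) (nm 1))) (nm 1)),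
      .assign 14 (plus (times (rg 13) (quo (rg 3) (rg 10)))
        (quo (times (rg 13) (rem (rg 3) (rg 10))) (rg 10))),
      .assign 15 (rem (times (rg 13) (rem (rg 3) (rg 10))) (rg 10)),
      .assign 16 (plus (rg 11) (quo (rg 12) (rg 10))),
      .assign 17 (rem (rg 12) (rg 10)),
      .assign 18 (plus (less (rg 14) (rg 16))
        (times (same (rg 14) (rg 16)) (less (rg 15) (plus (rg 17) (nm 1))))),
      .assign 13 (minus (plus (rg 13) (rg 18)) (nm 1)),
      .assign 7 (minus (plus (times (rg 7) (rg 5)) (times (rg 2) (rg 8))) (times (rg 13) (rg 3))),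
      .assign 6 (plus (times (rg 6) (rg 5)) (rg 13))])

theorem ev_reg (hρ : ∀ r, ρ r < 2 ^ w) (r : ℕ) : Ev w s mem ρ (rg r) (ρ r) :=
  ⟨hρ r, fun _ => rfl⟩

/-- Word arithmetic is exact modulo 2^w, so a remainder that fits in a word comes out right even if
the products wrap around. -/
theorem ev_sub_mod {a b c d u v : Expr} {A B C D U V X : ℕ} (ha : Ev w s mem ρ a A)
    (hb : Ev w s mem ρ b B) (hc : Ev w s mem ρ c C) (hd : Ev w s mem ρ d D)
    (hu : Ev w s mem ρ u U) (hv : Ev w s mem ρ v V) (h : A * B + C * D = U * V + X)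
    (hX : X < 2 ^ w) :
    Ev w s mem ρ (minus (plus (times a b) (times c d)) (times u v)) X := by
  refine ⟨hX, fun o => ?_⟩
  simp only [Expr.eval, ha.2, hb.2, hc.2, hd.2, hu.2, hv.2, BinOp.eval]
  rw [← BitVec.ofNat_mul, ← BitVec.ofNat_mul, ← BitVec.ofNat_mul, ← BitVec.ofNat_add, h,
    BitVec.ofNat_add]
  simp

set_option maxHeartbeats 1000000 in
-- Here `u` is the part of the multiplier read so far, and the invariant is quotient · q + remainder
-- = p · u. Since p ≤ q, the quotient never exceeds the multiplier, hence fits in a word.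
theorem run_divisionStep (hm : MemOk w s mem) (hw : 32 * ρ 5 * ρ 5 * ρ 5 ≤ 2 ^ w) (hB : 1 ≤ ρ 5)
    (hp : ρ 2 ≤ ρ 3) (hR : ρ 7 < ρ 3) (hl : ρ 8 < ρ 5) {u : ℕ}
    (hu : ρ 6 * ρ 3 + ρ 7 = ρ 2 * u) (hub : u * ρ 5 + ρ 8 < 2 ^ w) :
    Run w s mem divisionStep ρ o fun t ρ' o' => t ≤ 300 ∧ o' = o ∧ (∀ r ≤ 5, ρ' r = ρ r) ∧
      ρ' 7 < ρ 3 ∧ ρ' 6 * ρ 3 + ρ' 7 = ρ 2 * (u * ρ 5 + ρ 8) := by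
  refine Run.of_bounded fun hρ => ?_
  have hq2 := hρ 3
  generalize h5 : ρ 5 = B at *
  generalize h3 : ρ 3 = q at *
  generalize h2 : ρ 2 = p at *
  generalize h7 : ρ 7 = R at *
  generalize h6 : ρ 6 = A at *
  generalize h8 : ρ 8 = l at *
  have hq0 : 0 < q := by omega
  have hBB : B ≤ B * B := Nat.le_mul_of_pos_left _ hB
  have hBBB : B * B ≤ B * B * B := Nat.le_mul_of_pos_right _ hB
  have hw' : 32 * (B * B * B) ≤ 2 ^ w := by linarith
  have hmain : ∀ d r', R * B + p * l = d * q + r' → r' < q →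
      (A * B + d) * q + r' = p * (u * B + l) ∧ A * B + d < 2 ^ w := by
    intro d r' h hr
    have e1 : (A * B + d) * q + r' = p * (u * B + l) := by
      calc (A * B + d) * q + r' = A * q * B + (d * q + r') := by ring
        _ = (A * q + R) * B + p * l := by rw [← h]; ring
        _ = _ := by rw [hu]; ring
    refine ⟨e1, lt_of_le_of_lt ?_ hub⟩
    refine Nat.le_of_mul_le_mul_right ?_ hq0
    calc (A * B + d) * q ≤ p * (u * B + l) := by omega
      _ ≤ q * (u * B + l) := Nat.mul_le_mul_right _ hp
      _ = _ := mul_comm _ _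
  have hd1 : A * B ≤ A * B + (R * B + p * l) / q := Nat.le_add_right _ _
  obtain ⟨hm1, hm2⟩ := hmain _ _ (Nat.div_add_mod' _ q).symm
    (Nat.mod_lt (R * B + p * l) hq0)
  have h16 : 16 * B * B = 16 * (B * B) := by ring
  refine Run.cond hm ?_ ?_ ?_
  · simp only [Ok, OkOp, nev, natOp, h5]
    refine ⟨trivial, ⟨⟨?_, trivial, ?_⟩, trivial, ?_⟩, trivial⟩ <;> omega
  · intro hc
    simp only [nev, natOp, h5, h3, ne_eq, ite_eq_right_iff, one_ne_zero, imp_false, not_not] at hc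
    -- For q < 16B² both products are at most 16B³, so their sum fits in a word and the digit is
    -- computed directly.
    have hRB : R * B ≤ 16 * B * B * B := Nat.mul_le_mul_right _ (by omega)
    have hpl : p * l ≤ 16 * B * B * (B - 1) := Nat.mul_le_mul (by omega) (by omega)
    have hpl2 : 16 * B * B * (B - 1) < 16 * B * B * B :=
      Nat.mul_lt_mul_of_pos_left (by omega) (by positivity)
    have hsum : R * B + p * l < 2 ^ w := by
      have : 16 * B * B * B = 16 * (B * B * B) := by ring
      omega
    simp only [block]
    refine Run.seq (Run.assign_eq hm ?_ rfl (Run.seq (Run.assign_eq hm ?_ rfl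
      (Run.assign_eq hm ?_ rfl ?_))))
    · simp only [Ok, OkOp, nev, natOp, h5, h2, h7, h8]
      refine ⟨⟨trivial, trivial, by omega⟩, ⟨trivial, trivial, by omega⟩, hsum⟩
    · simp [Ok, OkOp, nev, natOp, h5, h3, h2, h7, h8, h6]
      exact ⟨by omega, hm2⟩
    · simp [Ok, OkOp]
    · simp [Expr.cost, nev, natOp, h5, h3, h2, h7, h8, h6, hm1, Nat.mod_lt _ hq0]
      intro r hr
      simp [Function.update_apply, show r ≠ 7 by omega, show r ≠ 6 by omega, show r ≠ 9 by omega]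
  · intro hc
    simp only [nev, natOp, h5, h3, ite_eq_right_iff, one_ne_zero, imp_false, not_lt] at hc
    obtain ⟨hV, hX0, hX1, he, hlo, hhi⟩ := quotient_estimate hB rfl hc hR hp hl rfl rfl rfl
    have hlex := lex_compare (C := 4 * B) (x1 := R / (4 * B) * B + p / (4 * B) * l)
      (x0 := R % (4 * B) * B + p % (4 * B) * l)
      (y1 := ((R / (4 * B) * B + p / (4 * B) * l) / (q / (4 * B) + 1) + 1) * (q / (4 * B)))
      (y0 := ((R / (4 * B) * B + p / (4 * B) * l) / (q / (4 * B) + 1) + 1) * (q % (4 * B)))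
      (by omega)
    have hqd : 4 * B * (q / (4 * B)) + q % (4 * B) = q := Nat.div_add_mod q (4 * B)
    have hqm : q % (4 * B) < 4 * B := Nat.mod_lt _ (by omega)
    generalize hq1 : q / (4 * B) = q1 at *
    generalize hq0' : q % (4 * B) = q0 at *
    generalize hx1 : R / (4 * B) * B = x1 at *
    generalize hx2 : p / (4 * B) * l = x2 at *
    generalize hx3 : R % (4 * B) * B = x3 at *
    generalize hx4 : p % (4 * B) * l = x4 at *
    generalize hE : (x1 + x2) / (q1 + 1) = E at *
    have hy : (E + 1) * q1 * (4 * B) + (E + 1) * q0 = (E + 1) * q := by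
      rw [← hqd]; ring
    rw [hy, ← hV] at hlex
    have hq1b : q1 * (2 * B) * 2 ≤ q := by
      have : q1 * (2 * B) * 2 = 4 * B * q1 := by ring
      omega
    have hy1 : (E + 1) * q1 ≤ q1 * (2 * B) := by
      rw [mul_comm]; exact Nat.mul_le_mul_left _ he
    have hy0 : (E + 1) * q0 ≤ 8 * B * B := by
      calc (E + 1) * q0 ≤ (2 * B) * (4 * B) := Nat.mul_le_mul he hqm.le
        _ = _ := by ring
    have hy0d : (E + 1) * q0 / (4 * B) ≤ (E + 1) * q0 := Nat.div_le_self _ _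
    have hx0d : (x3 + x4) / (4 * B) ≤ x3 + x4 := Nat.div_le_self _ _
    have hx0m : (x3 + x4) % (4 * B) ≤ x3 + x4 := Nat.mod_le _ _
    have h8B : 8 * B * B = 8 * (B * B) := by ring
    rw [h8B] at hX0 hy0
    have h2B : 2 * B ≤ 2 * (B * B) := by omega
    simp only [block]
    have hone : 1 ≤ B * B * B := by omega
    -- The estimate is E + 1. The bit δ records whether (E + 1)q does not exceed the dividend, so
    -- the true digit is E + δ.
    obtain ⟨δ, hδ⟩ : ∃ δ, natOp .add (natOp .lt (((E + 1) * q1) + (E + 1) * q0 / (4 * B))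
        ((x1 + x2) + (x3 + x4) / (4 * B))) (natOp .mul (natOp .eq
        (((E + 1) * q1) + (E + 1) * q0 / (4 * B)) ((x1 + x2) + (x3 + x4) / (4 * B)))
        (natOp .lt ((E + 1) * q0 % (4 * B)) ((x3 + x4) % (4 * B) + 1))) = δ := ⟨_, rfl⟩
    have hδ' : (δ = 1 ∧ (E + 1) * q ≤ R * B + p * l) ∨ (δ = 0 ∧ R * B + p * l < (E + 1) * q) := by
      rw [← hδ]
      by_cases hcmp : (E + 1) * q ≤ R * B + p * l
      · left
        refine ⟨?_, hcmp⟩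
        rcases hlex.2 hcmp with h | ⟨h, h'⟩
        · simp [natOp, h, h.ne]
        · simp [natOp, h, h']
      · right
        refine ⟨?_, by omega⟩
        have h1 := mt hlex.1 hcmp
        push Not at h1
        obtain ⟨h1, h1'⟩ := h1
        simp only [natOp, if_neg (not_lt.2 h1)]
        by_cases h2 : (E + 1) * q1 + (E + 1) * q0 / (4 * B) = x1 + x2 + (x3 + x4) / (4 * B)
        · simp [h2, not_lt.2 (h1' h2)]
        · simp [h2]
    obtain ⟨X, hX, hXq⟩ : ∃ X, R * B + p * l = (E + δ) * q + X ∧ X < q := by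
      rcases hδ' with ⟨rfl, h⟩ | ⟨rfl, h⟩
      · refine ⟨R * B + p * l - (E + 1) * q, by omega, ?_⟩
        have : (E + 1 + 1) * q = (E + 1) * q + q := by ring
        omega
      · have h' : (E + 1) * q = E * q + q := by ring
        have : (E + 1 - 1) * q = E * q := by simp
        refine ⟨R * B + p * l - E * q, ?_, by omega⟩
        rw [add_zero]; omega
    obtain ⟨hm3, hm4⟩ := hmain _ _ hX hXq
    have hδ1 : δ ≤ 1 := by rcases hδ' with ⟨rfl, -⟩ | ⟨rfl, -⟩ <;> omega
    simp only [natOp] at hδ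
    generalize hqc : 4 * B = qc at *
    have hw0 : ¬ w = 0 := by have := hm.one_le; omega
    have hq1q : q1 ≤ q1 * (2 * B) := Nat.le_mul_of_pos_right _ (by omega)
    obtain ⟨Y1, hY1⟩ : ∃ Y1, Y1 = (E + 1) * q1 + (E + 1) * q0 / qc := ⟨_, rfl⟩
    obtain ⟨Y0, hY0⟩ : ∃ Y0, Y0 = (E + 1) * q0 % qc := ⟨_, rfl⟩
    obtain ⟨Z1, hZ1⟩ : ∃ Z1, Z1 = x1 + x2 + (x3 + x4) / qc := ⟨_, rfl⟩
    obtain ⟨Z0, hZ0⟩ : ∃ Z0, Z0 = (x3 + x4) % qc := ⟨_, rfl⟩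
    rw [← hY1, ← hY0, ← hZ1, ← hZ0] at hδ
    have hEδ : E + 1 + δ - 1 = E + δ := by omega
    refine Run.seq (Run.assign_eq hm (v := qc) ?_ ?_ ?_)
    · simp only [Ok, OkOp, nev, natOp, h5]; refine ⟨?_, trivial, ?_⟩ <;> omega
    · simp [nev, natOp, h5, hqc]
    refine Run.seq (Run.assign_eq hm (v := x1 + x2) ?_ ?_ ?_)
    · simp [Ok, OkOp, nev, natOp, h5, h2, h7, h8, hx1, hx2]; omega
    · simp [nev, natOp, h5, h2, h7, h8, hx1, hx2]
    refine Run.seq (Run.assign_eq hm (v := x3 + x4) ?_ ?_ ?_)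
    · simp [Ok, OkOp, nev, natOp, h5, h2, h7, h8, hx3, hx4]; omega
    · simp [nev, natOp, h5, h2, h7, h8, hx3, hx4]
    refine Run.seq (Run.assign_eq hm (v := E + 1) ?_ ?_ ?_)
    · simp [Ok, OkOp, nev, natOp, h3, hq1, hE, hw0]; omega
    · simp [nev, natOp, h3, hq1, hE]
    refine Run.seq (Run.assign_eq hm (v := Y1) ?_ ?_ ?_)
    · simp [Ok, OkOp, nev, natOp, h3, hq1, hq0']; omega
    · simp [nev, natOp, h3, hq1, hq0', hY1]
    refine Run.seq (Run.assign_eq hm (v := Y0) ?_ ?_ ?_)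
    · simp [Ok, OkOp, nev, natOp, h3, hq0']; omega
    · simp [nev, natOp, h3, hq0', hY0]
    refine Run.seq (Run.assign_eq hm (v := Z1) ?_ ?_ ?_)
    · simp [Ok, OkOp, nev, natOp]; omega
    · simp [nev, natOp, hZ1]
    refine Run.seq (Run.assign_eq hm (v := Z0) ?_ ?_ ?_)
    · simp [Ok, OkOp]
    · simp [nev, natOp, hZ0]
    refine Run.seq (Run.assign_eq hm (v := δ) ?_ ?_ ?_)
    · have e1 : Z0 + 1 < 2 ^ w := by omega
      have e2 : (if Y1 < Z1 then 1 else 0) + (if Y1 = Z1 then 1 else 0) *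
        (if Y0 < Z0 + 1 then 1 else 0) < 2 ^ w := by rw [hδ]; omega
      have e3 : (if Y1 = Z1 then 1 else 0) * (if Y0 < Z0 + 1 then 1 else 0) < 2 ^ w :=
        lt_of_le_of_lt (Nat.le_add_left _ _) e2
      simp only [Ok, OkOp, nev, natOp, Function.update_apply, Nat.reduceEqDiff, if_false, if_true]
      exact ⟨⟨trivial, trivial, trivial⟩, ⟨⟨trivial, trivial, trivial⟩,
        ⟨trivial, ⟨trivial, by omega, e1⟩, trivial⟩, e3⟩, e2⟩
    · simp only [nev, natOp, Function.update_apply, Nat.reduceEqDiff, if_false, if_true]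
      exact hδ
    refine Run.seq (Run.assign_eq hm (v := E + δ) ?_ ?_ ?_)
    · simp [Ok, OkOp, nev, natOp]; omega
    · simp [nev, natOp, hEδ]
    refine Run.seq (Run.of_bounded fun hρ' => Run.assign_ev (v := X) (ev_sub_mod (ev_reg hρ' 7)
      (ev_reg hρ' 5) (ev_reg hρ' 2) (ev_reg hρ' 8) (ev_reg hρ' 13) (ev_reg hρ' 3) ?_
      (hXq.trans hq2)) ?_)
    · simp only [Function.update_apply, Nat.reduceEqDiff, if_false, if_true, h5, h3, h2, h7, h8]
      exact hX
    refine Run.assign_eq hm (v := A * B + (E + δ)) ?_ ?_ ?_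
    · have : A * B < 2 ^ w := by omega
      simp only [Ok, OkOp, nev, natOp, Function.update_apply, Nat.reduceEqDiff, if_false, if_true,
        h5, h6]
      exact ⟨⟨trivial, trivial, this⟩, trivial, hm4⟩
    · simp only [nev, natOp, Function.update_apply, Nat.reduceEqDiff, if_false, if_true, h5, h6]
    · refine ⟨by decide, rfl, ?_, ?_, ?_⟩
      · intro r hr
        have h : ∀ {ρ : ℕ → ℕ} {x : ℕ} (r'), 5 < r' → Function.update ρ r' x r = ρ r :=
          fun r' h => Function.update_of_ne (by omega) _ _
        rw [h, h, h, h, h, h, h, h, h, h, h, h] <;> norm_num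
      · simpa only [Function.update_apply, Nat.reduceEqDiff, if_false, if_true] using hXq
      · simpa only [Function.update_apply, Nat.reduceEqDiff, if_false, if_true] using hm3

end RangeMajority

namespace RangeMajority
open WordRAM

set_option linter.unusedSimpArgs false

variable {w s : ℕ} {mem ρ : ℕ → ℕ} {o : List ℕ}

/-- Register `4` gets the length `L` of the range, and register `6` the least `T` with
`p * L ≤ T * q`. -/
def thresholdProg : Prog :=
  block [
    .assign 4 (plus (minus (rg 1) (rg 0)) (nm 1)),
    .assign 5 (entry (nm 0) (nm 0)),
    .assign 6 (nm 0),
    .assign 7 (nm 0),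
    .assign 8 (quo (rg 4) (times (rg 5) (rg 5))),
    divisionStep,
    .assign 8 (rem (quo (rg 4) (rg 5)) (rg 5)),
    divisionStep,
    .assign 8 (rem (rg 4) (rg 5)),
    divisionStep,
    .assign 6 (plus (rg 6) (less (nm 0) (rg 7)))]

/-- As L < B³, three digits suffice: the prefixes of the multiplier are 0, L/B², L/B and L. The last
step of the program rounds the quotient up. -/
theorem run_thresholdProg (hm : MemOk w s mem) {B : ℕ} (hB : 1 ≤ B)
    (hw : 32 * B * B * B ≤ 2 ^ w) (hrd : Rd s mem 0 0 B) (hij : ρ 0 ≤ ρ 1) (hp : 1 ≤ ρ 2)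
    (hpq : ρ 2 ≤ ρ 3) (hL : ρ 1 - ρ 0 + 1 < B * B * B) :
    Run w s mem thresholdProg ρ o fun t ρ' o' => t ≤ 1200 ∧ o' = o ∧ (∀ r ≤ 3, ρ' r = ρ r) ∧
      ρ' 4 = ρ 1 - ρ 0 + 1 ∧ ∀ c, ρ' 6 ≤ c ↔ ρ 2 * (ρ 1 - ρ 0 + 1) ≤ c * ρ 3 := by
  obtain ⟨L, hLdef⟩ : ∃ L, L = ρ 1 - ρ 0 + 1 := ⟨_, rfl⟩
  rw [← hLdef] at hL ⊢
  have hBB : B ≤ B * B := Nat.le_mul_of_pos_left _ hB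
  have hBBB : B * B ≤ B * B * B := Nat.le_mul_of_pos_right _ hB
  have hw' : 32 * (B * B * B) ≤ 2 ^ w := by
    have : 32 * B * B * B = 32 * (B * B * B) := by ring
    omega
  have hw0 : ¬ w = 0 := by have := hm.one_le; omega
  have hLw : L < 2 ^ w := by omega
  have hB0 : 0 < B := hB
  have d1 : L / (B * B) < B := by rwa [Nat.div_lt_iff_lt_mul (by positivity), ← mul_assoc]
  have d2 : L / (B * B) * B + L / B % B = L / B := by
    rw [← Nat.div_div_eq_div_mul]; exact Nat.div_add_mod' _ _
  have d3 : L / B * B + L % B = L := Nat.div_add_mod' _ _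
  have d4 : L / B ≤ L := Nat.div_le_self _ _
  have d5 : L / (B * B) ≤ L := Nat.div_le_self _ _
  simp only [thresholdProg, block]
  refine Run.seq (Run.assign_eq hm (v := L) ?_ ?_ ?_)
  · simp [Ok, OkOp, nev, natOp, hij, hw0, ← hLdef, hLw]
  · simp [nev, natOp, hLdef]
  refine Run.seq (Run.assign_eq hm (v := B) ?_ ?_ ?_)
  · exact hrd.ok hm (Nat.two_pow_pos w) (Nat.two_pow_pos w)
  · exact hrd.nev
  refine Run.seq (Run.assign_eq hm (v := 0) ?_ ?_ ?_)
  · exact Nat.two_pow_pos w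
  · rfl
  refine Run.seq (Run.assign_eq hm (v := 0) ?_ ?_ ?_)
  · exact Nat.two_pow_pos w
  · rfl
  refine Run.seq (Run.assign_eq hm (v := L / (B * B)) ?_ ?_ ?_)
  · simp [Ok, OkOp, nev, natOp]; omega
  · simp [nev, natOp]
  refine Run.seq ((run_divisionStep hm (u := 0) ?_ ?_ ?_ ?_ ?_ ?_ ?_).mono ?_)
  iterate 7 simp; try omega
  rintro t1 ρ1 o1 ⟨ht1, ho1, hr1, hq1, he1⟩
  simp only [Function.update_apply, Nat.reduceEqDiff, if_false, if_true, zero_mul, zero_add]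
    at he1 hq1
  have g : ∀ r, r ≤ 5 → ρ1 r = if r = 5 then B else if r = 4 then L else ρ r := by
    intro r hr
    rw [hr1 r hr]
    simp only [Function.update_apply]
    split_ifs <;> first | rfl | omega
  have g2 := g 2 (by omega)
  have g3 := g 3 (by omega)
  have g4 := g 4 (by omega)
  have g5 := g 5 (by omega)
  simp only [Nat.reduceEqDiff, if_false, if_true] at g2 g3 g4 g5
  refine Run.seq (Run.assign_eq hm (v := L / B % B) ?_ ?_ ?_)
  · simp [Ok, OkOp]
  · simp [nev, natOp, g4, g5]
  refine Run.seq ((run_divisionStep hm (u := L / (B * B)) ?_ ?_ ?_ ?_ ?_ ?_ ?_).mono ?_)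
  iterate 7 simp [g2, g3, g4, g5, hw, hB, hpq, hq1, he1, Nat.mod_lt _ hB0, d2]; try omega
  rintro t2 ρ2 o2 ⟨ht2, ho2, hr2, hq2, he2⟩
  simp only [Function.update_apply, Nat.reduceEqDiff, if_false, if_true, g2, g3, g5, d2]
    at he2 hq2
  have g' : ∀ r, r ≤ 5 → ρ2 r = ρ1 r := by
    intro r hr
    rw [hr2 r hr]
    simp only [Function.update_apply]
    split_ifs <;> first | rfl | omega
  have g2' := (g' 2 (by omega)).trans g2
  have g3' := (g' 3 (by omega)).trans g3
  have g4' := (g' 4 (by omega)).trans g4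
  have g5' := (g' 5 (by omega)).trans g5
  refine Run.seq (Run.assign_eq hm (v := L % B) ?_ ?_ ?_)
  · simp [Ok, OkOp]
  · simp [nev, natOp, g4', g5']
  refine Run.seq ((run_divisionStep hm (u := L / B) ?_ ?_ ?_ ?_ ?_ ?_ ?_).mono ?_)
  iterate 7 simp [g2', g3', g4', g5', hw, hB, hpq, hq2, he2, Nat.mod_lt _ hB0, d3]; try omega
  rintro t3 ρ3 o3 ⟨ht3, ho3, hr3, hq3, he3⟩
  simp only [Function.update_apply, Nat.reduceEqDiff, if_false, if_true, g2', g3', g5', d3]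
    at he3 hq3
  have hq0 : 0 < ρ 3 := by omega
  have h6 : ρ3 6 ≤ L := by
    refine Nat.le_of_mul_le_mul_right ?_ hq0
    calc ρ3 6 * ρ 3 ≤ ρ 2 * L := by omega
      _ ≤ ρ 3 * L := Nat.mul_le_mul_right _ hpq
      _ = _ := mul_comm _ _
  refine Run.assign_eq hm (v := ρ3 6 + if 0 < ρ3 7 then 1 else 0) ?_ ?_ ?_
  · have : (if 0 < ρ3 7 then 1 else 0) ≤ 1 := by split <;> omega
    have h7 : ρ3 6 + (if 0 < ρ3 7 then 1 else 0) < 2 ^ w := by omega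
    exact ⟨trivial, ⟨Nat.two_pow_pos w, trivial, trivial⟩, h7⟩
  · rfl
  · refine ⟨?_, by rw [ho3, ho2, ho1], ?_, ?_, ?_⟩
    · simp only [Expr.cost, entry]; omega
    · intro r hr
      simp only [Function.update_apply, if_neg (show r ≠ 6 by omega)]
      rw [hr3 r (by omega), Function.update_of_ne (by omega), g' r (by omega), g r (by omega),
        if_neg (by omega), if_neg (by omega)]
    · rw [Function.update_of_ne (by norm_num), hr3 4 (by norm_num),
        Function.update_of_ne (by norm_num), g4']
    · intro c
      rw [Function.update_self, ← he3]
      by_cases h7 : 0 < ρ3 7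
      · rw [if_pos h7]
        constructor
        · intro h
          have : (ρ3 6 + 1) * ρ 3 ≤ c * ρ 3 := Nat.mul_le_mul_right _ h
          have e : (ρ3 6 + 1) * ρ 3 = ρ3 6 * ρ 3 + ρ 3 := by ring
          omega
        · intro h
          have : ρ3 6 * ρ 3 < c * ρ 3 := by omega
          exact Nat.lt_of_mul_lt_mul_right this
      · rw [if_neg h7, show ρ3 7 = 0 by omega, add_zero, add_zero]
        exact (Nat.mul_le_mul_right_iff hq0).symm

end RangeMajority

namespace RangeMajority

/-! ### The occurrences of all symbols in sorted order -/

/-- The string `sy`, with the value `σ` from the position `n` on. -/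
structure IsText (n σ : ℕ) (sy : ℕ → ℕ) : Prop where
  lt : ∀ p < n, sy p < σ
  eq : ∀ p, n ≤ p → sy p = σ

/-- The keys `sy p * N + p` of the positions `p`, and all numbers from `σ * N` on. -/
def IsKey (sy : ℕ → ℕ) (σ N x : ℕ) : Prop :=
  (x < σ * N ∧ sy (x % N) = x / N) ∨ σ * N ≤ x

instance (sy : ℕ → ℕ) (σ N : ℕ) : DecidablePred (IsKey sy σ N) := fun x => by
  unfold IsKey; infer_instance

/-- The key number `r`. -/
noncomputable def key (sy : ℕ → ℕ) (σ N r : ℕ) : ℕ := Nat.nth (IsKey sy σ N) r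

/-- The number of keys below `x`. -/
def rank (sy : ℕ → ℕ) (σ N x : ℕ) : ℕ := Nat.count (IsKey sy σ N) x

/-- The number of occurrences of `a` at positions from `u` to `v - 1`. -/
def occ (sy : ℕ → ℕ) (a u v : ℕ) : ℕ := ((Finset.Ico u v).filter fun p => sy p = a).card

/-- The position of the key number `r`. -/
noncomputable def keyPos (sy : ℕ → ℕ) (σ N r : ℕ) : ℕ :=
  if key sy σ N r < σ * N then key sy σ N r % N else N

/-- The symbol of the key number `r`. -/
noncomputable def keySym (sy : ℕ → ℕ) (σ N r : ℕ) : ℕ :=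
  if key sy σ N r < σ * N then key sy σ N r / N else 0

variable {n σ N : ℕ} {sy : ℕ → ℕ} {a u v p r x z : ℕ}

theorem isKey_infinite : (Set.ofPred (IsKey sy σ N)).Infinite :=
  Set.infinite_of_not_bddAbove fun ⟨b, hb⟩ => by
    have : σ * N + b + 1 ≤ b := hb (Or.inr (by omega) : IsKey sy σ N (σ * N + b + 1))
    omega

theorem key_strictMono : StrictMono (key sy σ N) := Nat.nth_strictMono isKey_infinite

theorem key_lt_iff : key sy σ N r < x ↔ r < rank sy σ N x := by
  have := Nat.count_le_iff_le_nth (isKey_infinite (sy := sy) (σ := σ) (N := N)) (a := x) (b := r)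
  rw [key, rank, ← not_le, ← this, not_le]

theorem le_key_iff : x ≤ key sy σ N r ↔ rank sy σ N x ≤ r := by
  rw [← not_lt, key_lt_iff, not_lt]

theorem isKey_key : IsKey sy σ N (key sy σ N r) := Nat.nth_mem_of_infinite isKey_infinite r

theorem rank_mono {y : ℕ} (h : x ≤ y) : rank sy σ N x ≤ rank sy σ N y := Nat.count_monotone _ h

theorem occ_mono {u' v' : ℕ} (hu : u' ≤ u) (hv : v ≤ v') : occ sy a u v ≤ occ sy a u' v' :=
  Finset.card_le_card (Finset.filter_subset_filter _ (Finset.Ico_subset_Ico hu hv))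

/-- The bound v ≤ N keeps the interval inside the N numbers that belong to a, where adding a·N turns
occurrences of a into keys. -/
theorem rank_add (ha : a < σ) (huv : u ≤ v) (hv : v ≤ N) :
    rank sy σ N (a * N + v) = rank sy σ N (a * N + u) + occ sy a u v := by
  obtain ⟨d, rfl⟩ := Nat.exists_eq_add_of_le huv
  rw [rank, ← add_assoc, Nat.count_add, ← rank, Nat.count_eq_card_filter_range]
  congr 1
  refine Finset.card_bij' (fun t _ => u + t) (fun p _ => p - u) ?_ ?_ ?_ ?_
  · intro t ht
    simp only [Finset.mem_filter, Finset.mem_range, Finset.mem_Ico] at ht ⊢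
    refine ⟨⟨by omega, by omega⟩, ?_⟩
    have h1 : a * N + N ≤ σ * N := by rw [← Nat.succ_mul]; exact Nat.mul_le_mul_right _ ha
    have h2 : (a * N + u + t) % N = u + t := by
      rw [add_assoc, Nat.add_comm, Nat.add_mul_mod_self_right]; exact Nat.mod_eq_of_lt (by omega)
    have h3 : (a * N + u + t) / N = a := by
      rw [add_assoc, Nat.add_comm, Nat.add_mul_div_right _ _ (by omega),
        Nat.div_eq_of_lt (by omega), zero_add]
    rcases ht.2 with ⟨-, h⟩ | h
    · rwa [h2, h3] at h
    · omega
  · intro p hp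
    simp only [Finset.mem_filter, Finset.mem_range, Finset.mem_Ico] at hp ⊢
    refine ⟨by omega, Or.inl ?_⟩
    have h1 : a * N + N ≤ σ * N := by rw [← Nat.succ_mul]; exact Nat.mul_le_mul_right _ ha
    have h0 : a * N + u + (p - u) = p + a * N := by omega
    rw [h0, Nat.add_mul_mod_self_right, Nat.mod_eq_of_lt (by omega),
      Nat.add_mul_div_right _ _ (by omega), Nat.div_eq_of_lt (by omega), zero_add]
    exact ⟨by omega, hp.2⟩
  · intro t _; simp
  · intro p hp
    simp only [Finset.mem_filter, Finset.mem_Ico] at hp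
    omega

/-- A key below σN is determined by its remainder modulo N, because the text gives the quotient.
That remainder is below n, since from n on the text has the value σ, which is not a symbol. -/
theorem rank_end_le (ht : IsText n σ sy) : rank sy σ N (σ * N) ≤ n := by
  rw [rank, Nat.count_eq_card_filter_range, ← Finset.card_range n]
  have key : ∀ x ∈ (Finset.range (σ * N)).filter (IsKey sy σ N), sy (x % N) = x / N := by
    intro x hx
    simp only [Finset.mem_filter, Finset.mem_range] at hx
    rcases hx.2 with h | h
    · exact h.2
    · omega
  refine Finset.card_le_card_of_injOn (fun x => x % N) ?_ ?_
  · intro x hx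
    have h1 := key x hx
    simp only [Finset.coe_filter, Finset.mem_range, Set.mem_ofPred_eq] at hx
    simp only [Finset.coe_range, Set.mem_Iio]
    by_contra hc
    rw [ht.eq _ (by omega)] at h1
    have := Nat.div_lt_of_lt_mul (show x < N * σ by rw [mul_comm]; exact hx.1)
    omega
  · intro x hx y hy hxy
    have h1 := key x hx
    have h2 := key y hy
    simp only at hxy
    rw [hxy, h2] at h1
    rw [← Nat.div_add_mod x N, ← Nat.div_add_mod y N, hxy, h1]

theorem key_spec (ht : IsText n σ sy) (h : key sy σ N r < σ * N) :
    sy (key sy σ N r % N) = key sy σ N r / N ∧ key sy σ N r / N < σ ∧ key sy σ N r % N < n := by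
  have h1 : sy (key sy σ N r % N) = key sy σ N r / N := by
    rcases isKey_key (sy := sy) (σ := σ) (N := N) (r := r) with h' | h'
    · exact h'.2
    · omega
  have h2 := Nat.div_lt_of_lt_mul (show key sy σ N r < N * σ by rw [mul_comm]; exact h)
  refine ⟨h1, h2, ?_⟩
  by_contra hc
  rw [ht.eq _ (by omega)] at h1
  omega

theorem keyPos_of_le (ht : IsText n σ sy) (h : n ≤ r) : keyPos sy σ N r = N := by
  rw [keyPos, if_neg]
  rw [not_lt, le_key_iff]
  exact (rank_end_le ht).trans h

theorem keyPos_le : keyPos sy σ N r ≤ N := by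
  rw [keyPos]
  split_ifs with h
  · exact (Nat.mod_lt _ (Nat.pos_of_mul_pos_left (Nat.zero_lt_of_lt h))).le
  · exact le_rfl

theorem keySym_lt_or (ht : IsText n σ sy) : keySym sy σ N r < σ ∨ keySym sy σ N r = 0 := by
  rw [keySym]
  split_ifs with h
  · exact Or.inl (key_spec ht h).2.1
  · exact Or.inr rfl

/-- The program compares keys through two tables and never forms a·N, which may exceed a word. Keys
past the last occurrence have position N and fail the test because z ≤ N. -/
theorem keyPos_lt_and_iff (ha : a < σ) (hz : z ≤ N) :
    (keyPos sy σ N r < z ∧ keySym sy σ N r = a) ↔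
      a * N ≤ key sy σ N r ∧ key sy σ N r < a * N + z := by
  have h1 : a * N + N ≤ σ * N := by rw [← Nat.succ_mul]; exact Nat.mul_le_mul_right _ ha
  have h3 := Nat.div_add_mod' (key sy σ N r) N
  rw [keyPos, keySym]
  split_ifs with h
  · constructor
    · rintro ⟨h2, rfl⟩; omega
    · rintro ⟨h4, h5⟩
      have hN : 0 < N := Nat.pos_of_mul_pos_left (Nat.zero_lt_of_lt h)
      have h6 : key sy σ N r / N = a := by
        refine Nat.div_eq_of_lt_le ?_ ?_
        · exact h4
        · rw [Nat.succ_mul]; omega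
      rw [h6] at h3
      exact ⟨by omega, h6⟩
  · omega

theorem sum_occ_le (A : Finset ℕ) : ∑ a ∈ A, occ sy a u v ≤ v - u := by
  calc ∑ a ∈ A, occ sy a u v
      = ∑ a ∈ A, (((Finset.Ico u v).filter fun p => sy p ∈ A).filter fun p => sy p = a).card := by
        refine Finset.sum_congr rfl fun a ha => ?_
        rw [occ, Finset.filter_filter]
        congr 1
        refine Finset.filter_congr fun p _ => ?_
        constructor
        · rintro rfl; exact ⟨ha, rfl⟩
        · exact fun h => h.2
    _ = ((Finset.Ico u v).filter fun p => sy p ∈ A).card :=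
        (Finset.card_eq_sum_card_fiberwise fun p hp => by simpa using (Finset.mem_filter.1
          hp).2).symm
    _ ≤ (Finset.Ico u v).card := Finset.card_filter_le _ _
    _ = v - u := Nat.card_Ico _ _

/-! ### Search within blocks of keys -/

/-- Sum of the differences of consecutive values of `f`, each cut to `D`, from the start of the
block of length `M` that contains `r`. -/
def offset (f : ℕ → ℕ) (D M r : ℕ) : ℕ :=
  ∑ u ∈ Finset.Ico (r / M * M) r, min D (f (u + 1) - f u)

/-- Either no gap was cut and the sum telescopes, or a single cut gap already contributes D. -/
theorem sum_cut_le {f : ℕ → ℕ} (hf : Monotone f) (D a d : ℕ) :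
    ∑ u ∈ Finset.Ico a (a + d), min D (f (u + 1) - f u) ≤ f (a + d) - f a ∧
      (D ≤ ∑ u ∈ Finset.Ico a (a + d), min D (f (u + 1) - f u) ∨
        ∑ u ∈ Finset.Ico a (a + d), min D (f (u + 1) - f u) = f (a + d) - f a) := by
  induction d with
  | zero => simp
  | succ d ih =>
    rw [← add_assoc, Finset.sum_Ico_succ_top (Nat.le_add_right a d)]
    have h1 := hf (Nat.le_add_right a d)
    have h2 := hf (Nat.le_succ (a + d))
    simp only [Nat.succ_eq_add_one] at h2
    omega

/-- Cut distances suffice for a target within D of f r: after r they are exact or at least D, and at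
or before r both sides hold by monotonicity. -/
theorem offset_lt_iff {f : ℕ → ℕ} (hf : Monotone f) {D M c r r' : ℕ} (hc : f r < c)
    (hD : c - f r ≤ D) (hr : r' / M = r / M) :
    offset f D M r' < offset f D M r + (c - f r) ↔ f r' < c := by
  have hM : ∀ r, r / M * M ≤ r := fun r => Nat.div_mul_le_self r M
  have h1 := hM r
  have h1' := hM r'
  rw [offset, offset, hr]
  rw [hr] at h1'
  rcases le_total r r' with h | h
  · obtain ⟨d, rfl⟩ := Nat.exists_eq_add_of_le h
    rw [← Finset.sum_Ico_consecutive _ h1 h]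
    have h2 := sum_cut_le hf D r d
    have h3 := hf h
    omega
  · rw [← Finset.sum_Ico_consecutive _ h1' h]
    have h3 := hf h
    omega

theorem offset_start (f : ℕ → ℕ) (D M g : ℕ) (hM : 0 < M) : offset f D M (g * M) = 0 := by
  rw [offset, Nat.mul_div_cancel _ hM]; simp

/-- A block has at most M - 1 gaps before any of its keys. For D = M = b³ this keeps offsets below
b⁶. -/
theorem offset_lt (f : ℕ → ℕ) {D M : ℕ} (hM : 0 < M) (r : ℕ) :
    offset f D M r + D ≤ M * D := by
  have h1 : offset f D M r ≤ ∑ u ∈ Finset.Ico (r / M * M) r, D :=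
    Finset.sum_le_sum fun u _ => min_le_left _ _
  rw [Finset.sum_const, Nat.card_Ico, smul_eq_mul] at h1
  have h2 := Nat.div_add_mod' r M
  have h3 := Nat.mod_lt r hM
  have h4 : (r - r / M * M + 1) * D ≤ M * D := Nat.mul_le_mul_right _ (by omega)
  rw [Nat.succ_mul] at h4
  omega

/-! ### Packed numbers -/

/-- The number with the `b` digits `val u` in the base `F`. -/
def pack (F b : ℕ) (val : ℕ → ℕ) : ℕ := ∑ u ∈ Finset.range b, val u * F ^ u

theorem pack_succ (F b : ℕ) (val : ℕ → ℕ) :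
    pack F (b + 1) val = val 0 + F * pack F b fun u => val (u + 1) := by
  rw [pack, pack, Finset.sum_range_succ', Finset.mul_sum, add_comm]
  simp only [pow_zero, mul_one, add_right_inj]
  refine Finset.sum_congr rfl fun u _ => ?_
  rw [pow_succ]; ring

theorem pack_lt {F b : ℕ} {val : ℕ → ℕ} (h : ∀ u < b, val u < F) : pack F b val < F ^ b := by
  induction b generalizing val with
  | zero => simp [pack]
  | succ b ih =>
    rw [pack_succ, pow_succ, mul_comm (F ^ b)]
    have h1 := ih (val := fun u => val (u + 1)) fun u hu => h _ (by omega)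
    have h2 := h 0 (by omega)
    have h3 : F * (pack F b (fun u => val (u + 1)) + 1) ≤ F * F ^ b := Nat.mul_le_mul_left _ h1
    rw [Nat.mul_succ] at h3
    omega

theorem pack_digit {F b u : ℕ} {val : ℕ → ℕ} (h : ∀ u < b, val u < F) (hu : u < b) :
    pack F b val / F ^ u % F = val u := by
  induction b generalizing val u with
  | zero => omega
  | succ b ih =>
    have h2 := h 0 (by omega)
    rw [pack_succ]
    cases u with
    | zero => rw [pow_zero, Nat.div_one, Nat.add_mul_mod_self_left, Nat.mod_eq_of_lt h2]
    | succ u =>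
      rw [pow_succ', ← Nat.div_div_eq_div_mul, Nat.add_mul_div_left _ _ (by omega),
        Nat.div_eq_of_lt h2, zero_add]
      exact ih (fun u hu => h _ (by omega)) (by omega)

/-- The number of digits of `W` below `d`, among the lowest `b` digits in the base `F`. -/
def digitsBelow (F b W d : ℕ) : ℕ := ((Finset.range b).filter fun u => W / F ^ u % F < d).card

theorem digitsBelow_le (F b W d : ℕ) : digitsBelow F b W d ≤ b :=
  (Finset.card_filter_le _ _).trans (Finset.card_range b).le

/-- The word of the node `q` at height `t` of the search trees for the values `off`. -/
def node (F b : ℕ) (off : ℕ → ℕ) (t q : ℕ) : ℕ := pack F b fun u => off ((q * b + u) * b ^ t)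

/-- Digit u of a node is the offset of the first key of its child u. The digits below d are
therefore those of the children up to the one that contains R, and their number minus one is its
index. -/
theorem digitsBelow_node {F b t R d : ℕ} {off : ℕ → ℕ} (hb : 0 < b) (hF : ∀ r, off r < F)
    (ht : t < 3) (hd : ∀ r, r / b ^ 3 = R / b ^ 3 → (off r < d ↔ r ≤ R)) :
    R / b ^ (t + 1) * b + digitsBelow F b (node F b off t (R / b ^ (t + 1))) d - 1 =
      R / b ^ t ∧ 1 ≤ digitsBelow F b (node F b off t (R / b ^ (t + 1))) d := by
  have h1 : R / b ^ (t + 1) = R / b ^ t / b := by rw [pow_succ, Nat.div_div_eq_div_mul]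
  have h2 := Nat.div_add_mod' (R / b ^ t) b
  have h3 := Nat.mod_lt (R / b ^ t) hb
  have key : digitsBelow F b (node F b off t (R / b ^ (t + 1))) d = R / b ^ t % b + 1 := by
    rw [digitsBelow, ← Finset.card_range (R / b ^ t % b + 1)]
    congr 1
    ext u
    simp only [Finset.mem_filter, Finset.mem_range]
    have main : ∀ u < b, (node F b off t (R / b ^ (t + 1)) / F ^ u % F < d ↔ u < R / b ^ t % b + 1)
      := by
      intro u hu'
      -- Since t < 3, all children of the node lie in the same block of b³ keys as R, where the
      -- hypothesis on d applies.
      have hblk : (R / b ^ (t + 1) * b + u) * b ^ t / b ^ 3 = R / b ^ 3 := by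
        have e3 : b ^ 3 = b ^ t * b * b ^ (2 - t) := by
          rw [← pow_succ, ← pow_add]; congr 1; omega
        rw [e3, mul_assoc (b ^ t), ← Nat.div_div_eq_div_mul, ← Nat.div_div_eq_div_mul,
          Nat.mul_div_cancel _ (by positivity), ← Nat.div_div_eq_div_mul, ← Nat.div_div_eq_div_mul,
          h1]
        congr 1
        rw [Nat.add_comm, Nat.add_mul_div_right _ _ hb, Nat.div_eq_of_lt hu', zero_add]
      rw [node, pack_digit (fun u _ => hF _) hu', hd _ hblk,
        ← Nat.le_div_iff_mul_le (by positivity), h1]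
      omega
    exact ⟨fun ⟨hu, h⟩ => (main u hu).1 h, fun h => ⟨by omega, (main u (by omega)).2 h⟩⟩
  rw [key, h1]
  omega

end RangeMajority

namespace RangeMajority
open WordRAM

set_option linter.unusedSimpArgs false

theorem nev_entry {mem ρ : ℕ → ℕ} {a x : Expr} :
    nev mem ρ (entry a x) = mem (mem (nev mem ρ a) + nev mem ρ x) := rfl

theorem ok_entry {w s : ℕ} {mem ρ : ℕ → ℕ} (hm : MemOk w s mem) {a x : Expr} :
    Ok w s mem ρ (entry a x) ↔ Ok w s mem ρ a ∧ Ok w s mem ρ x ∧ nev mem ρ a < s ∧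
      mem (nev mem ρ a) + nev mem ρ x < s := by
  have := hm.size
  simp only [entry, Ok, OkOp, nev, natOp]
  constructor
  · rintro ⟨⟨⟨h1, h2⟩, h3, -⟩, h4⟩; exact ⟨h1, h3, h2, h4⟩
  · rintro ⟨h1, h3, h2, h4⟩; exact ⟨⟨⟨h1, h2⟩, h3, by omega⟩, h4⟩

/-! ### The contents of the memory -/

/-- The parameters of the data structure: the word length `w`, the memory of `s` words with the
contents `mem`, the text `sy` of length `n` over `σ` symbols, the modulus `N` of the keys, `b`
numbers of `f` bits per packed word, and `G` scales of range lengths for each of the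
frequencies `1, …, 1 / 2 ^ kmax`; the number `B` is the base of the long division. -/
structure Params where
  (w s n σ N b f G kmax B : ℕ)
  (mem sy : ℕ → ℕ)

namespace Params

/-- Number of keys in a block. -/
abbrev M (c : Params) : ℕ := c.b ^ 3

/-- Base of the packed numbers. -/
abbrev F (c : Params) : ℕ := 2 ^ c.f

/-- The offsets of the keys in their blocks, at resolution `2 ^ k`. -/
noncomputable def off (c : Params) (k : ℕ) : ℕ → ℕ :=
  offset (fun r => key c.sy c.σ c.N r / 2 ^ k) c.M c.M

/-- The number of the first array for the frequency `1 / 2 ^ k`. -/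
abbrev dir (c : Params) (k : ℕ) : ℕ := 6 + k * (c.G + 3)

/-- The tables that serve all candidates are in the memory. -/
structure Valid (c : Params) : Prop where
  memOk : MemOk c.w c.s c.mem
  text : IsText c.n c.σ c.sy
  lt_N : c.n < c.N
  dvd_N : ∀ k ≤ c.kmax, 2 ^ k ∣ c.N
  b_pos : 0 < c.b
  F_eq : c.F = c.b ^ 6
  big : 64 * (c.n + c.N + c.M + c.F ^ c.b * (2 * c.F)) ≤ 2 ^ c.w
  dir_lt : ∀ k ≤ c.kmax, c.dir k + 64 ≤ 2 ^ c.w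
  pos : ∀ r ≤ 2 * c.n + c.M, Rd c.s c.mem 2 r (keyPos c.sy c.σ c.N r)
  sym : ∀ r ≤ 2 * c.n + c.M, Rd c.s c.mem 3 r (keySym c.sy c.σ c.N r)
  below : ∀ W < c.F ^ c.b, ∀ d < 2 * c.F,
    Rd c.s c.mem 5 (W * (2 * c.F) + d) (digitsBelow c.F c.b W d)
  tree : ∀ k ≤ c.kmax, ∀ t < 3, ∀ q, q * c.b ^ (t + 1) ≤ c.n →
    Rd c.s c.mem (c.dir k + t) q (node c.F c.b (c.off k) t q)

theorem Valid.off_add_le {c : Params} (hc : c.Valid) (k r : ℕ) : c.off k r + c.M ≤ c.F := by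
  have h := offset_lt (fun r => key c.sy c.σ c.N r / 2 ^ k) (D := c.M) (M := c.M)
    (Nat.pow_pos hc.b_pos) r
  have : c.M * c.M = c.F := by rw [hc.F_eq, M, ← pow_add]
  rw [off]; omega

theorem Valid.off_lt {c : Params} (hc : c.Valid) (k r : ℕ) : c.off k r < c.F := by
  have := hc.off_add_le k r
  have : 0 < c.M := Nat.pow_pos hc.b_pos
  omega

end Params

/-- One level of the descent in a search tree: register `34` holds the node, register `35` the
bound. -/
def descend (t : ℕ) : Prog :=
  .assign 34 (minus (plus (times (rg 34) (rg 11)) (entry (nm 5)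
    (plus (times (entry (plus (rg 18) (nm t)) (rg 34)) (times (nm 2) (rg 24))) (rg 35)))) (nm 1))

/-- Move from a block of keys to the next one, as long as its first key is small. -/
def blockLoop : Prog :=
  .loop (times (less (entry (nm 2) (rg 33)) (rg 17)) (same (entry (nm 3) (rg 33)) (rg 32)))
    (block [
      .assign 34 (plus (rg 34) (nm 1)),
      .assign 35 (minus (quo (rg 17) (rg 8)) (quo (entry (nm 2) (rg 33)) (rg 8))),
      .assign 33 (plus (rg 33) (rg 12))])

/-- Advance register `31` from the key number `r` to the first key of the symbol in register `32`
at a position at least the one in register `17`. -/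
def searchProg : Prog :=
  block [
    .assign 34 (quo (rg 31) (rg 12)),
    .assign 35 (plus (rem (shr (entry (rg 18) (quo (rg 31) (rg 11)))
      (times (rg 25) (rem (rg 31) (rg 11)))) (rg 24)) (minus (quo (rg 17) (rg 8))
      (quo (rg 33) (rg 8)))),
    .assign 33 (times (plus (rg 34) (nm 1)) (rg 12)),
    blockLoop,
    descend 2, descend 1, descend 0,
    .assign 31 (plus (rg 34) (nm 1))]

/-- The registers that hold the parameters of the query and of the data structure. -/
structure Regs (c : Params) (k x T i j : ℕ) (ρ : ℕ → ℕ) : Prop where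
  r0 : ρ 0 = i
  r1 : ρ 1 = j
  r6 : ρ 6 = T
  r8 : ρ 8 = 2 ^ k
  r11 : ρ 11 = c.b
  r12 : ρ 12 = c.M
  r17 : ρ 17 = x
  r18 : ρ 18 = c.dir k
  r24 : ρ 24 = c.F
  r25 : ρ 25 = c.f

theorem Regs.congr {c : Params} {k x T i j : ℕ} {ρ ρ' : ℕ → ℕ} (h : Regs c k x T i j ρ)
    (h' : ∀ r < 31, ρ' r = ρ r) : Regs c k x T i j ρ' :=
  ⟨(h' _ (by norm_num)).trans h.r0, (h' _ (by norm_num)).trans h.r1,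
    (h' _ (by norm_num)).trans h.r6, (h' _ (by norm_num)).trans h.r8,
    (h' _ (by norm_num)).trans h.r11, (h' _ (by norm_num)).trans h.r12,
    (h' _ (by norm_num)).trans h.r17, (h' _ (by norm_num)).trans h.r18,
    (h' _ (by norm_num)).trans h.r24, (h' _ (by norm_num)).trans h.r25⟩

/-! ### Searching the sorted occurrences of a candidate -/

variable {c : Params} {k x T i j a : ℕ} {ρ : ℕ → ℕ} {o : List ℕ}

theorem if_mul_if_ne_zero {p q : Prop} [Decidable p] [Decidable q] :
    (if p then 1 else 0) * (if q then 1 else 0) ≠ 0 ↔ p ∧ q := by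
  by_cases hp : p <;> by_cases hq : q <;> simp [hp, hq]

theorem if_mul_if_le {p q : Prop} [Decidable p] [Decidable q] :
    (if p then 1 else 0) * (if q then 1 else 0) ≤ 1 := by
  by_cases hp : p <;> by_cases hq : q <;> simp [hp, hq]

theorem keyPos_eq {σ N r : ℕ} {sy : ℕ → ℕ} (ha : a < σ) (h1 : a * N ≤ key sy σ N r)
    (h2 : key sy σ N r < a * N + N) :
    key sy σ N r = a * N + keyPos sy σ N r ∧ keySym sy σ N r = a := by
  have h := (keyPos_lt_and_iff ha le_rfl).2 ⟨h1, h2⟩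
  refine ⟨?_, h.2⟩
  have h3 := h.1
  rw [keyPos] at h3 ⊢
  split_ifs at h3 ⊢ with h4
  · have h5 := h.2
    rw [keySym, if_pos h4] at h5
    rw [← h5]; exact (Nat.div_add_mod' _ _).symm
  · omega

/-- Both N and x are multiples of 2^k, so dividing keys by 2^k loses nothing in a comparison with
a·N + x. This is why the search aims at x and not at i itself. -/
theorem off_lt_iff (hc : c.Valid) (hk : k ≤ c.kmax) (ha : a < c.σ) {x' r r' : ℕ}
    (hx : x = 2 ^ k * x') (hxN : x ≤ c.N) (h1 : a * c.N ≤ key c.sy c.σ c.N r)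
    (h2 : key c.sy c.σ c.N r < a * c.N + x)
    (hD : x' ≤ keyPos c.sy c.σ c.N r / 2 ^ k + c.M) (hr : r' / c.M = r / c.M) :
    keyPos c.sy c.σ c.N r / 2 ^ k < x' ∧
      (c.off k r' < c.off k r + (x' - keyPos c.sy c.σ c.N r / 2 ^ k) ↔
        r' < rank c.sy c.σ c.N (a * c.N + x)) := by
  obtain ⟨N', hN⟩ := hc.dvd_N k hk
  have hK := Nat.two_pow_pos k
  have hpos := (keyPos_eq ha h1 (by omega)).1
  have hz : a * c.N + x = 2 ^ k * (a * N' + x') := by rw [hN, hx]; ring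
  have hf : Monotone fun r => key c.sy c.σ c.N r / 2 ^ k := fun r s h =>
    Nat.div_le_div_right (key_strictMono.monotone h)
  have hlt : ∀ r, key c.sy c.σ c.N r < a * c.N + x ↔
      key c.sy c.σ c.N r / 2 ^ k < a * N' + x' := by
    intro r
    rw [Nat.div_lt_iff_lt_mul hK, hz, mul_comm (2 ^ k)]
  have hr2 : key c.sy c.σ c.N r / 2 ^ k = a * N' + keyPos c.sy c.σ c.N r / 2 ^ k := by
    rw [hpos, hN, show a * (2 ^ k * N') = 2 ^ k * (a * N') by ring, Nat.mul_add_div hK]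
  have h3 := (hlt r).1 h2
  have hsub : a * N' + x' - key c.sy c.σ c.N r / 2 ^ k =
      x' - keyPos c.sy c.σ c.N r / 2 ^ k := by omega
  refine ⟨by omega, ?_⟩
  have := offset_lt_iff hf (D := c.M) (M := c.M) h3 (by omega) hr
  simp only [hsub] at this
  rw [Params.off, this, ← hlt, key_lt_iff]

theorem run_descend (hc : c.Valid) (hk : k ≤ c.kmax) (h : Regs c k x T i j ρ) {t R d : ℕ}
    (ht : t < 3) (h34 : ρ 34 = R / c.b ^ (t + 1)) (h35 : ρ 35 = d) (hR : R ≤ c.n)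
    (hd : d < 2 * c.F)
    (hd' : ∀ r, r / c.b ^ 3 = R / c.b ^ 3 → (c.off k r < d ↔ r ≤ R)) :
    Run c.w c.s c.mem (descend t) ρ o fun t' ρ' o' => t' ≤ 40 ∧ o' = o ∧
      ρ' = Function.update ρ 34 (R / c.b ^ t) := by
  have hm := hc.memOk
  have hbig := hc.big
  have hnode := digitsBelow_node (F := c.F) hc.b_pos (hc.off_lt k) ht hd'
  have hq : R / c.b ^ (t + 1) * c.b ^ (t + 1) ≤ c.n := (Nat.div_mul_le_self _ _).trans hR
  obtain ⟨t1, t2, t3⟩ := hc.tree k hk t ht _ hq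
  have hW : node c.F c.b (c.off k) t (R / c.b ^ (t + 1)) < c.F ^ c.b :=
    pack_lt fun u _ => hc.off_lt k _
  obtain ⟨b1, b2, b3⟩ := hc.below _ hW d hd
  have hdb := digitsBelow_le c.F c.b (node c.F c.b (c.off k) t (R / c.b ^ (t + 1))) d
  have hdir := hc.dir_lt k hk
  have hb : c.b ≤ c.M := Nat.le_self_pow (by norm_num) _
  have h1 : R / c.b ^ (t + 1) * c.b ≤ R := by
    rw [pow_succ, ← Nat.div_div_eq_div_mul]
    exact (Nat.div_mul_le_self _ _).trans (Nat.div_le_self _ _)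
  have h2 : node c.F c.b (c.off k) t (R / c.b ^ (t + 1)) * (2 * c.F) + 2 * c.F
      ≤ c.F ^ c.b * (2 * c.F) := by
    rw [← Nat.succ_mul]; exact Nat.mul_le_mul_right _ hW
  refine Run.assign_eq hm (v := R / c.b ^ t) ?_ ?_ ?_
  · simp only [Ok, OkOp, nev, natOp, nev_entry, ok_entry hm, Function.update_apply,
      Nat.reduceEqDiff, if_false, if_true, and_true, true_and, h34, h35, h.r11, h.r18, h.r24, t3,
      b3]
    generalize node c.F c.b (c.off k) t (R / c.b ^ (t + 1)) = W at *
    generalize W * (2 * c.F) = W' at *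
    generalize R / c.b ^ (t + 1) * c.b = W'' at *
    omega
  · simp only [Ok, OkOp, nev, natOp, nev_entry, ok_entry hm, Function.update_apply,
      Nat.reduceEqDiff, if_false, if_true, and_true, true_and, h34, h35, h.r11, h.r18, h.r24, t3,
      b3]
    exact hnode.1
  · exact ⟨Nat.le_of_ble_eq_true rfl, rfl, rfl⟩

/-- The number `m` counts the block boundaries up to the key R, the last one below the target. The
bound `d` separates the keys up to R only within one block. Offsets restart at zero in each block,
so the new bound is the distance from its first key to x. -/
theorem run_blockLoop (hc : c.Valid) (hk : k ≤ c.kmax) (ha : a < c.σ) {r₀ x' R : ℕ}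
    (hx : x = 2 ^ k * x') (hxN : x ≤ c.N) (hr₀ : a * c.N ≤ key c.sy c.σ c.N r₀)
    (hR : rank c.sy c.σ c.N (a * c.N + x) = R + 1)
    (hD : x' ≤ keyPos c.sy c.σ c.N r₀ / 2 ^ k + c.M) :
    ∀ (m : ℕ) (ρ : ℕ → ℕ) (g d : ℕ), Regs c k x T i j ρ → ρ 32 = a → ρ 34 = g →
      ρ 33 = (g + 1) * c.M → ρ 35 = d → r₀ < (g + 1) * c.M → g + m = R / c.M → d < 2 * c.F →
      (∀ r, r / c.M = g → (c.off k r < d ↔ r ≤ R)) →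
    Run c.w c.s c.mem blockLoop ρ o fun t ρ' o' => t ≤ 60 * m + 20 ∧ o' = o ∧
      (∀ r < 33, ρ' r = ρ r) ∧ ρ' 34 = R / c.M ∧ ρ' 35 < 2 * c.F ∧
      (∀ r, r / c.M = R / c.M → (c.off k r < ρ' 35 ↔ r ≤ R)) := by
  have hm := hc.memOk
  have hbig := hc.big
  have hM : 0 < c.M := Nat.pow_pos hc.b_pos
  have hRn : R + 1 ≤ c.n := by
    rw [← hR]
    refine (rank_mono ?_).trans (rank_end_le hc.text (N := c.N))
    have : a * c.N + c.N ≤ c.σ * c.N := by rw [← Nat.succ_mul]; exact Nat.mul_le_mul_right _ ha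
    omega
  intro m
  induction m with
  | zero =>
    intro ρ g d h h32 h34 h33 h35 hg hgm hd hd'
    rw [add_zero] at hgm
    subst hgm
    have hmul : (R / c.M + 1) * c.M ≤ R + c.M := by
      rw [Nat.succ_mul]; have := Nat.div_mul_le_self R c.M; omega
    have hRlt : R < (R / c.M + 1) * c.M := by
      rw [Nat.succ_mul]; have := Nat.div_add_mod' R c.M; have := Nat.mod_lt R hM; omega
    obtain ⟨p1, p2, p3⟩ := hc.pos ((R / c.M + 1) * c.M) (by omega)
    obtain ⟨s1, s2, s3⟩ := hc.sym ((R / c.M + 1) * c.M) (by omega)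
    have hle := if_mul_if_le (p := keyPos c.sy c.σ c.N ((R / c.M + 1) * c.M) < x)
      (q := keySym c.sy c.σ c.N ((R / c.M + 1) * c.M) = a)
    refine Run.loop hm ?_ ?_ ?_
    · simp only [Ok, OkOp, nev, natOp, nev_entry, ok_entry hm, Function.update_apply,
        Nat.reduceEqDiff, if_false, if_true, and_true, true_and, h33, h.r17, h32, p3, s3]
      omega
    · intro h0
      exfalso
      simp only [Ok, OkOp, nev, natOp, nev_entry, ok_entry hm, Function.update_apply,
        Nat.reduceEqDiff, if_false, if_true, and_true, true_and, h33, h.r17, h32, p3, s3,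
        if_mul_if_ne_zero] at h0
      rw [keyPos_lt_and_iff ha hxN, key_lt_iff, hR] at h0
      omega
    · intro _
      refine ⟨Nat.le_of_ble_eq_true rfl, rfl, fun _ _ => rfl, h34, h35 ▸ hd, h35 ▸ hd'⟩
  | succ m ih =>
    intro ρ g d h h32 h34 h33 h35 hg hgm hd hd'
    have hgR : (g + 1) * c.M ≤ R := by
      rw [← Nat.le_div_iff_mul_le hM]; omega
    obtain ⟨p1, p2, p3⟩ := hc.pos ((g + 1) * c.M) (by omega)
    obtain ⟨s1, s2, s3⟩ := hc.sym ((g + 1) * c.M) (by omega)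
    have hle := if_mul_if_le (p := keyPos c.sy c.σ c.N ((g + 1) * c.M) < x)
      (q := keySym c.sy c.σ c.N ((g + 1) * c.M) = a)
    have hkey : key c.sy c.σ c.N ((g + 1) * c.M) < a * c.N + x := by
      rw [key_lt_iff, hR]; omega
    have hkey' : a * c.N ≤ key c.sy c.σ c.N ((g + 1) * c.M) :=
      hr₀.trans (key_strictMono hg).le
    have htest := (keyPos_lt_and_iff ha hxN).2 ⟨hkey', hkey⟩
    have hpos := (keyPos_eq ha hkey' (by omega)).1
    have hpos₀ := (keyPos_eq ha hr₀
      (lt_of_le_of_lt (key_strictMono hg).le (by omega))).1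
    have hkk := (key_strictMono (sy := c.sy) (σ := c.σ) (N := c.N) hg).le
    -- The first key of the next block is closer to x than r₀, so its distance is still at most M.
    have hdiv : keyPos c.sy c.σ c.N r₀ / 2 ^ k ≤ keyPos c.sy c.σ c.N ((g + 1) * c.M) / 2 ^ k :=
      Nat.div_le_div_right (by omega)
    have hoff := fun r' => off_lt_iff (r' := r') hc hk ha hx hxN hkey' hkey (by omega)
    have hxd : x / 2 ^ k = x' := by rw [hx, Nat.mul_div_cancel_left _ (Nat.two_pow_pos k)]
    have hMF : c.M ≤ c.F := by have := hc.off_add_le k 0; omega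
    have hMn : g + 1 ≤ (g + 1) * c.M := Nat.le_mul_of_pos_right _ hM
    have hlt := (hoff _ rfl).1
    have hx'x : x' ≤ x := hxd ▸ Nat.div_le_self _ _
    have hs1 : (g + 1) * c.M + c.M = (g + 1 + 1) * c.M := (Nat.succ_mul _ _).symm
    refine Run.loop hm ?_ ?_ ?_
    · simp only [Ok, OkOp, nev, natOp, nev_entry, ok_entry hm, Function.update_apply,
        Nat.reduceEqDiff, if_false, if_true, and_true, true_and, h33, h.r17, h32, p3, s3]
      omega
    · intro _
      simp only [block]
      refine Run.seq (Run.assign_eq hm (v := g + 1) ?_ ?_ ?_)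
      · simp only [Ok, OkOp, nev, natOp, nev_entry, ok_entry hm, Function.update_apply,
          Nat.reduceEqDiff, if_false, if_true, and_true, true_and, h34]; omega
      · simp only [Ok, OkOp, nev, natOp, nev_entry, ok_entry hm, Function.update_apply,
          Nat.reduceEqDiff, if_false, if_true, and_true, true_and, h34]
      refine Run.seq (Run.assign_eq hm
        (v := x' - keyPos c.sy c.σ c.N ((g + 1) * c.M) / 2 ^ k) ?_ ?_ ?_)
      · simp only [Ok, OkOp, nev, natOp, nev_entry, ok_entry hm, Function.update_apply,
          Nat.reduceEqDiff, if_false, if_true, and_true, true_and, h33, h.r17, h.r8, p3, hxd]; omega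
      · simp only [Ok, OkOp, nev, natOp, nev_entry, ok_entry hm, Function.update_apply,
          Nat.reduceEqDiff, if_false, if_true, and_true, true_and, h33, h.r17, h.r8, p3, hxd]
      refine Run.assign_eq hm (v := (g + 1 + 1) * c.M) ?_ ?_ ?_
      · simp only [Ok, OkOp, nev, natOp, nev_entry, ok_entry hm, Function.update_apply,
          Nat.reduceEqDiff, if_false, if_true, and_true, true_and, h33, h.r12, hs1]; omega
      · simp only [Ok, OkOp, nev, natOp, nev_entry, ok_entry hm, Function.update_apply,
          Nat.reduceEqDiff, if_false, if_true, and_true, true_and, h33, h.r12, hs1]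
      have hfr : ∀ r < 33, Function.update (Function.update (Function.update ρ 34 (g + 1)) 35
          (x' - keyPos c.sy c.σ c.N ((g + 1) * c.M) / 2 ^ k)) 33 ((g + 1 + 1) * c.M) r = ρ r := by
        intro r hr
        rw [Function.update_of_ne (by omega), Function.update_of_ne (by omega),
          Function.update_of_ne (by omega)]
      refine (ih _ (g + 1) (x' - keyPos c.sy c.σ c.N ((g + 1) * c.M) / 2 ^ k)
        (h.congr fun r hr => hfr r (by omega)) ((hfr 32 (by norm_num)).trans h32) ?_ ?_ ?_ ?_
        (by omega) (by omega) ?_).mono ?_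
      · simp
      · simp
      · simp
      · omega
      · intro r' hr'
        have h1 := (hoff r' (by rw [hr', Nat.mul_div_cancel _ hM])).2
        rw [Params.off, offset_start _ _ _ _ hM, zero_add, hR] at h1
        rw [Params.off, h1]; omega
      · rintro t' ρ' o' ⟨h1, h2, h3, h4, h5, h6⟩
        refine ⟨?_, h2, fun r hr => (h3 r hr).trans (hfr r hr), h4, h5, h6⟩
        simp only [Expr.cost, cost_entry]
        omega
    · intro h0
      exfalso
      revert h0
      simp only [Ok, OkOp, nev, natOp, nev_entry, ok_entry hm, Function.update_apply,
        Nat.reduceEqDiff, if_false, if_true, and_true, true_and, h33, h.r17, h32, p3, s3]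
      exact if_mul_if_ne_zero.2 htest

theorem run_searchProg (hc : c.Valid) (hk : k ≤ c.kmax) (ha : a < c.σ) {r₀ x' : ℕ}
    (h : Regs c k x T i j ρ) (h31 : ρ 31 = r₀) (h32 : ρ 32 = a)
    (h33 : ρ 33 = keyPos c.sy c.σ c.N r₀)
    (hx : x = 2 ^ k * x') (hxN : x ≤ c.N) (hr₀ : a * c.N ≤ key c.sy c.σ c.N r₀)
    (hr₀' : key c.sy c.σ c.N r₀ < a * c.N + x)
    (hD : x' ≤ keyPos c.sy c.σ c.N r₀ / 2 ^ k + c.M) :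
    Run c.w c.s c.mem searchProg ρ o fun t ρ' o' =>
      t ≤ 400 + 60 * ((rank c.sy c.σ c.N (a * c.N + x) - r₀) / c.M) ∧ o' = o ∧
      (∀ r < 33, r ≠ 31 → ρ' r = ρ r) ∧ ρ' 31 = rank c.sy c.σ c.N (a * c.N + x) := by
  have hm := hc.memOk
  have hbig := hc.big
  have hM : 0 < c.M := Nat.pow_pos hc.b_pos
  have hRn : rank c.sy c.σ c.N (a * c.N + x) ≤ c.n := by
    refine (rank_mono ?_).trans (rank_end_le hc.text (N := c.N))
    have : a * c.N + c.N ≤ c.σ * c.N := by rw [← Nat.succ_mul]; exact Nat.mul_le_mul_right _ ha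
    omega
  have hlt := key_lt_iff.1 hr₀'
  obtain ⟨R, hR⟩ : ∃ R, rank c.sy c.σ c.N (a * c.N + x) = R + 1 :=
    ⟨rank c.sy c.σ c.N (a * c.N + x) - 1, by omega⟩
  have hoff := fun r' => off_lt_iff (r' := r') hc hk ha hx hxN hr₀ hr₀' hD
  rw [hR] at hlt hRn hoff ⊢
  have hlt' := (hoff _ rfl).1
  have hxd : x / 2 ^ k = x' := by rw [hx, Nat.mul_div_cancel_left _ (Nat.two_pow_pos k)]
  have hx'x : x' ≤ x := hxd ▸ Nat.div_le_self _ _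
  have hdir := hc.dir_lt k hk
  have hbM : c.b ≤ c.M := Nat.le_self_pow (by norm_num) _
  obtain ⟨t1, t2, t3⟩ := hc.tree k hk 0 (by norm_num) (r₀ / c.b)
    (by rw [zero_add, pow_one]; exact (Nat.div_mul_le_self _ _).trans (by omega))
  rw [add_zero] at t1 t2 t3
  -- The nodes at height zero hold the offset of every key, so the offset of r₀ is one digit of its
  -- leaf word.
  have hdig : node c.F c.b (c.off k) 0 (r₀ / c.b) / 2 ^ (c.f * (r₀ % c.b)) % c.F =
      c.off k r₀ := by
    rw [pow_mul, node, pack_digit (fun u _ => hc.off_lt k _) (Nat.mod_lt _ hc.b_pos),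
      pow_zero, mul_one, Nat.div_add_mod']
  have hoffle := hc.off_add_le k r₀
  have hmod := Nat.mod_lt r₀ hc.b_pos
  have hg0 : r₀ / c.M ≤ R / c.M := Nat.div_le_div_right (by omega)
  have hgM : (r₀ / c.M + 1) * c.M ≤ r₀ + c.M := by
    rw [Nat.succ_mul]; have := Nat.div_mul_le_self r₀ c.M; omega
  have hgM' : r₀ < (r₀ / c.M + 1) * c.M := by
    rw [Nat.succ_mul]; have := Nat.div_add_mod' r₀ c.M; have := Nat.mod_lt r₀ hM; omega
  have hgle : r₀ / c.M ≤ r₀ := Nat.div_le_self _ _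
  have hfb : c.f * (r₀ % c.b) < 2 ^ c.w := by
    have h1 : c.f * (r₀ % c.b) < 2 ^ (c.f * (r₀ % c.b)) := Nat.lt_two_pow_self
    have h2 : 2 ^ (c.f * (r₀ % c.b)) ≤ 2 ^ (c.f * c.b) :=
      Nat.pow_le_pow_right (by norm_num) (Nat.mul_le_mul_left _ hmod.le)
    rw [pow_mul 2 c.f c.b] at h2
    have h3 : (2 ^ c.f) ^ c.b ≤ (2 ^ c.f) ^ c.b * (2 * 2 ^ c.f) :=
      Nat.le_mul_of_pos_right _ (by positivity)
    have h4 : c.F ^ c.b * (2 * c.F) = (2 ^ c.f) ^ c.b * (2 * 2 ^ c.f) := rfl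
    omega
  simp only [searchProg, block]
  refine Run.seq (Run.assign_eq hm (v := r₀ / c.M) ?_ ?_ ?_)
  · simp only [Ok, OkOp, nev, natOp, nev_entry, ok_entry hm, Function.update_apply,
      Nat.reduceEqDiff, if_false, if_true, and_true, true_and]
  · simp only [Ok, OkOp, nev, natOp, nev_entry, ok_entry hm, Function.update_apply,
      Nat.reduceEqDiff, if_false, if_true, and_true, true_and, h31, h.r12]
  refine Run.seq (Run.assign_eq hm
    (v := c.off k r₀ + (x' - keyPos c.sy c.σ c.N r₀ / 2 ^ k)) ?_ ?_ ?_)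
  · simp only [Ok, OkOp, nev, natOp, nev_entry, ok_entry hm, Function.update_apply,
      Nat.reduceEqDiff, if_false, if_true, and_true, true_and, h31, h.r11, h.r18, h.r24, h.r25,
      h.r17, h.r8, h33, t3, hxd, hdig]
    have hF1 : 2 * c.F ≤ c.F ^ c.b * (2 * c.F) := Nat.le_mul_of_pos_left _ (by positivity)
    generalize c.f * (r₀ % c.b) = fb at *
    omega
  · simp only [Ok, OkOp, nev, natOp, nev_entry, ok_entry hm, Function.update_apply,
      Nat.reduceEqDiff, if_false, if_true, and_true, true_and, h31, h.r11, h.r18, h.r24, h.r25,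
      h.r17, h.r8, h33, t3, hxd, hdig]
  refine Run.seq (Run.assign_eq hm (v := (r₀ / c.M + 1) * c.M) ?_ ?_ ?_)
  · simp only [Ok, OkOp, nev, natOp, nev_entry, ok_entry hm, Function.update_apply,
      Nat.reduceEqDiff, if_false, if_true, and_true, true_and, h.r12]; omega
  · simp only [Ok, OkOp, nev, natOp, nev_entry, ok_entry hm, Function.update_apply,
      Nat.reduceEqDiff, if_false, if_true, and_true, true_and, h.r12]
  have hMF : c.M ≤ c.F := by omega
  have hfr : ∀ r < 33, Function.update (Function.update (Function.update ρ 34 (r₀ / c.M)) 35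
      (c.off k r₀ + (x' - keyPos c.sy c.σ c.N r₀ / 2 ^ k))) 33 ((r₀ / c.M + 1) * c.M) r = ρ r := by
    intro r hr
    rw [Function.update_of_ne (by omega), Function.update_of_ne (by omega),
      Function.update_of_ne (by omega)]
  refine Run.seq ((run_blockLoop (T := T) (i := i) (j := j) hc hk ha hx hxN hr₀ hR hD
    (R / c.M - r₀ / c.M) _ (r₀ / c.M) (c.off k r₀ + (x' - keyPos c.sy c.σ c.N r₀ / 2 ^ k))
    (h.congr fun r hr => hfr r (by omega)) ((hfr 32 (by norm_num)).trans h32) (by simp) (by simp)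
    (by simp) hgM' (by omega) (by omega) ?_).mono ?_)
  · intro r' hr'
    rw [(hoff r' hr').2]; omega
  rintro t₁ ρ₁ o₁ ⟨ht₁, ho₁, hfr₁, h34, h35, hd⟩
  have hfr₁' : ∀ r < 33, ρ₁ r = ρ r := fun r hr => (hfr₁ r hr).trans (hfr r hr)
  have hregs := h.congr (ρ' := ρ₁) fun r hr => hfr₁' r (by omega)
  refine Run.seq ((run_descend hc hk hregs (t := 2) (R := R) (by norm_num) h34 rfl (by omega) h35
    hd).mono ?_)
  rintro t₂ ρ₂ o₂ ⟨ht₂, ho₂, rfl⟩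
  have hfr₂ : ∀ v r, r < 33 → Function.update ρ₁ 34 v r = ρ₁ r := fun v r hr =>
    Function.update_of_ne (by omega) _ _
  refine Run.seq ((run_descend hc hk (hregs.congr fun r hr => hfr₂ _ r (by omega)) (t := 1) (R := R)
    (d := ρ₁ 35) (by norm_num) (by simp) (by simp) (by omega) h35 hd).mono ?_)
  rintro t₃ ρ₃ o₃ ⟨ht₃, ho₃, rfl⟩
  rw [Function.update_idem]
  refine Run.seq ((run_descend hc hk (hregs.congr fun r hr => hfr₂ _ r (by omega)) (t := 0) (R := R)
    (d := ρ₁ 35) (by norm_num) (by simp) (by simp) (by omega) h35 hd).mono ?_)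
  rintro t₄ ρ₄ o₄ ⟨ht₄, ho₄, rfl⟩
  rw [Function.update_idem]
  refine Run.assign_eq hm (v := R + 1) ?_ ?_ ?_
  · simp only [Ok, OkOp, nev, natOp, nev_entry, ok_entry hm, Function.update_apply,
      Nat.reduceEqDiff, if_false, if_true, and_true, true_and, pow_zero, Nat.div_one]; omega
  · simp only [Ok, OkOp, nev, natOp, nev_entry, ok_entry hm, Function.update_apply,
      Nat.reduceEqDiff, if_false, if_true, and_true, true_and, pow_zero, Nat.div_one]
  refine ⟨?_, by rw [ho₄, ho₃, ho₂, ho₁], ?_, by simp⟩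
  -- All but one of the boundary crossings can be charged to M keys each; the remaining one is
  -- absorbed by the constant.
  · have hsteps : R / c.M - r₀ / c.M ≤ (R + 1 - r₀) / c.M + 1 := by
      have h1 : R / c.M ≤ ((R + 1 - r₀) + r₀) / c.M := Nat.div_le_div_right (by omega)
      have h3 : ((R + 1 - r₀) + r₀) / c.M ≤ (R + 1 - r₀) / c.M + r₀ / c.M + 1 := by
        rw [Nat.add_div hM]; split_ifs <;> omega
      omega
    simp only [Expr.cost, cost_entry]
    omega
  · intro r hr hr31
    rw [Function.update_of_ne hr31, Function.update_of_ne (by omega), hfr₁' r hr]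

/-- Process the candidate with the key number in register `31`: output its symbol if it is a
majority. -/
def candidateProg : Prog :=
  block [
    .assign 32 (entry (nm 3) (rg 31)),
    .assign 33 (entry (nm 2) (rg 31)),
    .cond (less (rg 33) (rg 17)) searchProg .skip,
    .loop (times (less (entry (nm 2) (rg 31)) (rg 0)) (same (entry (nm 3) (rg 31)) (rg 32)))
      (.assign 31 (plus (rg 31) (nm 1))),
    .assign 33 (minus (plus (rg 31) (rg 6)) (nm 1)),
    .cond (times (less (entry (nm 2) (rg 33)) (plus (rg 1) (nm 1)))
        (same (entry (nm 3) (rg 33)) (rg 32)))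
      (.emit (rg 32)) .skip]

theorem rank_le_n {n σ N z : ℕ} {sy : ℕ → ℕ} (ht : IsText n σ sy) (ha : a < σ) (hz : z ≤ N) :
    rank sy σ N (a * N + z) ≤ n := by
  refine (rank_mono ?_).trans (rank_end_le ht (N := N))
  have : a * N + N ≤ σ * N := by rw [← Nat.succ_mul]; exact Nat.mul_le_mul_right _ ha
  omega

/-- The induction is on the number `m` of occurrences still to be passed. -/
theorem run_scan (hc : c.Valid) (ha : a < c.σ) (hi : i ≤ c.N) :
    ∀ (m : ℕ) (ρ : ℕ → ℕ), ρ 0 = i → ρ 32 = a → ρ 31 + m = rank c.sy c.σ c.N (a * c.N + i) →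
      a * c.N ≤ key c.sy c.σ c.N (ρ 31) →
    Run c.w c.s c.mem (.loop (times (less (entry (nm 2) (rg 31)) (rg 0))
        (same (entry (nm 3) (rg 31)) (rg 32))) (.assign 31 (plus (rg 31) (nm 1)))) ρ o
      fun t ρ' o' => t ≤ 30 * m + 20 ∧ o' = o ∧ (∀ r ≠ 31, ρ' r = ρ r) ∧
        ρ' 31 = rank c.sy c.σ c.N (a * c.N + i) := by
  have hm := hc.memOk
  have hbig := hc.big
  have hn := hc.lt_N
  have hRn := rank_le_n hc.text ha hi
  intro m
  induction m with
  | zero =>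
    intro ρ h0 h32 h31 hkey
    rw [add_zero] at h31
    obtain ⟨p1, p2, p3⟩ := hc.pos (ρ 31) (by omega)
    obtain ⟨s1, s2, s3⟩ := hc.sym (ρ 31) (by omega)
    have hle := if_mul_if_le (p := keyPos c.sy c.σ c.N (ρ 31) < i)
      (q := keySym c.sy c.σ c.N (ρ 31) = a)
    refine Run.loop hm ?_ ?_ ?_
    · simp only [Ok, OkOp, nev, natOp, nev_entry, ok_entry hm, Function.update_apply,
        Nat.reduceEqDiff, if_false, if_true, and_true, true_and, h0, h32, p3, s3]
      omega
    · intro hne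
      exfalso
      simp only [Ok, OkOp, nev, natOp, nev_entry, ok_entry hm, Function.update_apply,
        Nat.reduceEqDiff, if_false, if_true, and_true, true_and, h0, h32, p3, s3, if_mul_if_ne_zero]
        at hne
      rw [keyPos_lt_and_iff ha hi, key_lt_iff] at hne
      omega
    · intro _
      exact ⟨Nat.le_of_ble_eq_true rfl, rfl, fun _ _ => rfl, h31⟩
  | succ m ih =>
    intro ρ h0 h32 h31 hkey
    obtain ⟨p1, p2, p3⟩ := hc.pos (ρ 31) (by omega)
    obtain ⟨s1, s2, s3⟩ := hc.sym (ρ 31) (by omega)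
    have hle := if_mul_if_le (p := keyPos c.sy c.σ c.N (ρ 31) < i)
      (q := keySym c.sy c.σ c.N (ρ 31) = a)
    have htest := (keyPos_lt_and_iff ha hi).2 ⟨hkey, key_lt_iff.2 (by omega)⟩
    refine Run.loop hm ?_ ?_ ?_
    · simp only [Ok, OkOp, nev, natOp, nev_entry, ok_entry hm, Function.update_apply,
        Nat.reduceEqDiff, if_false, if_true, and_true, true_and, h0, h32, p3, s3]
      omega
    · intro _
      refine Run.assign_eq hm (v := ρ 31 + 1) ?_ ?_ ?_
      · simp only [Ok, OkOp, nev, natOp, nev_entry, ok_entry hm, Function.update_apply,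
          Nat.reduceEqDiff, if_false, if_true, and_true, true_and]; omega
      · simp only [Ok, OkOp, nev, natOp, nev_entry, ok_entry hm, Function.update_apply,
          Nat.reduceEqDiff, if_false, if_true, and_true, true_and]
      refine (ih _ (by simpa using h0) (by simpa using h32) (by simp; omega) ?_).mono ?_
      · rw [Function.update_self]
        exact hkey.trans (key_strictMono (Nat.lt_succ_self _)).le
      · rintro t ρ' o' ⟨h1, h2, h3, h4⟩
        refine ⟨?_, h2, fun r hr => (h3 r hr).trans (Function.update_of_ne hr _ _), h4⟩
        simp only [Expr.cost, cost_entry]; omega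
    · intro hz
      exfalso
      revert hz
      simp only [Ok, OkOp, nev, natOp, nev_entry, ok_entry hm, Function.update_apply,
        Nat.reduceEqDiff, if_false, if_true, and_true, true_and, h0, h32, p3, s3]
      exact if_mul_if_ne_zero.2 htest

theorem run_candidateProg (hc : c.Valid) (hk : k ≤ c.kmax) (ha : a < c.σ) {y x' : ℕ}
    (h : Regs c k x T i j ρ) (h31 : ρ 31 = rank c.sy c.σ c.N (a * c.N + y))
    (hx : x = 2 ^ k * x') (hyx : y ≤ x) (hxi : x ≤ i) (hij : i ≤ j) (hj : j < c.n)
    (hy : x' ≤ y / 2 ^ k + c.M) (hocc : 0 < occ c.sy a y c.n) (hT : 1 ≤ T) (hTn : T ≤ c.n) :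
    Run c.w c.s c.mem candidateProg ρ o fun t ρ' o' =>
      t ≤ 600 + 60 * (occ c.sy a y x / c.M) + 30 * occ c.sy a x i ∧
      o' = (if T ≤ occ c.sy a i (j + 1) then o ++ [a] else o) ∧ (∀ r < 31, ρ' r = ρ r) := by
  have hm := hc.memOk
  have hbig := hc.big
  have hn := hc.lt_N
  have e1 := rank_add (N := c.N) (sy := c.sy) ha hyx (by omega)
  have e2 := rank_add (N := c.N) (sy := c.sy) ha hxi (by omega)
  have e3 := rank_add (N := c.N) (sy := c.sy) (u := i) (v := j + 1) ha (by omega) (by omega)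
  have e4 := rank_add (N := c.N) (sy := c.sy) (u := y) (v := c.n) ha (by omega) (by omega)
  have n1 := rank_le_n hc.text ha (z := i) (N := c.N) (by omega)
  have n2 := rank_le_n hc.text ha (z := c.n) (N := c.N) (by omega)
  obtain ⟨r₀, hr₀⟩ : ∃ r₀, r₀ = rank c.sy c.σ c.N (a * c.N + y) := ⟨_, rfl⟩
  have k1 : a * c.N + y ≤ key c.sy c.σ c.N r₀ := le_key_iff.2 hr₀.ge
  have k2 : key c.sy c.σ c.N r₀ < a * c.N + c.n := key_lt_iff.2 (by omega)
  obtain ⟨k3, k4⟩ := keyPos_eq ha (by omega : a * c.N ≤ key c.sy c.σ c.N r₀) (by omega)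
  obtain ⟨p1, p2, p3⟩ := hc.pos r₀ (by omega)
  obtain ⟨s1, s2, s3⟩ := hc.sym r₀ (by omega)
  rw [← hr₀] at h31
  have w2 : 2 < 2 ^ c.w := by omega
  have hMpos : 0 < c.M := Nat.pow_pos hc.b_pos
  simp only [candidateProg, block]
  refine Run.seq (Run.assign_eq hm (v := a) ?_ ?_ ?_)
  · simp only [Ok, OkOp, nev, natOp, nev_entry, ok_entry hm, Function.update_apply,
      Nat.reduceEqDiff, if_false, if_true, and_true, true_and, h31, s3]; omega
  · simp only [Ok, OkOp, nev, natOp, nev_entry, ok_entry hm, Function.update_apply,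
      Nat.reduceEqDiff, if_false, if_true, and_true, true_and, h31, s3, k4]
  refine Run.seq (Run.assign_eq hm (v := keyPos c.sy c.σ c.N r₀) ?_ ?_ ?_)
  · simp only [Ok, OkOp, nev, natOp, nev_entry, ok_entry hm, Function.update_apply,
      Nat.reduceEqDiff, if_false, if_true, and_true, true_and, h31, p3]; omega
  · simp only [Ok, OkOp, nev, natOp, nev_entry, ok_entry hm, Function.update_apply,
      Nat.reduceEqDiff, if_false, if_true, and_true, true_and, h31, p3]
  obtain ⟨ρ₁, hρ₁⟩ : ∃ ρ₁, ρ₁ = Function.update (Function.update ρ 32 a) 33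
    (keyPos c.sy c.σ c.N r₀) := ⟨_, rfl⟩
  have hfr₁ : ∀ r < 31, ρ₁ r = ρ r := fun r hr => by
    rw [hρ₁, Function.update_of_ne (by omega), Function.update_of_ne (by omega)]
  have h1_31 : ρ₁ 31 = r₀ := by rw [hρ₁]; simpa using h31
  have h1_32 : ρ₁ 32 = a := by rw [hρ₁]; simp
  have h1_33 : ρ₁ 33 = keyPos c.sy c.σ c.N r₀ := by rw [hρ₁]; simp
  have hR₁ := h.congr hfr₁
  rw [← hρ₁]
  have hcond : Run c.w c.s c.mem (.cond (less (rg 33) (rg 17)) searchProg .skip) ρ₁ o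
      fun t ρ' o' => t ≤ 410 + 60 * (occ c.sy a y x / c.M) ∧ o' = o ∧
        (∀ r < 33, r ≠ 31 → ρ' r = ρ₁ r) ∧ ρ' 31 = rank c.sy c.σ c.N (a * c.N + x) := by
    refine Run.cond hm ⟨trivial, trivial, trivial⟩ ?_ ?_
    · intro hlt
      simp only [Ok, OkOp, nev, natOp, nev_entry, ok_entry hm, Function.update_apply,
        Nat.reduceEqDiff, if_false, if_true, and_true, true_and, h1_33, hR₁.r17, ne_eq,
        ite_eq_right_iff, one_ne_zero, imp_false,
        not_not] at hlt
      have hdiv : y / 2 ^ k ≤ keyPos c.sy c.σ c.N r₀ / 2 ^ k := Nat.div_le_div_right (by omega)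
      refine (run_searchProg hc hk ha hR₁ h1_31 h1_32 h1_33 hx (by omega) (by omega) (by omega)
        (by omega)).mono ?_
      rintro t ρ' o' ⟨h1, h2, h3, h4⟩
      refine ⟨?_, h2, h3, h4⟩
      rw [show rank c.sy c.σ c.N (a * c.N + x) - r₀ = occ c.sy a y x by omega] at h1
      simp only [Expr.cost]
      omega
    · intro hge
      simp only [Ok, OkOp, nev, natOp, nev_entry, ok_entry hm, Function.update_apply,
        Nat.reduceEqDiff, if_false, if_true, and_true, true_and, h1_33, hR₁.r17, ite_eq_right_iff,
        one_ne_zero, imp_false, not_lt] at hge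
      refine Run.skip ⟨?_, rfl, fun _ _ _ => rfl, ?_⟩
      · simp only [Expr.cost]; omega
      -- If the first occurrence from y on is already at or after x, the ranks at y and x coincide
      -- and no search is needed.
      · have : rank c.sy c.σ c.N (a * c.N + x) ≤ r₀ := le_key_iff.1 (by omega)
        omega
  refine Run.seq (hcond.mono ?_)
  rintro t₂ ρ₂ o₂ ⟨ht₂, ho₂, hfr₂, h2_31⟩
  have hfr₂' : ∀ r < 31, ρ₂ r = ρ r := fun r hr =>
    (hfr₂ r (by omega) (by omega)).trans (hfr₁ r hr)
  have h2_32 : ρ₂ 32 = a := (hfr₂ 32 (by norm_num) (by norm_num)).trans h1_32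
  have hkx : a * c.N ≤ key c.sy c.σ c.N (rank c.sy c.σ c.N (a * c.N + x)) := by
    have : a * c.N + x ≤ _ := le_key_iff.2 (le_refl (rank c.sy c.σ c.N (a * c.N + x)))
    omega
  refine Run.seq ((run_scan hc ha (by omega) (occ c.sy a x i) ρ₂
    ((hfr₂' 0 (by norm_num)).trans h.r0) h2_32 (by omega) (by rwa [h2_31])).mono ?_)
  rintro t₃ ρ₃ o₃ ⟨ht₃, ho₃, hfr₃, h3_31⟩
  have hfr₃' : ∀ r < 31, ρ₃ r = ρ r := fun r hr =>
    (hfr₃ r (by omega)).trans (hfr₂' r hr)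
  have h3_32 : ρ₃ 32 = a := (hfr₃ 32 (by norm_num)).trans h2_32
  have hR₃ := h.congr hfr₃'
  -- This would be the T-th occurrence of a from i on. It is at most j and has symbol a exactly if
  -- the range contains T occurrences, so one probe replaces counting.
  obtain ⟨r₁, hr₁⟩ : ∃ r₁, r₁ = rank c.sy c.σ c.N (a * c.N + i) + T - 1 := ⟨_, rfl⟩
  obtain ⟨q1, q2, q3⟩ := hc.pos r₁ (by omega)
  obtain ⟨u1, u2, u3⟩ := hc.sym r₁ (by omega)
  have hle := if_mul_if_le (p := keyPos c.sy c.σ c.N r₁ < j + 1)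
    (q := keySym c.sy c.σ c.N r₁ = a)
  have htest := keyPos_lt_and_iff (sy := c.sy) (r := r₁) ha (show j + 1 ≤ c.N by omega)
  have hk1 : a * c.N + i ≤ key c.sy c.σ c.N r₁ := le_key_iff.2 (by omega)
  have hk2 := key_lt_iff (sy := c.sy) (σ := c.σ) (N := c.N) (r := r₁) (x := a * c.N + (j + 1))
  refine Run.seq (Run.assign_eq hm (v := r₁) ?_ ?_ ?_)
  · simp only [Ok, OkOp, nev, natOp, nev_entry, ok_entry hm, Function.update_apply,
      Nat.reduceEqDiff, if_false, if_true, and_true, true_and, h3_31, hR₃.r6]; omega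
  · simp only [Ok, OkOp, nev, natOp, nev_entry, ok_entry hm, Function.update_apply,
      Nat.reduceEqDiff, if_false, if_true, and_true, true_and, h3_31, hR₃.r6, hr₁]
  have hfr₄ : ∀ r < 31, Function.update ρ₃ 33 r₁ r = ρ r := fun r hr =>
    (Function.update_of_ne (by omega) _ _).trans (hfr₃' r hr)
  refine Run.cond hm ?_ ?_ ?_
  · simp only [Ok, OkOp, nev, natOp, nev_entry, ok_entry hm, Function.update_apply,
      Nat.reduceEqDiff, if_false, if_true, and_true, true_and, hR₃.r1, h3_32, q3, u3]; omega
  · intro hne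
    simp only [Ok, OkOp, nev, natOp, nev_entry, ok_entry hm, Function.update_apply,
      Nat.reduceEqDiff, if_false, if_true, and_true, true_and, hR₃.r1, h3_32, q3, u3,
      if_mul_if_ne_zero] at hne
    refine Run.emit hm trivial ⟨?_, ?_, hfr₄⟩
    · simp only [Expr.cost, cost_entry]; omega
    · rw [if_pos (by omega), ho₃, ho₂]
      simp only [Ok, OkOp, nev, natOp, nev_entry, ok_entry hm, Function.update_apply,
        Nat.reduceEqDiff, if_false, if_true, and_true, true_and, h3_32]
  · intro h0
    have hne : ¬ (keyPos c.sy c.σ c.N r₁ < j + 1 ∧ keySym c.sy c.σ c.N r₁ = a) := by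
      intro hh
      revert h0
      simp only [Ok, OkOp, nev, natOp, nev_entry, ok_entry hm, Function.update_apply,
        Nat.reduceEqDiff, if_false, if_true, and_true, true_and, hR₃.r1, h3_32, q3, u3]
      exact if_mul_if_ne_zero.2 hh
    refine Run.skip ⟨?_, ?_, hfr₄⟩
    · simp only [Expr.cost, cost_entry]; omega
    · rw [htest] at hne
      rw [if_neg (by omega), ho₃, ho₂]

/-- Padding of the lists of candidates is passed over. -/
theorem run_candidateProg_pad (hc : c.Valid) (h : Regs c k x T i j ρ) (h31 : ρ 31 = c.n)
    (hx : x ≤ i) (hij : i ≤ j) (hj : j < c.n) (hT : 1 ≤ T) (hTn : T ≤ c.n) :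
    Run c.w c.s c.mem candidateProg ρ o fun t ρ' o' =>
      t ≤ 600 ∧ o' = o ∧ (∀ r < 31, ρ' r = ρ r) := by
  have hm := hc.memOk
  have hbig := hc.big
  have hn := hc.lt_N
  obtain ⟨p1, p2, p3⟩ := hc.pos c.n (by omega)
  obtain ⟨s1, s2, s3⟩ := hc.sym c.n (by omega)
  obtain ⟨q1, q2, q3⟩ := hc.pos (c.n + T - 1) (by omega)
  obtain ⟨u1, u2, u3⟩ := hc.sym (c.n + T - 1) (by omega)
  -- From the number n on, keys have position N, which exceeds x, i and j; all three tests of the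
  -- program fail.
  rw [keyPos_of_le hc.text le_rfl] at p3
  rw [keyPos_of_le hc.text (by omega)] at q3
  generalize keySym c.sy c.σ c.N c.n = a at *
  generalize keySym c.sy c.σ c.N (c.n + T - 1) = a' at *
  have hle : (if c.N < i then 1 else 0) * 1 ≤ 1 := by split <;> omega
  have hle' := if_mul_if_le (p := c.N < j + 1) (q := a' = a)
  simp only [candidateProg, block]
  refine Run.seq (Run.assign_eq hm (v := a) ?_ ?_ ?_)
  · simp only [Ok, OkOp, nev, natOp, nev_entry, ok_entry hm, Function.update_apply,
      Nat.reduceEqDiff, if_false, if_true, and_true, true_and, h31]; omega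
  · simp only [Ok, OkOp, nev, natOp, nev_entry, ok_entry hm, Function.update_apply,
      Nat.reduceEqDiff, if_false, if_true, and_true, true_and, h31, s3]
  refine Run.seq (Run.assign_eq hm (v := c.N) ?_ ?_ ?_)
  · simp only [Ok, OkOp, nev, natOp, nev_entry, ok_entry hm, Function.update_apply,
      Nat.reduceEqDiff, if_false, if_true, and_true, true_and, h31]; omega
  · simp only [Ok, OkOp, nev, natOp, nev_entry, ok_entry hm, Function.update_apply,
      Nat.reduceEqDiff, if_false, if_true, and_true, true_and, h31, p3]
  refine Run.seq (Run.cond hm ⟨trivial, trivial, trivial⟩ ?_ ?_)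
  · intro hlt
    exfalso
    simp only [Ok, OkOp, nev, natOp, nev_entry, ok_entry hm, Function.update_apply,
      Nat.reduceEqDiff, if_false, if_true, and_true, true_and, h.r17, ne_eq, ite_eq_right_iff,
      one_ne_zero, imp_false, not_not] at hlt
    omega
  intro _
  refine Run.skip ?_
  refine Run.seq (Run.loop hm ?_ ?_ ?_)
  · simp only [Ok, OkOp, nev, natOp, nev_entry, ok_entry hm, Function.update_apply,
      Nat.reduceEqDiff, if_false, if_true, and_true, true_and, h31, p3, s3, h.r0]; omega
  · intro hne
    exfalso
    simp only [Ok, OkOp, nev, natOp, nev_entry, ok_entry hm, Function.update_apply,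
      Nat.reduceEqDiff, if_false, if_true, and_true, true_and, h31, p3, s3, h.r0] at hne
    rw [if_neg (by omega)] at hne
    exact hne rfl
  intro _
  refine Run.seq (Run.assign_eq hm (v := c.n + T - 1) ?_ ?_ ?_)
  · simp only [Ok, OkOp, nev, natOp, nev_entry, ok_entry hm, Function.update_apply,
      Nat.reduceEqDiff, if_false, if_true, and_true, true_and, h31, h.r6]; omega
  · simp only [Ok, OkOp, nev, natOp, nev_entry, ok_entry hm, Function.update_apply,
      Nat.reduceEqDiff, if_false, if_true, and_true, true_and, h31, h.r6]
  refine Run.cond hm ?_ ?_ ?_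
  · simp only [Ok, OkOp, nev, natOp, nev_entry, ok_entry hm, Function.update_apply,
      Nat.reduceEqDiff, if_false, if_true, and_true, true_and, q3, u3, h.r1]; omega
  · intro hne
    exfalso
    simp only [Ok, OkOp, nev, natOp, nev_entry, ok_entry hm, Function.update_apply,
      Nat.reduceEqDiff, if_false, if_true, and_true, true_and, q3, u3, h.r1, if_mul_if_ne_zero]
      at hne
    omega
  intro _
  refine Run.skip ⟨?_, rfl, ?_⟩
  · simp only [Expr.cost, cost_entry]; omega
  · intro r hr
    rw [Function.update_of_ne (by omega), Function.update_of_ne (by omega),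
      Function.update_of_ne (by omega)]

end RangeMajority

namespace RangeMajority
open WordRAM

set_option linter.unusedSimpArgs false

/-! ### Candidates and their lists -/

variable {n σ N k s y a m t A : ℕ} {sy e e' : ℕ → ℕ}

/-- Symbols that are frequent in the range of length `3 * s * 2 ^ k` from the position `y` on. -/
def candidates (sy : ℕ → ℕ) (σ k s y : ℕ) : Finset ℕ :=
  (Finset.range σ).filter fun a => 0 < occ sy a y (y + 3 * s * 2 ^ k) ∧
    (s ≤ 2 * occ sy a y (y + 3 * s * 2 ^ k) ∨ σ ≤ 2 ^ k)

/-- Each candidate takes at least s/2 of the 3·s·2^k positions of the window, unless there are at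
most 2^k symbols altogether. -/
theorem card_candidates_le (hs : 0 < s) : (candidates sy σ k s y).card ≤ 6 * 2 ^ k := by
  by_cases hσ : σ ≤ 2 ^ k
  · have := Finset.card_filter_le (Finset.range σ) fun a => 0 < occ sy a y (y + 3 * s * 2 ^ k) ∧
      (s ≤ 2 * occ sy a y (y + 3 * s * 2 ^ k) ∨ σ ≤ 2 ^ k)
    rw [Finset.card_range] at this
    rw [candidates]; omega
  · have h1 := sum_occ_le (sy := sy) (u := y) (v := y + 3 * s * 2 ^ k) (candidates sy σ k s y)
    have h2 : (candidates sy σ k s y).card * s ≤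
        ∑ a ∈ candidates sy σ k s y, 2 * occ sy a y (y + 3 * s * 2 ^ k) := by
      rw [← smul_eq_mul, ← Finset.sum_const]
      refine Finset.sum_le_sum fun a ha => ?_
      have := (Finset.mem_filter.1 ha).2.2
      omega
    rw [← Finset.mul_sum] at h2
    refine Nat.le_of_mul_le_mul_right (c := s) ?_ hs
    have : 6 * 2 ^ k * s = 2 * (3 * s * 2 ^ k) := by ring
    omega

theorem filterMap_range_getElem? {α : Type*} (l : List α) (h : l.length ≤ m) :
    (List.range m).filterMap (fun t => l[t]?) = l := by
  obtain ⟨d, rfl⟩ := Nat.exists_eq_add_of_le h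
  have key : ∀ A, (List.range A).filterMap (fun t => l[t]?) = l.take A := by
    intro A
    induction A with
    | zero => simp
    | succ A ih =>
      rw [List.range_succ, List.filterMap_append, ih, List.take_add_one]
      congr 1
  rw [key, List.take_of_length_le (by omega)]

/-- The start of the window of the entry number `t` of a stream: each entry `0` moves the
window, of length `s`, to the next position. -/
def streamBase (e : ℕ → ℕ) (s y : ℕ) : ℕ → ℕ
  | 0 => y
  | t + 1 => streamBase e s y t + if e t = 0 then s else 0

/-- The position that the entry number `t` of a stream stands for. -/
def streamPos (e : ℕ → ℕ) (s y t : ℕ) : Option ℕ :=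
  if e t = 0 then none else some (streamBase e s y t + e t - 1)

theorem le_streamBase : y ≤ streamBase e s y t := by
  induction t with
  | zero => exact le_rfl
  | succ t ih => rw [streamBase]; omega

theorem streamBase_le : streamBase e s y t ≤ y + s * t := by
  induction t with
  | zero => exact le_rfl
  | succ t ih => rw [streamBase, Nat.mul_succ]; split <;> omega

theorem streamBase_congr (h : ∀ u < t, e u = e' u) : streamBase e s y t = streamBase e' s y t := by
  induction t with
  | zero => rfl
  | succ t ih => rw [streamBase, streamBase, ih fun u hu => h u (by omega), h t (by omega)]

/-- The stream `e` of length `A` encodes the set `P` of positions, and ends with the window `m`. -/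
structure Encodes (e : ℕ → ℕ) (s y m A : ℕ) (P : Finset ℕ) : Prop where
  le : ∀ t, e t ≤ s
  base : streamBase e s y A = y + s * m
  perm : ((List.range A).filterMap (streamPos e s y)).Perm P.toList

theorem filterMap_streamPos_update {v : ℕ} :
    (List.range A).filterMap (streamPos (Function.update e A v) s y) =
      (List.range A).filterMap (streamPos e s y) := by
  refine List.filterMap_congr fun t ht => ?_
  rw [List.mem_range] at ht
  rw [streamPos, streamPos, Function.update_of_ne ht.ne,
    streamBase_congr fun u hu => Function.update_of_ne (by omega) _ _]

theorem streamBase_update {v : ℕ} :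
    streamBase (Function.update e A v) s y A = streamBase e s y A :=
  streamBase_congr fun u hu => Function.update_of_ne (by omega) _ _

theorem Encodes.insert {P : Finset ℕ} (h : Encodes e s y m A P) {p : ℕ} (hp : p ∉ P)
    (h1 : y + s * m ≤ p) (h2 : p < y + s * m + s) :
    Encodes (Function.update e A (p - (y + s * m) + 1)) s y m (A + 1) (insert p P) where
  le t := by
    by_cases ht : t = A
    · subst ht; rw [Function.update_self]; omega
    · rw [Function.update_of_ne ht]; exact h.le t
  base := by
    rw [streamBase, streamBase_update, h.base, Function.update_self, if_neg (by omega), add_zero]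
  perm := by
    rw [List.range_succ, List.filterMap_append, filterMap_streamPos_update]
    have : streamPos (Function.update e A (p - (y + s * m) + 1)) s y A = some p := by
      rw [streamPos, streamBase_update, h.base, Function.update_self, if_neg (by omega)]
      congr 1; omega
    simp only [List.filterMap_cons, this, List.filterMap_nil]
    exact (List.perm_append_singleton p _).trans
      ((h.perm.cons p).trans (Finset.toList_insert hp).symm)

theorem Encodes.next {P : Finset ℕ} (h : Encodes e s y m A P) :
    Encodes (Function.update e A 0) s y (m + 1) (A + 1) P where
  le t := by
    by_cases ht : t = A
    · subst ht; rw [Function.update_self]; omega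
    · rw [Function.update_of_ne ht]; exact h.le t
  base := by
    rw [streamBase, streamBase_update, h.base, Function.update_self, if_pos rfl]; ring
  perm := by
    rw [List.range_succ, List.filterMap_append, filterMap_streamPos_update]
    have : streamPos (Function.update e A 0) s y A = none := by
      rw [streamPos, Function.update_self, if_pos rfl]
    simpa only [List.filterMap_cons, this, List.filterMap_nil, List.append_nil] using h.perm

theorem exists_encodes_window {P : Finset ℕ} (h : Encodes e s y m A P) (Q : Finset ℕ)
    (hQ : ∀ p ∈ Q, y + s * m ≤ p ∧ p < y + s * m + s) (hd : Disjoint P Q) :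
    ∃ e', Encodes e' s y m (A + Q.card) (P ∪ Q) := by
  induction Q using Finset.induction with
  | empty => exact ⟨e, by simpa using h⟩
  | insert p Q hp ih =>
    rw [Finset.disjoint_insert_right] at hd
    obtain ⟨e', he'⟩ := ih (fun q hq => hQ q (Finset.mem_insert_of_mem hq)) hd.2
    obtain ⟨h1, h2⟩ := hQ p (Finset.mem_insert_self _ _)
    rw [Finset.union_insert, Finset.card_insert_of_notMem hp]
    exact ⟨_, he'.insert (by simp [hd.1, hp]) h1 h2⟩

/-- Window by window: one entry for each position of P in the window, then a zero to move on. This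
makes |P| + m entries, none above s. -/
theorem exists_encodes (s y m : ℕ) (P : Finset ℕ) (hP : ∀ p ∈ P, y ≤ p ∧ p < y + s * m) :
    ∃ e, Encodes e s y m (P.card + m) P := by
  induction m generalizing P with
  | zero =>
    obtain rfl : P = ∅ := Finset.eq_empty_of_forall_notMem fun p hp => by have := hP p hp; omega
    exact ⟨fun _ => 0, fun _ => Nat.zero_le _, rfl, by simp⟩
  | succ m ih =>
    obtain ⟨e, he⟩ := ih (P.filter (· < y + s * m)) fun p hp => by
      rw [Finset.mem_filter] at hp; exact ⟨(hP p hp.1).1, hp.2⟩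
    obtain ⟨e', he'⟩ := exists_encodes_window he (P.filter fun p => ¬ p < y + s * m)
      (fun p hp => by
        rw [Finset.mem_filter] at hp
        have := hP p hp.1
        rw [Nat.mul_succ] at this
        omega) (Finset.disjoint_filter_filter_not _ _ _)
    have hc := Finset.card_filter_add_card_filter_not (s := P) (· < y + s * m)
    rw [Finset.filter_union_filter_not_eq] at he'
    have := he'.next
    rw [show (P.filter (· < y + s * m)).card + m + (P.filter fun p => ¬ p < y + s * m).card + 1 =
      P.card + (m + 1) by omega] at this
    exact ⟨_, this⟩

/-- Zeros at the end stand for no position, so all streams can be padded to one length. -/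
theorem exists_encodes_of_le (s y m : ℕ) (P : Finset ℕ) (hP : ∀ p ∈ P, y ≤ p ∧ p < y + s * m)
    (hA : P.card + m ≤ A) : ∃ e m', Encodes e s y m' A P := by
  obtain ⟨d, rfl⟩ := Nat.exists_eq_add_of_le hA
  induction d with
  | zero => obtain ⟨e, h⟩ := exists_encodes s y m P hP; exact ⟨e, m, h⟩
  | succ d ih => obtain ⟨e, m', h⟩ := ih (by omega); exact ⟨_, _, h.next⟩

theorem occ_eq_zero_iff {u v : ℕ} : occ sy a u v = 0 ↔ ∀ p, u ≤ p → p < v → sy p ≠ a := by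
  rw [occ, Finset.card_eq_zero, Finset.filter_eq_empty_iff]
  simp only [Finset.mem_Ico, and_imp, ne_eq]

theorem exists_first {v : ℕ} (h : 0 < occ sy a y v) :
    ∃ p, y ≤ p ∧ p < v ∧ sy p = a ∧ occ sy a y p = 0 := by
  classical
  rw [Nat.pos_iff_ne_zero, ne_eq, occ_eq_zero_iff] at h
  push Not at h
  have h' : ∃ p, y ≤ p ∧ p < v ∧ sy p = a := h
  obtain ⟨h1, h2, h3⟩ := Nat.find_spec h'
  refine ⟨_, h1, h2, h3, occ_eq_zero_iff.2 fun p hp hp' hpa => ?_⟩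
  exact Nat.find_min h' hp' ⟨hp, by omega, hpa⟩

/-- The stream `e` of length `9 * 2 ^ k` encodes the first positions of the candidates. -/
structure IsStream (sy : ℕ → ℕ) (σ k s y : ℕ) (e : ℕ → ℕ) : Prop where
  le : ∀ t, e t ≤ s
  perm : ((List.range (9 * 2 ^ k)).filterMap fun t => (streamPos e s y t).map sy).Perm
    (candidates sy σ k s y).toList
  first : ∀ t < 9 * 2 ^ k, e t ≠ 0 →
    sy (streamBase e s y t + e t - 1) ∈ candidates sy σ k s y ∧
    occ sy (sy (streamBase e s y t + e t - 1)) y (streamBase e s y t + e t - 1) = 0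

/-- Each candidate is represented by its first position from y on; distinct first positions carry
distinct symbols. The length 9·2^k is made up of at most 6·2^k candidates and 3·2^k moves of the
window. -/
theorem exists_isStream (sy : ℕ → ℕ) (σ k y : ℕ) (hs : 0 < s) :
    ∃ e, IsStream sy σ k s y e := by
  let P := (Finset.Ico y (y + s * (3 * 2 ^ k))).filter fun p =>
    sy p ∈ candidates sy σ k s y ∧ occ sy (sy p) y p = 0
  have hP : ∀ p, p ∈ P ↔ (y ≤ p ∧ p < y + s * (3 * 2 ^ k)) ∧
    sy p ∈ candidates sy σ k s y ∧ occ sy (sy p) y p = 0 := fun p => by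
      simp only [P, Finset.mem_filter, Finset.mem_Ico]
  have hinj : ∀ p ∈ P, ∀ q ∈ P, sy p = sy q → p = q := by
    intro p hp q hq hpq
    have h1 := occ_eq_zero_iff.1 ((hP p).1 hp).2.2
    have h2 := occ_eq_zero_iff.1 ((hP q).1 hq).2.2
    have h3 := ((hP p).1 hp).1
    have h4 := ((hP q).1 hq).1
    rcases lt_trichotomy p q with h | h | h
    · exact absurd hpq (h2 p h3.1 h)
    · exact h
    · exact absurd hpq.symm (h1 q h4.1 h)
  have himage : P.image sy = candidates sy σ k s y := by
    ext a
    simp only [Finset.mem_image]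
    constructor
    · rintro ⟨p, hp, rfl⟩; exact ((hP p).1 hp).2.1
    · intro ha
      obtain ⟨p, h1, h2, h3, h4⟩ := exists_first (Finset.mem_filter.1 ha).2.1
      refine ⟨p, (hP p).2 ⟨⟨h1, ?_⟩, h3 ▸ ha, h3 ▸ h4⟩, h3⟩
      have : s * (3 * 2 ^ k) = 3 * s * 2 ^ k := by ring
      omega
  have hcard : P.card ≤ 6 * 2 ^ k := by
    rw [← Finset.card_image_of_injOn (f := sy) (s := P) (fun p hp q hq h => hinj p hp q hq h),
      himage]
    exact card_candidates_le hs
  obtain ⟨e, m', he⟩ := exists_encodes_of_le (A := 9 * 2 ^ k) s y (3 * 2 ^ k) P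
    (fun p hp => ((hP p).1 hp).1) (by omega)
  refine ⟨e, he.le, ?_, fun t ht h0 => ?_⟩
  · rw [← List.map_filterMap]
    refine (he.perm.map sy).trans ?_
    refine (List.perm_ext_iff_of_nodup ?_ (Finset.nodup_toList _)).2 fun a => ?_
    · exact (Finset.nodup_toList P).map_on fun p hp q hq h =>
        hinj p (Finset.mem_toList.1 hp) q (Finset.mem_toList.1 hq) h
    · rw [Finset.mem_toList, ← himage]; simp
  · have : streamBase e s y t + e t - 1 ∈ P := by
      rw [← Finset.mem_toList, ← he.perm.mem_iff, List.mem_filterMap]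
      exact ⟨t, List.mem_range.2 ht, by rw [streamPos, if_neg h0]⟩
    exact ((hP _).1 this).2

end RangeMajority

namespace RangeMajority
open WordRAM

set_option linter.unusedSimpArgs false

/-! ### The query program -/

theorem Params.Valid.shift_lt {c : Params} (hc : c.Valid) {u : ℕ} (hu : u < c.b) :
    c.f * u < 2 ^ c.w := by
  have hbig := hc.big
  have h1 : c.f * u < 2 ^ (c.f * u) := Nat.lt_two_pow_self
  have h2 : 2 ^ (c.f * u) ≤ 2 ^ (c.f * c.b) :=
    Nat.pow_le_pow_right (by norm_num) (Nat.mul_le_mul_left _ hu.le)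
  rw [pow_mul 2 c.f c.b] at h2
  have h3 : (2 ^ c.f) ^ c.b ≤ (2 ^ c.f) ^ c.b * (2 * 2 ^ c.f) :=
    Nat.le_mul_of_pos_right _ (by positivity)
  have h4 : c.F ^ c.b * (2 * c.F) = (2 ^ c.f) ^ c.b * (2 * 2 ^ c.f) := rfl
  omega

namespace Params

/-- Length of the blocks that share a list of candidates, in units of `2 ^ k`. -/
abbrev width (c : Params) (g : ℕ) : ℕ := min (2 ^ g) c.M

/-- A stream of the candidates of the block number `u`. -/
noncomputable def stream (c : Params) (k g u : ℕ) : ℕ → ℕ :=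
  (exists_isStream c.sy c.σ k (u * (c.width g * 2 ^ k)) (Nat.two_pow_pos g)).choose

theorem stream_spec (c : Params) (k g u : ℕ) :
    IsStream c.sy c.σ k (2 ^ g) (u * (c.width g * 2 ^ k)) (c.stream k g u) :=
  (exists_isStream c.sy c.σ k (u * (c.width g * 2 ^ k)) (Nat.two_pow_pos g)).choose_spec

/-- The candidates of the block number `u` as a list, for long blocks. -/
noncomputable def fullSlot (c : Params) (k g u t : ℕ) : Option ℕ :=
  (candidates c.sy c.σ k (2 ^ g) (u * (c.width g * 2 ^ k))).toList[t]?

/-- The entry number `t` of the list of candidates of the block number `u`. -/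
noncomputable def slot (c : Params) (k g u t : ℕ) : Option ℕ :=
  if 2 ^ g < c.b then
    (streamPos (c.stream k g u) (2 ^ g) (u * (c.width g * 2 ^ k)) t).map c.sy
  else c.fullSlot k g u t

/-- The number of the key at which the search for a candidate starts. -/
noncomputable def start (c : Params) (k g u : ℕ) (a : Option ℕ) : ℕ :=
  a.elim c.n fun a => rank c.sy c.σ c.N (a * c.N + u * (c.width g * 2 ^ k))

/-- All tables are in the memory. -/
structure Full (c : Params) : Prop extends c.Valid where
  B_pos : 1 ≤ c.B
  B_le : 32 * c.B * c.B * c.B ≤ 2 ^ c.w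
  n_lt_B : c.n < c.B * c.B * c.B
  big' : 1000 * c.n ≤ 2 ^ c.w
  kmax_spec : c.σ ≤ 2 ^ c.kmax ∨ c.n < 2 ^ (c.kmax + 1)
  scal_B : Rd c.s c.mem 0 0 c.B
  scal_K : Rd c.s c.mem 0 1 (2 ^ c.kmax)
  scal_b : Rd c.s c.mem 0 2 c.b
  scal_M : Rd c.s c.mem 0 3 c.M
  scal_G : Rd c.s c.mem 0 4 (c.G + 3)
  scal_F : Rd c.s c.mem 0 5 c.F
  scal_f : Rd c.s c.mem 0 6 c.f
  scal_n : Rd c.s c.mem 0 7 c.n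
  log : ∀ v, 1 ≤ v → v ≤ c.n → Rd c.s c.mem 1 v (Nat.log 2 v)
  rank : ∀ p < c.n, Rd c.s c.mem 4 p (rank c.sy c.σ c.N (c.sy p * c.N + p))
  small : ∀ k ≤ c.kmax, ∀ g, 2 ^ g * 2 ^ k ≤ c.n → 2 ^ g < c.b → ∀ q,
    q * c.b ≤ 9 * (c.n / 2 ^ g) + 9 * 2 ^ k → Rd c.s c.mem (c.dir k + 3 + g) q
      (pack c.F c.b fun v => c.stream k g ((q * c.b + v) / (9 * 2 ^ k)) ((q * c.b + v) % (9 * 2 ^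
        k)))
  full : ∀ k ≤ c.kmax, ∀ g, 2 ^ g * 2 ^ k ≤ c.n → c.b ≤ 2 ^ g → ∀ u,
    u * (c.width g * 2 ^ k) < c.n → ∀ t < 9 * 2 ^ k,
    Rd c.s c.mem (c.dir k + 3 + g) (u * (9 * 2 ^ k) + t)
      (c.start k g u (c.fullSlot k g u t))

/-- Both encodings list every candidate exactly once; the output inherits completeness and freedom
from repetition. -/
theorem slots_perm (c : Params) (k g u : ℕ) :
    ((List.range (9 * 2 ^ k)).filterMap (c.slot k g u)).Perm
      (candidates c.sy c.σ k (2 ^ g) (u * (c.width g * 2 ^ k))).toList := by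
  by_cases h : 2 ^ g < c.b
  · rw [List.filterMap_congr fun t _ => by rw [slot, if_pos h]]
    exact (c.stream_spec k g u).perm
  · rw [List.filterMap_congr (g := c.fullSlot k g u) fun t _ => by rw [slot, if_neg h]]
    have h1 := card_candidates_le (sy := c.sy) (σ := c.σ) (k := k)
      (y := u * (c.width g * 2 ^ k)) (Nat.two_pow_pos g)
    have h2 := filterMap_range_getElem? (m := 9 * 2 ^ k)
      (candidates c.sy c.σ k (2 ^ g) (u * (c.width g * 2 ^ k))).toList
      (by rw [Finset.length_toList]; omega)
    exact List.Perm.of_eq h2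

end Params

/-- Put the number of the key at which the search for the next candidate starts in register
`31`. -/
def fetchProg : Prog :=
  .cond (rg 22)
    (block [
      .assign 30 (rem (shr (entry (plus (rg 18) (plus (nm 3) (rg 9)))
        (quo (plus (rg 23) (rg 20)) (rg 11)))
        (times (rg 25) (rem (plus (rg 23) (rg 20)) (rg 11)))) (rg 24)),
      .cond (rg 30)
        (.assign 31 (entry (nm 4) (minus (plus (rg 21) (rg 30)) (nm 1))))
        (.seq (.assign 21 (plus (rg 21) (rg 10))) (.assign 31 (rg 26)))])
    (.assign 31 (entry (plus (rg 18) (plus (nm 3) (rg 9))) (plus (rg 23) (rg 20))))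

/-- Registers in the main loop. -/
structure LoopRegs (c : Params) (k x T i j g u : ℕ) (ρ : ℕ → ℕ) : Prop
    extends Regs c k x T i j ρ where
  r9 : ρ 9 = g
  r10 : ρ 10 = 2 ^ g
  r19 : ρ 19 = 9 * 2 ^ k
  r22 : ρ 22 = if 2 ^ g < c.b then 1 else 0
  r23 : ρ 23 = u * (9 * 2 ^ k)
  r26 : ρ 26 = c.n

variable {c : Params} {k x T i j g u t : ℕ} {ρ : ℕ → ℕ} {o : List ℕ}

theorem LoopRegs.congr {ρ' : ℕ → ℕ} (h : LoopRegs c k x T i j g u ρ)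
    (h' : ∀ r < 30, r ≠ 20 → r ≠ 21 → ρ' r = ρ r) : LoopRegs c k x T i j g u ρ' where
  r0 := (h' _ (by norm_num) (by norm_num) (by norm_num)).trans h.r0
  r1 := (h' _ (by norm_num) (by norm_num) (by norm_num)).trans h.r1
  r6 := (h' _ (by norm_num) (by norm_num) (by norm_num)).trans h.r6
  r8 := (h' _ (by norm_num) (by norm_num) (by norm_num)).trans h.r8
  r11 := (h' _ (by norm_num) (by norm_num) (by norm_num)).trans h.r11
  r12 := (h' _ (by norm_num) (by norm_num) (by norm_num)).trans h.r12
  r17 := (h' _ (by norm_num) (by norm_num) (by norm_num)).trans h.r17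
  r18 := (h' _ (by norm_num) (by norm_num) (by norm_num)).trans h.r18
  r24 := (h' _ (by norm_num) (by norm_num) (by norm_num)).trans h.r24
  r25 := (h' _ (by norm_num) (by norm_num) (by norm_num)).trans h.r25
  r9 := (h' _ (by norm_num) (by norm_num) (by norm_num)).trans h.r9
  r10 := (h' _ (by norm_num) (by norm_num) (by norm_num)).trans h.r10
  r19 := (h' _ (by norm_num) (by norm_num) (by norm_num)).trans h.r19
  r22 := (h' _ (by norm_num) (by norm_num) (by norm_num)).trans h.r22
  r23 := (h' _ (by norm_num) (by norm_num) (by norm_num)).trans h.r23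
  r26 := (h' _ (by norm_num) (by norm_num) (by norm_num)).trans h.r26

/-- A long list stores the rank at y itself. A stream gives only the first position p of the symbol;
as the symbol does not occur in [y, p), its rank at p, which is tabulated for every position, equals
its rank at y. -/
theorem run_fetchProg (hc : c.Full) (hk : k ≤ c.kmax) (hg : 2 ^ g * 2 ^ k ≤ c.n)
    (hu : u * (c.width g * 2 ^ k) < c.n) (h : LoopRegs c k x T i j g u ρ)
    (ht : t < 9 * 2 ^ k) (h20 : ρ 20 = t)
    (h21 : 2 ^ g < c.b →
      ρ 21 = streamBase (c.stream k g u) (2 ^ g) (u * (c.width g * 2 ^ k)) t) :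
    Run c.w c.s c.mem fetchProg ρ o fun t' ρ' o' => t' ≤ 100 ∧ o' = o ∧
      (∀ r < 30, r ≠ 21 → ρ' r = ρ r) ∧ ρ' 31 = c.start k g u (c.slot k g u t) ∧
      (2 ^ g < c.b → ρ' 21 =
        streamBase (c.stream k g u) (2 ^ g) (u * (c.width g * 2 ^ k)) (t + 1)) := by
  have hm := hc.memOk
  have hbig := hc.big
  have hbig' := hc.big'
  have hdir := hc.dir_lt k hk
  have hM : 0 < c.M := Nat.pow_pos hc.b_pos
  have hn : 2 ^ k ≤ c.n :=
    (Nat.le_mul_of_pos_left _ (Nat.two_pow_pos g)).trans hg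
  have hsize := hm.size
  have hgn : 2 ^ g ≤ c.n :=
    (Nat.le_mul_of_pos_right _ (Nat.two_pow_pos k)).trans hg
  by_cases hs : 2 ^ g < c.b
  · have hwid : c.width g = 2 ^ g := min_eq_left (hs.le.trans (Nat.le_self_pow (by norm_num) _))
    -- The streams of all blocks are concatenated before packing, so that no word is wasted on a
    -- short stream; E is the global index of the entry.
    obtain ⟨E, hE⟩ : ∃ E, E = u * (9 * 2 ^ k) + t := ⟨_, rfl⟩
    have hE1 : E / (9 * 2 ^ k) = u := by
      rw [hE, mul_comm u, Nat.mul_add_div (by positivity), Nat.div_eq_of_lt ht, add_zero]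
    have hE2 : E % (9 * 2 ^ k) = t := by
      rw [hE, mul_comm u, Nat.mul_add_mod, Nat.mod_eq_of_lt ht]
    have hE3 : E / c.b * c.b + E % c.b = E := Nat.div_add_mod' _ _
    have hmod : E % c.b < c.b := Nat.mod_lt _ hc.b_pos
    have huK : u * 2 ^ k ≤ c.n / 2 ^ g := by
      rw [Nat.le_div_iff_mul_le (by positivity)]
      rw [hwid] at hu
      have : u * 2 ^ k * 2 ^ g = u * (2 ^ g * 2 ^ k) := by ring
      omega
    have huK' : u * (9 * 2 ^ k) = 9 * (u * 2 ^ k) := by ring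
    have hns : c.n / 2 ^ g ≤ c.n := Nat.div_le_self _ _
    obtain ⟨t1, t2, t3⟩ := hc.small k hk g hg hs (E / c.b) (by omega)
    have hstr := c.stream_spec k g u
    have hsF : 2 ^ g < c.F := by
      rw [hc.F_eq]; exact lt_of_lt_of_le hs (Nat.le_self_pow (by norm_num) _)
    have hdig := pack_digit (F := c.F) (b := c.b) (u := E % c.b)
      (val := fun v => c.stream k g ((E / c.b * c.b + v) / (9 * 2 ^ k))
        ((E / c.b * c.b + v) % (9 * 2 ^ k)))
      (fun v _ => lt_of_le_of_lt ((c.stream_spec k g _).le _) hsF) hmod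
    simp only [hE3, hE1, hE2] at hdig
    rw [← pow_mul] at hdig
    have hfb := hc.shift_lt hmod
    have hbase := streamBase_le (e := c.stream k g u) (s := 2 ^ g)
      (y := u * (c.width g * 2 ^ k)) (t := t)
    have hbase' := le_streamBase (e := c.stream k g u) (s := 2 ^ g)
      (y := u * (c.width g * 2 ^ k)) (t := t)
    have hst : 2 ^ g * t ≤ 9 * (2 ^ g * 2 ^ k) := by
      calc 2 ^ g * t ≤ 2 ^ g * (9 * 2 ^ k) := Nat.mul_le_mul_left _ ht.le
        _ = _ := by ring
    have hle := hstr.le t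
    have hfirst := hstr.first t ht
    have hnext : streamBase (c.stream k g u) (2 ^ g) (u * (c.width g * 2 ^ k)) (t + 1) =
      streamBase (c.stream k g u) (2 ^ g) (u * (c.width g * 2 ^ k)) t +
        if c.stream k g u t = 0 then 2 ^ g else 0 := rfl
    have hslot : c.slot k g u t =
      (streamPos (c.stream k g u) (2 ^ g) (u * (c.width g * 2 ^ k)) t).map c.sy := by
      rw [Params.slot, if_pos hs]
    rw [hslot, streamPos, hnext]
    have h21' := h21 hs
    have hE4 : E ≤ 18 * c.n := by omega
    generalize hy : u * (c.width g * 2 ^ k) = y at *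
    generalize c.stream k g u t = v at *
    generalize streamBase (c.stream k g u) (2 ^ g) y t = base at *
    refine Run.cond hm trivial (fun _ => ?_) (fun h0 => ?_)
    swap
    · exfalso; simp [nev, h.r22, hs] at h0
    simp only [block]
    refine Run.seq (Run.assign_eq hm (v := v) ?_ ?_ ?_)
    · simp only [Ok, OkOp, nev, natOp, nev_entry, ok_entry hm, Function.update_apply,
        Nat.reduceEqDiff, if_false, if_true, and_true, true_and, h.r9, h.r11, h.r18, h.r23, h.r24,
        h.r25, h20, ← hE, t3, ← add_assoc]
      generalize c.f * (E % c.b) = fb at *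
      omega
    · simp only [Ok, OkOp, nev, natOp, nev_entry, ok_entry hm, Function.update_apply,
        Nat.reduceEqDiff, if_false, if_true, and_true, true_and, h.r9, h.r11, h.r18, h.r23, h.r24,
        h.r25, h20, ← hE, t3, hdig, ← add_assoc]
    refine Run.cond hm trivial (fun hv => ?_) (fun hv => ?_)
    · simp only [Ok, OkOp, nev, natOp, nev_entry, ok_entry hm, Function.update_apply,
        Nat.reduceEqDiff, if_false, if_true, and_true, true_and] at hv
      rw [if_neg hv, if_neg hv]
      obtain ⟨hf1, hf2⟩ := hfirst hv
      have ha := Finset.mem_range.1 (Finset.mem_filter.1 hf1).1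
      have hpn : base + v - 1 < c.n := by
        by_contra hge
        rw [hc.text.eq _ (by omega)] at ha
        omega
      obtain ⟨r1, r2, r3⟩ := hc.rank _ hpn
      have hra := rank_add (N := c.N) (sy := c.sy) (u := y) (v := base + v - 1) ha (by omega)
        (by have := hc.lt_N; omega)
      refine Run.assign_eq hm (v := rank c.sy c.σ c.N (c.sy (base + v - 1) * c.N + y)) ?_ ?_ ?_
      · simp only [Ok, OkOp, nev, natOp, nev_entry, ok_entry hm, Function.update_apply,
          Nat.reduceEqDiff, if_false, if_true, and_true, true_and, h21']; omega
      · simp only [Ok, OkOp, nev, natOp, nev_entry, ok_entry hm, Function.update_apply,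
          Nat.reduceEqDiff, if_false, if_true, and_true, true_and, h21']
        rw [r3, hra, hf2, add_zero]
      · refine ⟨Nat.le_of_ble_eq_true rfl, rfl, fun r hr _ => ?_, ?_, fun _ => ?_⟩
        · rw [Function.update_of_ne (by omega), Function.update_of_ne (by omega)]
        · simp [Params.start, hy]
        · simp [h21']
    · simp only [Ok, OkOp, nev, natOp, nev_entry, ok_entry hm, Function.update_apply,
        Nat.reduceEqDiff, if_false, if_true, and_true, true_and] at hv
      rw [if_pos hv, if_pos hv]
      refine Run.seq (Run.assign_eq hm (v := base + 2 ^ g) ?_ ?_ ?_)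
      · simp only [Ok, OkOp, nev, natOp, nev_entry, ok_entry hm, Function.update_apply,
          Nat.reduceEqDiff, if_false, if_true, and_true, true_and, h.r10, h21']; omega
      · simp only [Ok, OkOp, nev, natOp, nev_entry, ok_entry hm, Function.update_apply,
          Nat.reduceEqDiff, if_false, if_true, and_true, true_and, h.r10, h21']
      refine Run.assign_eq hm (v := c.n) trivial ?_ ?_
      · simp only [Ok, OkOp, nev, natOp, nev_entry, ok_entry hm, Function.update_apply,
          Nat.reduceEqDiff, if_false, if_true, and_true, true_and, h.r26]
      · refine ⟨Nat.le_of_ble_eq_true rfl, rfl, fun r hr hr' => ?_, ?_, fun _ => ?_⟩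
        · rw [Function.update_of_ne (by omega), Function.update_of_ne (by omega),
            Function.update_of_ne (by omega)]
        · simp [Params.start]
        · simp
  · rw [Params.slot, if_neg hs]
    obtain ⟨t1, t2, t3⟩ := hc.full k hk g hg (not_lt.1 hs) u hu t ht
    refine Run.cond hm trivial (fun h0 => ?_) (fun _ => ?_)
    · exfalso; simp [nev, h.r22, hs] at h0
    refine Run.assign_eq hm (v := c.start k g u (c.fullSlot k g u t)) ?_ ?_ ?_
    · simp only [Ok, OkOp, nev, natOp, nev_entry, ok_entry hm, Function.update_apply,
        Nat.reduceEqDiff, if_false, if_true, and_true, true_and, h.r9, h.r18, h.r23, h20, ←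
        add_assoc]
      have := hm.size
      omega
    · simp only [Ok, OkOp, nev, natOp, nev_entry, ok_entry hm, Function.update_apply,
        Nat.reduceEqDiff, if_false, if_true, and_true, true_and, h.r9, h.r18, h.r23, h20, ←
        add_assoc]
      rw [← t3]; simp only [add_assoc]
    · refine ⟨Nat.le_of_ble_eq_true rfl, rfl, fun r hr hr' => ?_, ?_, fun h => absurd h hs⟩
      · rw [Function.update_of_ne (by omega)]
      · simp

end RangeMajority

/-! ### The main loop and the parameters of a query -/

namespace RangeMajority
open WordRAM

set_option linter.unusedSimpArgs false

variable {c : Params} {k x T i j g u t : ℕ} {ρ : ℕ → ℕ} {o : List ℕ}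

/-- Process all candidates of the list. -/
def mainLoop : Prog :=
  .loop (less (rg 20) (rg 19))
    (block [fetchProg, candidateProg, .assign 20 (plus (rg 20) (nm 1))])

/-- The time spent on the search for the first position of a symbol from `i` on. -/
def searchCost (c : Params) (y x i : ℕ) (a : ℕ) : ℕ :=
  60 * (occ c.sy a y x / c.M) + 30 * occ c.sy a x i

/-- The numbers that describe the query fit together. -/
structure Query (c : Params) (k x T i j g u : ℕ) : Prop where
  k_le : k ≤ c.kmax
  le_n : 2 ^ g * 2 ^ k ≤ c.n
  x_eq : x = 2 ^ k * (i / 2 ^ k)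
  u_eq : u = i / (c.width g * 2 ^ k)
  i_le : i ≤ j
  j_lt : j < c.n
  T_pos : 1 ≤ T
  T_le : T ≤ c.n

/-- The block start u·width·2^k is a multiple of 2^k and at most i, hence at most x. Since the width
is at most M, the way from there to x is at most M·2^k, as search and amortization require. -/
theorem Query.bounds (hq : Query c k x T i j g u) (hM : 0 < c.M) :
    u * (c.width g * 2 ^ k) ≤ x ∧ x ≤ i ∧ i < x + 2 ^ k ∧
      i / 2 ^ k ≤ u * (c.width g * 2 ^ k) / 2 ^ k + c.M ∧ u * (c.width g * 2 ^ k) ≤ i ∧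
      i < u * (c.width g * 2 ^ k) + c.width g * 2 ^ k ∧ x - u * (c.width g * 2 ^ k) ≤ c.M * 2 ^ k :=
        by
  have hK : 0 < 2 ^ k := by positivity
  have hW : 0 < c.width g := lt_min (by positivity) hM
  have h1 : u * (c.width g * 2 ^ k) ≤ i := hq.u_eq ▸ Nat.div_mul_le_self _ _
  have h2 : i < u * (c.width g * 2 ^ k) + c.width g * 2 ^ k := by
    rw [hq.u_eq]; exact Nat.lt_div_mul_add (by positivity)
  have h3 : u * c.width g ≤ i / 2 ^ k := by
    rw [Nat.le_div_iff_mul_le hK, mul_assoc]; exact h1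
  have h4 : u * (c.width g * 2 ^ k) = 2 ^ k * (u * c.width g) := by ring
  have h5 : x ≤ i := hq.x_eq ▸ Nat.mul_div_le _ _
  have h6 : i < x + 2 ^ k := by
    rw [hq.x_eq, mul_comm]; exact Nat.lt_div_mul_add hK
  have h7 : c.width g * 2 ^ k ≤ c.M * 2 ^ k := Nat.mul_le_mul_right _ (min_le_right _ _)
  refine ⟨?_, h5, h6, ?_, h1, h2, by omega⟩
  · rw [h4, hq.x_eq]; exact Nat.mul_le_mul_left _ h3
  · rw [h4, Nat.mul_div_cancel_left _ hK]
    have h8 : i / 2 ^ k < u * c.width g + c.width g := by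
      rw [Nat.div_lt_iff_lt_mul hK, Nat.add_mul, mul_assoc]; exact h2
    have : c.width g ≤ c.M := min_le_right _ _
    omega

/-- The time keeps the individual search costs as a sum over the candidates, since a single search
may be long and only the total is bounded. -/
theorem run_mainLoop (hc : c.Full) (hq : Query c k x T i j g u) :
    ∀ (m t : ℕ) (ρ : ℕ → ℕ) (o : List ℕ), t + m = 9 * 2 ^ k → LoopRegs c k x T i j g u ρ →
      ρ 20 = t → (2 ^ g < c.b →
        ρ 21 = streamBase (c.stream k g u) (2 ^ g) (u * (c.width g * 2 ^ k)) t) →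
    Run c.w c.s c.mem mainLoop ρ o fun t' _ o' =>
      t' ≤ 800 * m + (((List.range' t m).filterMap (c.slot k g u)).map
        (searchCost c (u * (c.width g * 2 ^ k)) x i)).sum + 10 ∧
      o' = o ++ ((List.range' t m).filterMap (c.slot k g u)).filter
        fun a => T ≤ occ c.sy a i (j + 1) := by
  have hm := hc.memOk
  have hM : 0 < c.M := Nat.pow_pos hc.b_pos
  obtain ⟨b1, b2, b3, b4, b5, b6, b7⟩ := hq.bounds hM
  have hun : u * (c.width g * 2 ^ k) < c.n := by have := hq.i_le; have := hq.j_lt; omega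
  intro m
  induction m with
  | zero =>
    intro t ρ o htm h h20 h21
    refine Run.loop hm ⟨trivial, trivial, trivial⟩ (fun h0 => ?_) (fun _ => ?_)
    · exfalso
      simp only [Ok, OkOp, nev, natOp, nev_entry, ok_entry hm, Function.update_apply,
        Nat.reduceEqDiff, if_false, if_true, and_true, true_and, h20, h.r19] at h0
      rw [if_neg (by omega)] at h0
      exact h0 rfl
    · simp [Expr.cost]
  | succ m ih =>
    intro t ρ o htm h h20 h21
    refine Run.loop hm ⟨trivial, trivial, trivial⟩ (fun _ => ?_) (fun h0 => ?_)
    swap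
    · exfalso
      simp only [Ok, OkOp, nev, natOp, nev_entry, ok_entry hm, Function.update_apply,
        Nat.reduceEqDiff, if_false, if_true, and_true, true_and, h20, h.r19] at h0
      rw [if_pos (by omega)] at h0
      exact one_ne_zero h0
    simp only [block]
    refine Run.seq ((run_fetchProg hc hq.k_le hq.le_n hun h (by omega) h20 h21).mono ?_)
    rintro t₁ ρ₁ o₁ ⟨ht₁, rfl, hfr₁, h31, h21₁⟩
    have h₁ : LoopRegs c k x T i j g u ρ₁ := h.congr fun r hr _ hr' => hfr₁ r hr hr'
    have h20₁ : ρ₁ 20 = t := (hfr₁ 20 (by norm_num) (by norm_num)).trans h20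
    have hcand : Run c.w c.s c.mem candidateProg ρ₁ o₁ fun t' ρ' o' =>
        t' ≤ 600 + (((c.slot k g u t).toList).map
          (searchCost c (u * (c.width g * 2 ^ k)) x i)).sum ∧
        o' = o₁ ++ (c.slot k g u t).toList.filter (fun a => T ≤ occ c.sy a i (j + 1)) ∧
        ∀ r < 31, ρ' r = ρ₁ r := by
      cases hsl : c.slot k g u t with
      | none =>
        rw [hsl] at h31
        refine (run_candidateProg_pad hc.toValid h₁.toRegs h31 b2 hq.i_le hq.j_lt hq.T_pos
          hq.T_le).mono ?_
        rintro t' ρ' o' ⟨h1, h2, h3⟩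
        exact ⟨by simpa using h1, by simpa using h2, h3⟩
      | some a =>
        rw [hsl] at h31
        have ha : a ∈ candidates c.sy c.σ k (2 ^ g) (u * (c.width g * 2 ^ k)) := by
          rw [← Finset.mem_toList, ← (c.slots_perm k g u).mem_iff, List.mem_filterMap]
          exact ⟨t, List.mem_range.2 (by omega), hsl⟩
        obtain ⟨ha1, ha2, -⟩ := Finset.mem_filter.1 ha
        rw [Finset.mem_range] at ha1
        obtain ⟨p, p1, p2, p3, p4⟩ := exists_first ha2
        have hpn : p < c.n := by
          by_contra hge
          rw [hc.text.eq _ (by omega)] at p3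
          omega
        have hocc : 0 < occ c.sy a (u * (c.width g * 2 ^ k)) c.n := by
          rw [Nat.pos_iff_ne_zero, ne_eq, occ_eq_zero_iff]
          exact fun hh => hh p p1 hpn p3
        refine (run_candidateProg hc.toValid hq.k_le ha1 h₁.toRegs h31 hq.x_eq b1 b2 hq.i_le
          hq.j_lt b4 hocc hq.T_pos hq.T_le).mono ?_
        rintro t' ρ' o' ⟨h1, h2, h3⟩
        refine ⟨?_, ?_, h3⟩
        · simp only [Option.toList_some, List.map_cons, List.map_nil, List.sum_cons, List.sum_nil,
            searchCost]
          omega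
        · rw [h2]
          split_ifs with hT <;> simp [hT]
    refine Run.seq (hcand.mono ?_)
    rintro t₂ ρ₂ o₂ ⟨ht₂, rfl, hfr₂⟩
    have h20₂ : ρ₂ 20 = t := (hfr₂ 20 (by norm_num)).trans h20₁
    have h₂ : LoopRegs c k x T i j g u ρ₂ := h₁.congr fun r hr _ _ => hfr₂ r (by omega)
    have hbig := hc.big'
    have hKn : 2 ^ k ≤ c.n := (Nat.le_mul_of_pos_left _ (Nat.two_pow_pos g)).trans hq.le_n
    refine Run.assign_eq hm (v := t + 1) ?_ ?_ ?_
    · simp only [Ok, OkOp, nev, natOp, nev_entry, ok_entry hm, Function.update_apply,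
        Nat.reduceEqDiff, if_false, if_true, and_true, true_and, h20₂]; omega
    · simp only [Ok, OkOp, nev, natOp, nev_entry, ok_entry hm, Function.update_apply,
        Nat.reduceEqDiff, if_false, if_true, and_true, true_and, h20₂]
    refine (ih (t + 1) _ _ (by omega)
      (h₂.congr fun r _ hr _ => Function.update_of_ne hr _ _) (by simp) (fun hs => ?_)).mono ?_
    · rw [Function.update_of_ne (by norm_num), hfr₂ 21 (by norm_num), h21₁ hs]
    rintro t₃ ρ₃ o₃ ⟨ht₃, rfl⟩
    have hcons : (List.range' t (m + 1)).filterMap (c.slot k g u) =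
        (c.slot k g u t).toList ++ (List.range' (t + 1) m).filterMap (c.slot k g u) := by
      rw [List.range'_succ]
      cases hsl : c.slot k g u t <;> simp [hsl]
    rw [hcons]
    simp only [List.map_append, List.sum_append, List.filter_append, ← List.append_assoc, and_true]
    simp only [Expr.cost]
    omega

/-- Occurrences of different symbols are disjoint. Those in [x, i) number less than K in total, and
those in [y, x) at most M·K, of which M pay for one step. -/
theorem sum_searchCost_le (hM : 0 < c.M) {y x i K : ℕ} (h1 : x - y ≤ c.M * K) (h2 : i < x + K)
    (A : Finset ℕ) : A.sum (searchCost c y x i) ≤ 90 * K := by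
  change ∑ a ∈ A, (60 * (occ c.sy a y x / c.M) + 30 * occ c.sy a x i) ≤ 90 * K
  rw [Finset.sum_add_distrib, ← Finset.mul_sum, ← Finset.mul_sum]
  have h3 := sum_occ_le (sy := c.sy) (u := x) (v := i) A
  have h4 := sum_occ_le (sy := c.sy) (u := y) (v := x) A
  have h5 : (∑ a ∈ A, occ c.sy a y x / c.M) ≤ K := by
    refine Nat.le_of_mul_le_mul_left (?_ : c.M * _ ≤ c.M * K) hM
    rw [Finset.mul_sum]
    refine le_trans (Finset.sum_le_sum fun a _ => Nat.mul_div_le _ _) (by omega)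
  omega

/-- Compute the parameters of the query. -/
def setupProg : Prog :=
  block [
    .assign 5 (quo (rg 3) (rg 2)),
    .cond (less (rg 4) (rg 5)) (.assign 5 (rg 4)) .skip,
    .cond (less (entry (nm 0) (nm 1)) (rg 5)) (.assign 5 (entry (nm 0) (nm 1))) .skip,
    .assign 7 (entry (nm 1) (rg 5)),
    .assign 8 (shl (nm 1) (rg 7)),
    .assign 9 (entry (nm 1) (quo (rg 4) (rg 8))),
    .assign 10 (shl (nm 1) (rg 9)),
    .assign 11 (entry (nm 0) (nm 2)),
    .assign 12 (entry (nm 0) (nm 3)),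
    .assign 13 (rg 10),
    .cond (less (rg 12) (rg 13)) (.assign 13 (rg 12)) .skip,
    .assign 14 (times (rg 13) (rg 8)),
    .assign 15 (quo (rg 0) (rg 14)),
    .assign 16 (times (rg 15) (rg 14)),
    .assign 17 (times (rg 8) (quo (rg 0) (rg 8))),
    .assign 18 (plus (nm 6) (times (rg 7) (entry (nm 0) (nm 4)))),
    .assign 19 (times (nm 9) (rg 8)),
    .assign 20 (nm 0),
    .assign 21 (rg 16),
    .assign 22 (less (rg 10) (rg 11)),
    .assign 23 (times (rg 15) (rg 19)),
    .assign 24 (entry (nm 0) (nm 5)),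
    .assign 25 (entry (nm 0) (nm 6)),
    .assign 26 (entry (nm 0) (nm 7))]

/-- Run `P` with the minimum of two numbers in register `5`. -/
theorem run_min {w s : ℕ} {mem : ℕ → ℕ} (hm : MemOk w s mem) {r v v' : ℕ} {e : Expr}
    (he : Ok w s mem ρ e) (hv : nev mem ρ e = v) (hr : ρ r = v')
    (Q : ℕ → (ℕ → ℕ) → List ℕ → Prop)
    (hQ : ∀ t, t ≤ 2 * e.cost + 10 → Q t (Function.update ρ r (min v v')) o) :
    Run w s mem (.cond (less e (rg r)) (.assign r e) .skip) ρ o Q := by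
  refine Run.cond hm ⟨he, trivial, trivial⟩ (fun h => ?_) (fun h => ?_)
  · refine Run.assign_eq hm (v := min v v') he ?_ (hQ _ ?_)
    · simp only [nev, natOp, hv, hr] at h
      have : v < v' := by by_contra hh; exact h (if_neg hh)
      rw [hv, min_eq_left this.le]
    · simp only [Expr.cost]; omega
  · refine Run.skip ?_
    have : Function.update ρ r (min v v') = ρ := by
      simp only [nev, natOp, hv, hr] at h
      have : ¬ v < v' := fun hh => by rw [if_pos hh] at h; exact one_ne_zero h
      rw [min_eq_right (not_lt.1 this), ← hr, Function.update_eq_self]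
    rw [← this]
    refine hQ _ ?_
    simp only [Expr.cost]; omega

set_option maxHeartbeats 1000000 in
-- Powers of two come from a table of logarithms up to n. The minimum `v` keeps the lookup in range
-- and k at most `kmax`.
theorem run_setupProg (hc : c.Full) {p q L v : ℕ} (h0 : ρ 0 = i) (h1 : ρ 1 = j) (h2 : ρ 2 = p)
    (h3 : ρ 3 = q) (h4 : ρ 4 = L) (h6 : ρ 6 = T) (hL : L ≤ c.n)
    (hv : v = min (2 ^ c.kmax) (min L (q / p))) (hk : k = Nat.log 2 v)
    (hg : g = Nat.log 2 (L / 2 ^ k)) (hv1 : 1 ≤ v) (hKL : 1 ≤ L / 2 ^ k)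
    (hq : Query c k x T i j g u) :
    Run c.w c.s c.mem setupProg ρ o fun t ρ' o' => t ≤ 300 ∧ o' = o ∧
      LoopRegs c k x T i j g u ρ' ∧ ρ' 20 = 0 ∧ ρ' 21 = u * (c.width g * 2 ^ k) := by
  have hm := hc.memOk
  have hM : 0 < c.M := Nat.pow_pos hc.b_pos
  obtain ⟨b1, b2, b3, b4, b5, b6, b7⟩ := hq.bounds hM
  have hij := hq.i_le
  have hjn := hq.j_lt
  have hbig := hc.big'
  have hdir : 6 + k * (c.G + 3) + 64 ≤ 2 ^ c.w := hc.dir_lt k hq.k_le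
  have hsize := hm.size
  obtain ⟨K1, K2, K3⟩ := hc.scal_K
  obtain ⟨a1, a2, a3⟩ := hc.scal_b
  obtain ⟨m1, m2, m3⟩ := hc.scal_M
  obtain ⟨g1, g2, g3⟩ := hc.scal_G
  obtain ⟨F1, F2, F3⟩ := hc.scal_F
  obtain ⟨f1, f2, f3⟩ := hc.scal_f
  obtain ⟨n1, n2, n3⟩ := hc.scal_n
  have hvn : v ≤ c.n := by omega
  obtain ⟨l1, l2, l3⟩ := hc.log v hv1 hvn
  obtain ⟨l4, l5, l6⟩ := hc.log (L / 2 ^ k) hKL ((Nat.div_le_self _ _).trans hL)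
  rw [← hk] at l3
  rw [← hg] at l6
  have hKn : 2 ^ k ≤ c.n := (Nat.le_mul_of_pos_left _ (Nat.two_pow_pos g)).trans hq.le_n
  have hgn : 2 ^ g ≤ c.n := (Nat.le_mul_of_pos_right _ (Nat.two_pow_pos k)).trans hq.le_n
  have hwn : c.width g * 2 ^ k ≤ c.n :=
    (Nat.mul_le_mul_right _ (min_le_left _ _)).trans hq.le_n
  have hnw : c.n < 2 ^ c.w := by omega
  have hu : u * (9 * 2 ^ k) ≤ 9 * c.n := by
    have : u * (9 * 2 ^ k) = 9 * (u * 2 ^ k) := by ring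
    have hW : 0 < c.width g := lt_min (by positivity) hM
    have : u * 2 ^ k ≤ u * (c.width g * 2 ^ k) :=
      Nat.mul_le_mul_left _ (Nat.le_mul_of_pos_left _ hW)
    omega
  have hc1 : c.M < 2 ^ c.w := by have := hc.big; omega
  simp only [setupProg, block]
  refine Run.seq (Run.assign_eq hm (v := q / p) ?_ ?_ ?_)
  · simp only [Ok, OkOp, nev, natOp, nev_entry, ok_entry hm, Function.update_apply,
      Nat.reduceEqDiff, if_false, if_true, and_true, true_and]
  · simp only [Ok, OkOp, nev, natOp, nev_entry, ok_entry hm, Function.update_apply,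
      Nat.reduceEqDiff, if_false, if_true, and_true, true_and, h2, h3]
  refine Run.seq (run_min hm (e := rg 4) (v := L) (v' := q / p) trivial (by simp only [Ok, OkOp,
    nev, natOp, nev_entry, ok_entry hm, Function.update_apply, Nat.reduceEqDiff, if_false, if_true,
    and_true, true_and, h4]) (by simp) _ ?_)
  intro t₁ ht₁
  rw [Function.update_idem]
  refine Run.seq (run_min hm (e := entry (nm 0) (nm 1)) (v := 2 ^ c.kmax) (v' := min L (q / p)) ?_
    ?_ (by simp) _ ?_)
  · simp only [Ok, OkOp, nev, natOp, nev_entry, ok_entry hm, Function.update_apply,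
      Nat.reduceEqDiff, if_false, if_true, and_true, true_and]; omega
  · simp only [Ok, OkOp, nev, natOp, nev_entry, ok_entry hm, Function.update_apply,
      Nat.reduceEqDiff, if_false, if_true, and_true, true_and, K3]
  intro t₂ ht₂
  rw [Function.update_idem, ← hv]
  refine Run.seq (Run.assign_eq hm (v := k) ?_ ?_ ?_)
  · simp only [Ok, OkOp, nev, natOp, nev_entry, ok_entry hm, Function.update_apply,
      Nat.reduceEqDiff, if_false, if_true, and_true, true_and]; omega
  · simp only [Ok, OkOp, nev, natOp, nev_entry, ok_entry hm, Function.update_apply,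
      Nat.reduceEqDiff, if_false, if_true, and_true, true_and, l3]
  refine Run.seq (Run.assign_eq hm (v := 2 ^ k) ?_ ?_ ?_)
  · simp only [Ok, OkOp, nev, natOp, nev_entry, ok_entry hm, Function.update_apply,
      Nat.reduceEqDiff, if_false, if_true, and_true, true_and, one_mul]; omega
  · simp only [Ok, OkOp, nev, natOp, nev_entry, ok_entry hm, Function.update_apply,
      Nat.reduceEqDiff, if_false, if_true, and_true, true_and, one_mul]
  refine Run.seq (Run.assign_eq hm (v := g) ?_ ?_ ?_)
  · simp only [Ok, OkOp, nev, natOp, nev_entry, ok_entry hm, Function.update_apply,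
      Nat.reduceEqDiff, if_false, if_true, and_true, true_and, h4]; omega
  · simp only [Ok, OkOp, nev, natOp, nev_entry, ok_entry hm, Function.update_apply,
      Nat.reduceEqDiff, if_false, if_true, and_true, true_and, h4, l6]
  refine Run.seq (Run.assign_eq hm (v := 2 ^ g) ?_ ?_ ?_)
  · simp only [Ok, OkOp, nev, natOp, nev_entry, ok_entry hm, Function.update_apply,
      Nat.reduceEqDiff, if_false, if_true, and_true, true_and, one_mul]; omega
  · simp only [Ok, OkOp, nev, natOp, nev_entry, ok_entry hm, Function.update_apply,
      Nat.reduceEqDiff, if_false, if_true, and_true, true_and, one_mul]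
  refine Run.seq (Run.assign_eq hm (v := c.b) ?_ ?_ ?_)
  · simp only [Ok, OkOp, nev, natOp, nev_entry, ok_entry hm, Function.update_apply,
      Nat.reduceEqDiff, if_false, if_true, and_true, true_and]; omega
  · simp only [Ok, OkOp, nev, natOp, nev_entry, ok_entry hm, Function.update_apply,
      Nat.reduceEqDiff, if_false, if_true, and_true, true_and, a3]
  refine Run.seq (Run.assign_eq hm (v := c.M) ?_ ?_ ?_)
  · simp only [Ok, OkOp, nev, natOp, nev_entry, ok_entry hm, Function.update_apply,
      Nat.reduceEqDiff, if_false, if_true, and_true, true_and]; omega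
  · simp only [Ok, OkOp, nev, natOp, nev_entry, ok_entry hm, Function.update_apply,
      Nat.reduceEqDiff, if_false, if_true, and_true, true_and, m3]
  refine Run.seq (Run.assign_eq hm (v := 2 ^ g) ?_ ?_ ?_)
  · simp only [Ok, OkOp, nev, natOp, nev_entry, ok_entry hm, Function.update_apply,
      Nat.reduceEqDiff, if_false, if_true, and_true, true_and]
  · simp only [Ok, OkOp, nev, natOp, nev_entry, ok_entry hm, Function.update_apply,
      Nat.reduceEqDiff, if_false, if_true, and_true, true_and]
  refine Run.seq (run_min hm (e := rg 12) (v := c.M) (v' := 2 ^ g) trivial (by simp only [Ok, OkOp,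
    nev, natOp, nev_entry, ok_entry hm, Function.update_apply, Nat.reduceEqDiff, if_false, if_true,
    and_true, true_and]) (by simp) _ ?_)
  intro t₃ ht₃
  rw [Function.update_idem, min_comm]
  refine Run.seq (Run.assign_eq hm (v := c.width g * 2 ^ k) ?_ ?_ ?_)
  · simp only [Ok, OkOp, nev, natOp, nev_entry, ok_entry hm, Function.update_apply,
      Nat.reduceEqDiff, if_false, if_true, and_true, true_and]; exact lt_of_le_of_lt hwn hnw
  · simp only [Ok, OkOp, nev, natOp, nev_entry, ok_entry hm, Function.update_apply,
      Nat.reduceEqDiff, if_false, if_true, and_true, true_and]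
  refine Run.seq (Run.assign_eq hm (v := u) ?_ ?_ ?_)
  · simp only [Ok, OkOp, nev, natOp, nev_entry, ok_entry hm, Function.update_apply,
      Nat.reduceEqDiff, if_false, if_true, and_true, true_and]
  · simp only [Ok, OkOp, nev, natOp, nev_entry, ok_entry hm, Function.update_apply,
      Nat.reduceEqDiff, if_false, if_true, and_true, true_and, h0, hq.u_eq]
  refine Run.seq (Run.assign_eq hm (v := u * (c.width g * 2 ^ k)) ?_ ?_ ?_)
  · simp only [Ok, OkOp, nev, natOp, nev_entry, ok_entry hm, Function.update_apply,
      Nat.reduceEqDiff, if_false, if_true, and_true, true_and]; omega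
  · simp only [Ok, OkOp, nev, natOp, nev_entry, ok_entry hm, Function.update_apply,
      Nat.reduceEqDiff, if_false, if_true, and_true, true_and]
  refine Run.seq (Run.assign_eq hm (v := x) ?_ ?_ ?_)
  · simp only [Ok, OkOp, nev, natOp, nev_entry, ok_entry hm, Function.update_apply,
      Nat.reduceEqDiff, if_false, if_true, and_true, true_and, h0, ← hq.x_eq]; omega
  · simp only [Ok, OkOp, nev, natOp, nev_entry, ok_entry hm, Function.update_apply,
      Nat.reduceEqDiff, if_false, if_true, and_true, true_and, h0, ← hq.x_eq]
  refine Run.seq (Run.assign_eq hm (v := c.dir k) ?_ ?_ ?_)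
  · simp only [Ok, OkOp, nev, natOp, nev_entry, ok_entry hm, Function.update_apply,
      Nat.reduceEqDiff, if_false, if_true, and_true, true_and, g3]; omega
  · simp only [Ok, OkOp, nev, natOp, nev_entry, ok_entry hm, Function.update_apply,
      Nat.reduceEqDiff, if_false, if_true, and_true, true_and, g3]
  refine Run.seq (Run.assign_eq hm (v := 9 * 2 ^ k) ?_ ?_ ?_)
  · simp only [Ok, OkOp, nev, natOp, nev_entry, ok_entry hm, Function.update_apply,
      Nat.reduceEqDiff, if_false, if_true, and_true, true_and]; omega
  · simp only [Ok, OkOp, nev, natOp, nev_entry, ok_entry hm, Function.update_apply,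
      Nat.reduceEqDiff, if_false, if_true, and_true, true_and]
  refine Run.seq (Run.assign_eq hm (v := 0) ?_ ?_ ?_)
  · simp only [Ok, OkOp, nev, natOp, nev_entry, ok_entry hm, Function.update_apply,
      Nat.reduceEqDiff, if_false, if_true, and_true, true_and]; omega
  · simp only [Ok, OkOp, nev, natOp, nev_entry, ok_entry hm, Function.update_apply,
      Nat.reduceEqDiff, if_false, if_true, and_true, true_and]
  refine Run.seq (Run.assign_eq hm (v := u * (c.width g * 2 ^ k)) ?_ ?_ ?_)
  · simp only [Ok, OkOp, nev, natOp, nev_entry, ok_entry hm, Function.update_apply,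
      Nat.reduceEqDiff, if_false, if_true, and_true, true_and]
  · simp only [Ok, OkOp, nev, natOp, nev_entry, ok_entry hm, Function.update_apply,
      Nat.reduceEqDiff, if_false, if_true, and_true, true_and]
  refine Run.seq (Run.assign_eq hm (v := if 2 ^ g < c.b then 1 else 0) ?_ ?_ ?_)
  · simp only [Ok, OkOp, nev, natOp, nev_entry, ok_entry hm, Function.update_apply,
      Nat.reduceEqDiff, if_false, if_true, and_true, true_and]
  · simp only [Ok, OkOp, nev, natOp, nev_entry, ok_entry hm, Function.update_apply,
      Nat.reduceEqDiff, if_false, if_true, and_true, true_and]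
  refine Run.seq (Run.assign_eq hm (v := u * (9 * 2 ^ k)) ?_ ?_ ?_)
  · simp only [Ok, OkOp, nev, natOp, nev_entry, ok_entry hm, Function.update_apply,
      Nat.reduceEqDiff, if_false, if_true, and_true, true_and]; omega
  · simp only [Ok, OkOp, nev, natOp, nev_entry, ok_entry hm, Function.update_apply,
      Nat.reduceEqDiff, if_false, if_true, and_true, true_and]
  refine Run.seq (Run.assign_eq hm (v := c.F) ?_ ?_ ?_)
  · simp only [Ok, OkOp, nev, natOp, nev_entry, ok_entry hm, Function.update_apply,
      Nat.reduceEqDiff, if_false, if_true, and_true, true_and]; omega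
  · simp only [Ok, OkOp, nev, natOp, nev_entry, ok_entry hm, Function.update_apply,
      Nat.reduceEqDiff, if_false, if_true, and_true, true_and, F3]
  refine Run.seq (Run.assign_eq hm (v := c.f) ?_ ?_ ?_)
  · simp only [Ok, OkOp, nev, natOp, nev_entry, ok_entry hm, Function.update_apply,
      Nat.reduceEqDiff, if_false, if_true, and_true, true_and]; omega
  · simp only [Ok, OkOp, nev, natOp, nev_entry, ok_entry hm, Function.update_apply,
      Nat.reduceEqDiff, if_false, if_true, and_true, true_and, f3]
  refine Run.assign_eq hm (v := c.n) ?_ ?_ ?_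
  · simp only [Ok, OkOp, nev, natOp, nev_entry, ok_entry hm, Function.update_apply,
      Nat.reduceEqDiff, if_false, if_true, and_true, true_and]; omega
  · simp only [Ok, OkOp, nev, natOp, nev_entry, ok_entry hm, Function.update_apply,
      Nat.reduceEqDiff, if_false, if_true, and_true, true_and, n3]
  refine ⟨?_, rfl, ?_, ?_, ?_⟩
  · simp only [Expr.cost, cost_entry] at ht₁ ht₂ ht₃ ⊢
    omega
  · constructor
    · constructor <;> simp only [Ok, OkOp, nev, natOp, nev_entry, ok_entry hm,
        Function.update_apply, Nat.reduceEqDiff, if_false, if_true, and_true, true_and, h0, h1, h6]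
    all_goals simp only [Ok, OkOp, nev, natOp, nev_entry, ok_entry hm, Function.update_apply,
      Nat.reduceEqDiff, if_false, if_true, and_true, true_and]
  · simp only [Ok, OkOp, nev, natOp, nev_entry, ok_entry hm, Function.update_apply,
      Nat.reduceEqDiff, if_false, if_true, and_true, true_and]
  · simp only [Ok, OkOp, nev, natOp, nev_entry, ok_entry hm, Function.update_apply,
      Nat.reduceEqDiff, if_false, if_true, and_true, true_and]

end RangeMajority

/-! ### Correctness and running time of a query -/

namespace RangeMajority
open WordRAM

set_option linter.unusedSimpArgs false

variable {c : Params} {i j : ℕ} {ρ : ℕ → ℕ}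

/-- The program that answers queries. -/
def queryProg : Prog := .seq thresholdProg (.seq setupProg mainLoop)

/-- A symbol that occurs in the range but is no candidate has 2·occ < s, so s ≥ 2 and L ≥ 2·2^k. The
minimum that defines k is below 2·2^k, and each of its three terms is treated in turn. A small
2^kmax makes every occurring symbol a candidate or contradicts L ≤ n. A small L is impossible. A
small q/p makes the frequency of a at least so large that 2·occ > s. -/
theorem mem_candidates {n σ k s y i j a p q kmax L : ℕ} {sy : ℕ → ℕ} (ha : a < σ) (hp : 1 ≤ p)
    (hkmax : σ ≤ 2 ^ kmax ∨ n < 2 ^ (kmax + 1)) (hk : k = Nat.log 2 (min (2 ^ kmax) (min L (q /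
      p))))
    (hLn : L ≤ n) (hs : s * 2 ^ k ≤ L) (hs0 : 0 < s) (hy : y ≤ i)
    (hj : j + 1 ≤ y + 3 * s * 2 ^ k) (hocc : 0 < occ sy a i (j + 1))
    (hfreq : p * L ≤ occ sy a i (j + 1) * q) : a ∈ candidates sy σ k s y := by
  have hmono : occ sy a i (j + 1) ≤ occ sy a y (y + 3 * s * 2 ^ k) := occ_mono hy hj
  refine Finset.mem_filter.2 ⟨Finset.mem_range.2 ha, by omega, ?_⟩
  by_contra! hcon
  obtain ⟨h1, h2⟩ := hcon
  have hlt : min (2 ^ kmax) (min L (q / p)) < 2 * 2 ^ k := by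
    rw [hk, mul_comm, ← pow_succ]; exact Nat.lt_pow_succ_log_self (by norm_num) _
  have hs2 : 2 ≤ s := by omega
  have hL : 2 * 2 ^ k ≤ L := (Nat.mul_le_mul_right _ hs2).trans hs
  rcases min_lt_iff.1 hlt with h | h
  · have h3 : 2 ^ kmax < 2 ^ (k + 1) := by rw [pow_succ, mul_comm (2 ^ k)]; exact h
    have h4 := (Nat.pow_lt_pow_iff_right (by norm_num : 1 < 2)).1 h3
    have h5 : 2 ^ kmax ≤ 2 ^ k := Nat.pow_le_pow_right (by norm_num) (by omega)
    rcases hkmax with h6 | h6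
    · omega
    · rw [pow_succ] at h6; omega
  rcases min_lt_iff.1 h with h | h
  · omega
  · have h3 : q < 2 * 2 ^ k * p := (Nat.div_lt_iff_lt_mul hp).1 h
    have h4 : occ sy a i (j + 1) * q < occ sy a i (j + 1) * (2 * 2 ^ k * p) :=
      Nat.mul_lt_mul_of_pos_left h3 hocc
    have h5 : p * (s * 2 ^ k) ≤ p * L := Nat.mul_le_mul_left _ hs
    have h6 : s * (p * 2 ^ k) < (2 * occ sy a i (j + 1)) * (p * 2 ^ k) := by
      have e1 : s * (p * 2 ^ k) = p * (s * 2 ^ k) := by ring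
      have e2 : (2 * occ sy a i (j + 1)) * (p * 2 ^ k) = occ sy a i (j + 1) * (2 * 2 ^ k * p) := by
        ring
      omega
    have := Nat.lt_of_mul_lt_mul_right h6
    omega

theorem run_queryProg (hc : c.Full) {p q : ℕ} (h0 : ρ 0 = i) (h1 : ρ 1 = j) (h2 : ρ 2 = p)
    (h3 : ρ 3 = q) (hij : i ≤ j) (hj : j < c.n) (hp : 1 ≤ p) (hpq : p ≤ q) :
    Run c.w c.s c.mem queryProg ρ [] fun t _ o' => t * p ≤ 10000 * q ∧ o'.Nodup ∧
      ∀ a, a ∈ o' ↔ a < c.σ ∧ p * (j - i + 1) ≤ occ c.sy a i (j + 1) * q := by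
  have hm := hc.memOk
  have hM : 0 < c.M := Nat.pow_pos hc.b_pos
  have hnB := hc.n_lt_B
  refine Run.seq ((run_thresholdProg hm hc.B_pos hc.B_le hc.scal_B (by omega) (by omega) (by omega)
    (by omega)).mono ?_)
  rintro t₁ ρ₁ o₁ ⟨ht₁, rfl, hfr₁, h4, h6⟩
  rw [h0, h1] at h4
  simp only [h0, h1, h2, h3] at h6
  obtain ⟨L, hL⟩ : ∃ L, L = j - i + 1 := ⟨_, rfl⟩
  rw [← hL] at h4 h6 ⊢
  obtain ⟨v, hv⟩ : ∃ v, v = min (2 ^ c.kmax) (min L (q / p)) := ⟨_, rfl⟩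
  obtain ⟨k, hk⟩ : ∃ k, k = Nat.log 2 v := ⟨_, rfl⟩
  obtain ⟨g, hg⟩ : ∃ g, g = Nat.log 2 (L / 2 ^ k) := ⟨_, rfl⟩
  have hqp : 1 ≤ q / p := (Nat.one_le_div_iff (by omega)).2 hpq
  have hv1 : 1 ≤ v := by
    have := Nat.two_pow_pos c.kmax; omega
  have hkv : 2 ^ k ≤ v := hk ▸ Nat.pow_log_le_self 2 (by omega)
  have hkmax : k ≤ c.kmax := by
    refine (Nat.pow_le_pow_iff_right (a := 2) (by norm_num)).1 (by omega)
  have hKL : 1 ≤ L / 2 ^ k := (Nat.one_le_div_iff (by positivity)).2 (by omega)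
  have hgL : 2 ^ g * 2 ^ k ≤ L := by
    rw [← Nat.le_div_iff_mul_le (by positivity), hg]
    exact Nat.pow_log_le_self 2 (by omega)
  have hLg : L < 2 * 2 ^ g * 2 ^ k := by
    rw [← Nat.div_lt_iff_lt_mul (by positivity), mul_comm 2, ← pow_succ, hg]
    exact Nat.lt_pow_succ_log_self (by norm_num) _
  have hkp : 2 ^ k * p ≤ q := by
    rw [← Nat.le_div_iff_mul_le (by omega)]; omega
  have hT1 : 1 ≤ ρ₁ 6 := by
    by_contra hT
    have h5 := (h6 0).1 (by omega)
    have : 0 < p * L := Nat.mul_pos hp (by omega)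
    omega
  have hTL : ρ₁ 6 ≤ L := (h6 L).2 (by rw [mul_comm]; exact Nat.mul_le_mul_left _ hpq)
  have hq : Query c k (2 ^ k * (i / 2 ^ k)) (ρ₁ 6) i j g (i / (c.width g * 2 ^ k)) :=
    ⟨hkmax, by omega, rfl, rfl, hij, hj, hT1, by omega⟩
  obtain ⟨b1, b2, b3, b4, b5, b6, b7⟩ := hq.bounds hM
  refine Run.seq ((run_setupProg hc ((hfr₁ 0 (by norm_num)).trans h0)
    ((hfr₁ 1 (by norm_num)).trans h1) ((hfr₁ 2 (by norm_num)).trans h2)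
    ((hfr₁ 3 (by norm_num)).trans h3) h4 rfl (by omega) hv hk hg hv1 hKL hq).mono ?_)
  rintro t₂ ρ₂ o₂ ⟨ht₂, rfl, hR, h20, h21⟩
  refine (run_mainLoop hc hq (9 * 2 ^ k) 0 ρ₂ [] (by omega) hR h20 fun _ => h21).mono ?_
  rintro t₃ ρ₃ o₃ ⟨ht₃, rfl⟩
  generalize i / (c.width g * 2 ^ k) = u at *
  rw [← List.range_eq_range'] at ht₃ ⊢
  have hperm := c.slots_perm k g u
  refine ⟨?_, ?_, fun a => ?_⟩
  · rw [(hperm.map _).sum_eq, Finset.sum_map_toList] at ht₃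
    have hsum := sum_searchCost_le hM b7 b3 (candidates c.sy c.σ k (2 ^ g) (u * (c.width g * 2 ^
      k)))
    have hK := Nat.two_pow_pos k
    -- Threshold and set-up take at most 1500, the loop 800 for each of 9·2^k entries plus 10, and
    -- the searches 90·2^k in total.
    calc (t₁ + (t₂ + t₃)) * p ≤ 10000 * 2 ^ k * p := Nat.mul_le_mul_right _ (by omega)
      _ = 10000 * (2 ^ k * p) := by ring
      _ ≤ 10000 * q := Nat.mul_le_mul_left _ hkp
  · exact ((hperm.nodup_iff).2 (Finset.nodup_toList _)).filter _
  · rw [List.nil_append, List.mem_filter, hperm.mem_iff, Finset.mem_toList, decide_eq_true_eq, h6]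
    constructor
    · rintro ⟨ha, hf⟩
      exact ⟨Finset.mem_range.1 (Finset.mem_filter.1 ha).1, hf⟩
    · rintro ⟨ha, hf⟩
      refine ⟨?_, hf⟩
      have hocc := (h6 _).2 hf
      have hwid : c.width g * 2 ^ k ≤ 2 ^ g * 2 ^ k := Nat.mul_le_mul_right _ (min_le_left _ _)
      have e1 : 3 * 2 ^ g * 2 ^ k = 3 * (2 ^ g * 2 ^ k) := by ring
      have e2 : 2 * 2 ^ g * 2 ^ k = 2 * (2 ^ g * 2 ^ k) := by ring
      exact mem_candidates ha hp hc.kmax_spec (hv ▸ hk) (by omega : L ≤ c.n) hgL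
        (by positivity) b5 (by omega) (by omega) hf

end RangeMajority

namespace RangeMajority
open WordRAM

set_option linter.unusedSimpArgs false

/-! ### The layout of the memory -/

/-- Offset of the array number `a` in a memory that starts with a directory of `m` offsets. -/
def arrayStart (m : ℕ) (len : ℕ → ℕ) (a : ℕ) : ℕ := m + ∑ u ∈ Finset.range a, len u

theorem arrayStart_mono {m : ℕ} {len : ℕ → ℕ} : Monotone (arrayStart m len) := fun a a' h => by
  have : ∑ u ∈ Finset.range a, len u ≤ ∑ u ∈ Finset.range a', len u :=
    Finset.sum_le_sum_of_subset (Finset.range_mono h)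
  simp only [arrayStart]; omega

theorem arrayStart_succ {m : ℕ} {len : ℕ → ℕ} {a : ℕ} :
    arrayStart m len (a + 1) = arrayStart m len a + len a := by
  rw [arrayStart, Finset.sum_range_succ, arrayStart]; omega

/-- Arrays do not overlap, so an address determines the array and the entry; this makes a memory
defined by choice well determined. -/
theorem arrayStart_add_inj {m : ℕ} {len : ℕ → ℕ} {a a' e e' : ℕ} (he : e < len a)
    (he' : e' < len a') (h : arrayStart m len a + e = arrayStart m len a' + e') :
    a = a' ∧ e = e' := by
  have key : ∀ a a' e e', e < len a → arrayStart m len a + e = arrayStart m len a' + e' →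
      ¬ a < a' := by
    intro a a' e e' he h hlt
    have := arrayStart_mono (m := m) (len := len) (show a + 1 ≤ a' from hlt)
    rw [arrayStart_succ] at this
    omega
  have h1 := key a a' e e' he h
  have h2 := key a' a e' e he' h.symm
  obtain rfl : a = a' := by omega
  exact ⟨rfl, by omega⟩

/-- A memory can hold arrays of given lengths and contents. -/
theorem exists_memory (w m : ℕ) (len : ℕ → ℕ) (val : ℕ → ℕ → ℕ) (hw : 1 ≤ w)
    (hs : arrayStart m len m < 2 ^ w) (hval : ∀ a < m, ∀ e < len a, val a e < 2 ^ w) :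
    ∃ mem, MemOk w (arrayStart m len m) mem ∧
      ∀ a < m, ∀ e < len a, Rd (arrayStart m len m) mem a e (val a e) := by
  classical
  let mem : ℕ → ℕ := fun x => if x < m then arrayStart m len x else
    if h : ∃ q : ℕ × ℕ, q.1 < m ∧ q.2 < len q.1 ∧ x = arrayStart m len q.1 + q.2 then
      val h.choose.1 h.choose.2 else 0
  have hle : ∀ a, m ≤ arrayStart m len a := fun a => Nat.le_add_right _ _
  have hlt : ∀ a < m, ∀ e < len a, arrayStart m len a + e < arrayStart m len m := by
    intro a ha e he
    have := arrayStart_mono (m := m) (len := len) (show a + 1 ≤ m from ha)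
    rw [arrayStart_succ] at this
    omega
  refine ⟨mem, ⟨hw, hs.le, fun x hx => ?_⟩, fun a ha e he => ?_⟩
  · simp only [mem]
    split_ifs with h1 h
    · exact lt_of_le_of_lt (arrayStart_mono h1.le) hs
    · exact hval _ h.choose_spec.1 _ h.choose_spec.2.1
    · exact Nat.two_pow_pos w
  · have h1 : mem a = arrayStart m len a := if_pos ha
    have h2 : mem (arrayStart m len a + e) = val a e := by
      have hex : ∃ q : ℕ × ℕ, q.1 < m ∧ q.2 < len q.1 ∧
        arrayStart m len a + e = arrayStart m len q.1 + q.2 := ⟨(a, e), ha, he, rfl⟩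
      have h3 := hex.choose_spec
      obtain ⟨h4, h5⟩ := arrayStart_add_inj he h3.2.1 h3.2.2
      have := hle a
      simp only [mem]
      rw [if_neg (by omega), dif_pos hex, ← h4, ← h5]
    have := hlt a ha e he
    exact ⟨by have := hle m; omega, by rw [h1]; exact this, by rw [h1]; exact h2⟩

/-! ### The size of the memory -/

namespace Params

/-- Length of the list of candidates for the frequency `1 / 2 ^ k` and the ranges of about
`2 ^ (g + k)` positions. -/
def listLen (c : Params) (k g : ℕ) : ℕ :=
  if 2 ^ g * 2 ^ k ≤ c.n then
    if 2 ^ g < c.b then (9 * (c.n / 2 ^ g) + 9 * 2 ^ k) / c.b + 1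
    else (c.n / (c.width g * 2 ^ k) + 1) * (9 * 2 ^ k)
  else 0

/-- Length of the array number `r` for the frequency `1 / 2 ^ k`. -/
def levelLen (c : Params) (k r : ℕ) : ℕ :=
  if r < 3 then c.n / c.b ^ (r + 1) + 1 else c.listLen k (r - 3)

/-- Length of the array number `a`. -/
def arrayLen (c : Params) : ℕ → ℕ
  | 0 => 8
  | 1 => c.n + 1
  | 2 => 2 * c.n + c.M + 1
  | 3 => 2 * c.n + c.M + 1
  | 4 => c.n
  | 5 => c.F ^ c.b * (2 * c.F)
  | a + 6 => c.levelLen (a / (c.G + 3)) (a % (c.G + 3))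

/-- Contents of the list of candidates. -/
noncomputable def listVal (c : Params) (k g e : ℕ) : ℕ :=
  if 2 ^ g < c.b then
    pack c.F c.b fun v => c.stream k g ((e * c.b + v) / (9 * 2 ^ k)) ((e * c.b + v) % (9 * 2 ^ k))
  else c.start k g (e / (9 * 2 ^ k)) (c.fullSlot k g (e / (9 * 2 ^ k)) (e % (9 * 2 ^ k)))

/-- Contents of the array number `r` for the frequency `1 / 2 ^ k`. -/
noncomputable def levelVal (c : Params) (k r e : ℕ) : ℕ :=
  if r < 3 then node c.F c.b (c.off k) r e else c.listVal k (r - 3) e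

/-- Contents of the array number `a`. -/
noncomputable def arrayVal (c : Params) : ℕ → ℕ → ℕ
  | 0, e => [c.B, 2 ^ c.kmax, c.b, c.M, c.G + 3, c.F, c.f, c.n].getD e 0
  | 1, e => Nat.log 2 e
  | 2, e => keyPos c.sy c.σ c.N e
  | 3, e => keySym c.sy c.σ c.N e
  | 4, e => RangeMajority.rank c.sy c.σ c.N (c.sy e * c.N + e)
  | 5, e => digitsBelow c.F c.b (e / (2 * c.F)) (e % (2 * c.F))
  | a + 6, e => c.levelVal (a / (c.G + 3)) (a % (c.G + 3)) e

variable {c : Params} {k r e g : ℕ}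

theorem arrayLen_dir (hr : r < c.G + 3) : c.arrayLen (c.dir k + r) = c.levelLen k r := by
  rw [dir, show 6 + k * (c.G + 3) + r = ((c.G + 3) * k + r) + 6 by ring, arrayLen,
    Nat.mul_add_div (by omega), Nat.div_eq_of_lt hr, Nat.mul_add_mod, Nat.mod_eq_of_lt hr, add_zero]

theorem arrayVal_dir (hr : r < c.G + 3) : c.arrayVal (c.dir k + r) e = c.levelVal k r e := by
  rw [dir, show 6 + k * (c.G + 3) + r = ((c.G + 3) * k + r) + 6 by ring, arrayVal,
    Nat.mul_add_div (by omega), Nat.div_eq_of_lt hr, Nat.mul_add_mod, Nat.mod_eq_of_lt hr, add_zero]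

theorem sum_arrayLen (A : ℕ) :
    ∑ a ∈ Finset.range (c.dir A), c.arrayLen a =
      (∑ a ∈ Finset.range 6, c.arrayLen a) +
        ∑ k ∈ Finset.range A, ∑ r ∈ Finset.range (c.G + 3), c.levelLen k r := by
  induction A with
  | zero => simp [dir]
  | succ A ih =>
    rw [Finset.sum_range_succ _ A, ← add_assoc, ← ih,
      show c.dir (A + 1) = c.dir A + (c.G + 3) by simp only [dir]; ring, Finset.sum_range_add]
    congr 1
    exact Finset.sum_congr rfl fun r hr => arrayLen_dir (Finset.mem_range.1 hr)

/-- The relations between the parameters. -/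
structure Sizes (c : Params) (l β : ℕ) : Prop where
  n_pos : 0 < c.n
  l_eq : l = Nat.log 2 c.n
  N_eq : c.N = 2 ^ (l + 1)
  b_eq : c.b = 2 ^ β
  f_eq : c.f = 6 * β
  G_eq : c.G = l + 1
  kmax_eq : c.kmax = min (Nat.clog 2 c.σ) l
  β_le : 6 * β * 2 ^ β + 6 * β ≤ l
  lt_β : l < 6 * (β + 1) * 2 ^ (β + 1) + 6 * (β + 1)

variable {l β : ℕ}

theorem Sizes.pow_le (h : c.Sizes l β) : 2 ^ l ≤ c.n := by
  rw [h.l_eq]; exact Nat.pow_log_le_self 2 h.n_pos.ne'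

theorem Sizes.lt_pow (h : c.Sizes l β) : c.n < 2 ^ (l + 1) := by
  rw [h.l_eq]; exact Nat.lt_pow_succ_log_self (by norm_num) _

theorem Sizes.l_lt (h : c.Sizes l β) : l < 18 * (β + 1) * c.b := by
  have h1 := h.lt_β
  have h2 : 6 * (β + 1) ≤ 6 * (β + 1) * 2 ^ β := Nat.le_mul_of_pos_right _ (by positivity)
  rw [h.b_eq]
  have h3 : 6 * (β + 1) * 2 ^ (β + 1) = 2 * (6 * (β + 1) * 2 ^ β) := by ring
  have h4 : 18 * (β + 1) * 2 ^ β = 3 * (6 * (β + 1) * 2 ^ β) := by ring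
  omega

/-- There are about log n scales. This bound lets each long scale use n/b³ words within a total of
O(n/b). -/
theorem Sizes.l_lt_sq (h : c.Sizes l β) : l < 18 * c.b ^ 2 := by
  have h1 : β + 1 ≤ 2 ^ β := Nat.lt_two_pow_self
  calc l < 18 * (β + 1) * c.b := h.l_lt
    _ ≤ 18 * c.b * c.b := by
      rw [h.b_eq]
      exact Nat.mul_le_mul_right _ (Nat.mul_le_mul_left _ h1)
    _ = 18 * c.b ^ 2 := by ring

theorem Sizes.b_pos (h : c.Sizes l β) : 0 < c.b := by rw [h.b_eq]; positivity

theorem Sizes.cube_le (h : c.Sizes l β) : c.M ≤ c.n := by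
  refine le_trans ?_ h.pow_le
  rw [M, h.b_eq, ← pow_mul]
  exact Nat.pow_le_pow_right (by norm_num) (by have := h.β_le; omega)

theorem Sizes.β_mul_le (h : c.Sizes l β) : β * c.b ≤ c.n := by
  have h1 := h.β_le
  have h2 := h.pow_le
  have h3 : l < 2 ^ l := Nat.lt_two_pow_self
  have h4 : 6 * β * 2 ^ β = 6 * (β * 2 ^ β) := by ring
  rw [h.b_eq]; omega

/-- The exponent of F^b · F is 6β·2^β + 6β, and β is chosen to keep this at most log n. -/
theorem Sizes.table_le (h : c.Sizes l β) : c.F ^ c.b * (2 * c.F) ≤ 2 * c.n := by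
  have h1 : c.F ^ c.b * (2 * c.F) = 2 * 2 ^ (6 * β * 2 ^ β + 6 * β) := by
    rw [F, h.f_eq, h.b_eq, pow_add, pow_mul 2 (6 * β) (2 ^ β)]; ring
  rw [h1]
  exact Nat.mul_le_mul_left _ ((Nat.pow_le_pow_right (by norm_num) h.β_le).trans h.pow_le)

/-- For g < β, the packed streams use about 18n/2^g numbers, b to a word, and b accounts for
rounding up. For g ≥ β, a list has one word per entry, hence at most 18n/width words; the last two
terms belong to the widths 2^g and b³. -/
theorem Sizes.mul_listLen_le (h : c.Sizes l β) (k g : ℕ) :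
    c.b * c.listLen k g ≤ 18 * c.n / 2 ^ g + (if g < β then c.b else 0) +
      (if β ≤ g then 18 * c.n / 2 ^ (g - β) else 0) + 18 * c.n / c.b ^ 2 := by
  have hb := h.b_pos
  have hiff : 2 ^ g < c.b ↔ g < β := by
    rw [h.b_eq]; exact Nat.pow_lt_pow_iff_right (by norm_num)
  rw [listLen]
  by_cases h1 : 2 ^ g * 2 ^ k ≤ c.n
  swap
  · rw [if_neg h1, mul_zero]; exact Nat.zero_le _
  rw [if_pos h1]
  by_cases h2 : g < β
  · rw [if_pos (hiff.2 h2), if_pos h2, if_neg (not_le.2 h2)]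
    have h7 : 2 ^ k ≤ c.n / 2 ^ g := by
      rw [Nat.le_div_iff_mul_le (by positivity), mul_comm]; exact h1
    have h8 : 18 * (c.n / 2 ^ g) ≤ 18 * c.n / 2 ^ g := Nat.mul_div_le_mul_div_assoc _ _ _
    have h9 : c.b * ((9 * (c.n / 2 ^ g) + 9 * 2 ^ k) / c.b) ≤ _ := Nat.mul_div_le _ _
    rw [Nat.mul_add]
    generalize 18 * c.n / 2 ^ g = X at *
    generalize c.n / 2 ^ g = X' at *
    generalize c.b * ((9 * X' + 9 * 2 ^ k) / c.b) = X'' at *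
    generalize 18 * c.n / c.b ^ 2 = Y at *
    omega
  · rw [if_neg (hiff.not.2 h2), if_neg h2, if_pos (not_lt.1 h2)]
    have hW : 0 < c.width g := lt_min (by positivity) (Nat.pow_pos hb)
    have hwk : c.width g * 2 ^ k ≤ c.n :=
      (Nat.mul_le_mul_right _ (min_le_left _ _)).trans h1
    have h7 : (c.n / (c.width g * 2 ^ k) + 1) * (9 * 2 ^ k) ≤ 18 * c.n / c.width g := by
      rw [Nat.le_div_iff_mul_le hW]
      have h8 := Nat.div_mul_le_self c.n (c.width g * 2 ^ k)
      calc (c.n / (c.width g * 2 ^ k) + 1) * (9 * 2 ^ k) * c.width g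
          = 9 * (c.n / (c.width g * 2 ^ k) * (c.width g * 2 ^ k)) + 9 * (c.width g * 2 ^ k) := by
            ring
        _ ≤ 18 * c.n := by omega
    have h8 : c.b * (18 * c.n / 2 ^ g) ≤ 18 * c.n / 2 ^ (g - β) := by
      rw [Nat.le_div_iff_mul_le (by positivity), h.b_eq]
      calc 2 ^ β * (18 * c.n / 2 ^ g) * 2 ^ (g - β)
          = 18 * c.n / 2 ^ g * (2 ^ β * 2 ^ (g - β)) := by ring
        _ = 18 * c.n / 2 ^ g * 2 ^ g := by rw [← pow_add]; congr 2; omega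
        _ ≤ 18 * c.n := Nat.div_mul_le_self _ _
    have h9 : c.b * (18 * c.n / c.M) ≤ 18 * c.n / c.b ^ 2 := by
      rw [Nat.le_div_iff_mul_le (by positivity)]
      calc c.b * (18 * c.n / c.M) * c.b ^ 2 = 18 * c.n / c.M * c.M := by simp only [M]; ring
        _ ≤ 18 * c.n := Nat.div_mul_le_self _ _
    have h10 : c.b * (18 * c.n / c.width g) ≤
        18 * c.n / 2 ^ (g - β) + 18 * c.n / c.b ^ 2 := by
      rcases min_choice (2 ^ g) c.M with hmin | hmin <;> rw [width, hmin]
      · exact h8.trans (Nat.le_add_right _ _)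
      · exact h9.trans (Nat.le_add_left _ _)
    have h11 := Nat.mul_le_mul_left c.b h7
    exact (h11.trans h10).trans (Nat.add_le_add_right (Nat.le_add_left _ _) _)

/-- The terms in 2^g and in 2^(g - β) form geometric series, at most β scales pay b for rounding,
and the term 18n/b² is paid by at most 19b² scales. The trees add 6n. -/
theorem Sizes.sum_levelLen_le (h : c.Sizes l β) (k : ℕ) :
    c.b * ∑ r ∈ Finset.range (c.G + 3), c.levelLen k r ≤ 450 * c.n := by
  have hb := h.b_pos
  have hbn : c.b ≤ c.n := (Nat.le_self_pow (by norm_num) _).trans h.cube_le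
  have hgeom : ∀ A, ∑ g ∈ Finset.range A, 18 * c.n / 2 ^ g ≤ 36 * c.n := fun A => by
    have := Nat.geom_sum_le (le_refl 2) (18 * c.n) A
    omega
  rw [add_comm c.G, Finset.sum_range_add, Nat.mul_add]
  have h1 : c.b * ∑ r ∈ Finset.range 3, c.levelLen k r ≤ 6 * c.n := by
    have h2 : ∀ r ∈ Finset.range 3, c.levelLen k r ≤ c.n / c.b + 1 := fun r hr => by
      rw [levelLen, if_pos (Finset.mem_range.1 hr)]
      have := Nat.div_le_div_left (a := c.n) (Nat.le_self_pow (Nat.succ_ne_zero r) c.b) hb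
      exact Nat.add_le_add_right this 1
    have h3 := Finset.sum_le_sum h2
    rw [Finset.sum_const, Finset.card_range, smul_eq_mul] at h3
    have h4 := Nat.mul_div_le c.n c.b
    have h5 := Nat.mul_le_mul_left c.b h3
    have h6 : c.b * (3 * (c.n / c.b + 1)) = 3 * (c.b * (c.n / c.b)) + 3 * c.b := by ring
    omega
  have h2 : c.b * ∑ g ∈ Finset.range c.G, c.levelLen k (3 + g) ≤ 444 * c.n := by
    rw [Finset.mul_sum]
    have h3 : ∀ g ∈ Finset.range c.G, c.b * c.levelLen k (3 + g) ≤
        18 * c.n / 2 ^ g + (if g < β then c.b else 0) +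
        (if β ≤ g then 18 * c.n / 2 ^ (g - β) else 0) + 18 * c.n / c.b ^ 2 := fun g _ => by
      rw [levelLen, if_neg (by omega), Nat.add_sub_cancel_left]; exact h.mul_listLen_le k g
    refine (Finset.sum_le_sum h3).trans ?_
    rw [Finset.sum_add_distrib, Finset.sum_add_distrib, Finset.sum_add_distrib]
    have h4 : ∑ g ∈ Finset.range c.G, (if g < β then c.b else 0) ≤ c.n := by
      rw [← Finset.sum_filter, Finset.sum_const, smul_eq_mul]
      refine le_trans (Nat.mul_le_mul_right _ ?_) h.β_mul_le
      refine (Finset.card_le_card (t := Finset.range β) fun g hg =>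
        Finset.mem_range.2 (Finset.mem_filter.1 hg).2).trans (Finset.card_range β).le
    have h5 : ∑ g ∈ Finset.range c.G, (if β ≤ g then 18 * c.n / 2 ^ (g - β) else 0) ≤
        36 * c.n := by
      rw [← Finset.sum_filter]
      refine le_trans ?_ (hgeom c.G)
      rw [← Finset.sum_image (f := fun g => 18 * c.n / 2 ^ g) (g := fun g => g - β)]
      · refine Finset.sum_le_sum_of_subset fun x hx => ?_
        simp only [Finset.mem_image, Finset.mem_filter, Finset.mem_range] at hx ⊢
        omega
      · intro g hg g' hg' hgg
        simp only [Finset.coe_filter, Set.mem_ofPred_eq] at hg hg' hgg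
        omega
    have h6 : ∑ g ∈ Finset.range c.G, 18 * c.n / c.b ^ 2 ≤ 342 * c.n := by
      rw [Finset.sum_const, Finset.card_range, smul_eq_mul]
      have h7 : c.G ≤ 19 * c.b ^ 2 := by
        have := h.l_lt_sq; have := Nat.pow_pos (n := 2) hb; rw [h.G_eq]; omega
      refine (Nat.mul_le_mul_right _ h7).trans ?_
      have := Nat.mul_div_le (18 * c.n) (c.b ^ 2)
      rw [mul_assoc]; omega
    have h7 := hgeom c.G
    omega
  omega

end Params

end RangeMajority

/-! ### Total space and existence of the data structure -/

namespace RangeMajority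
open WordRAM

set_option linter.unusedSimpArgs false

namespace Params

variable {c : Params} {l β : ℕ}

theorem Sizes.F_eq (h : c.Sizes l β) : c.F = c.b ^ 6 := by
  rw [F, h.f_eq, h.b_eq, ← pow_mul, mul_comm]

theorem Sizes.power_le (h : c.Sizes l β) : c.F ^ c.b ≤ 2 * c.n :=
  (Nat.le_mul_of_pos_right _ (by positivity)).trans h.table_le

theorem Sizes.F_le (h : c.Sizes l β) : c.F ≤ 2 * c.n := by
  have h1 : 2 * c.F ≤ c.F ^ c.b * (2 * c.F) := Nat.le_mul_of_pos_left _ (by positivity)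
  have := h.table_le
  omega

theorem Sizes.off_lt (h : c.Sizes l β) (k r : ℕ) : c.off k r < c.F := by
  have hM : 0 < c.M := Nat.pow_pos h.b_pos
  have h1 := offset_lt (fun r => key c.sy c.σ c.N r / 2 ^ k) (D := c.M) hM r
  have : c.M * c.M = c.F := by rw [h.F_eq, M, ← pow_add]
  rw [off]; omega

theorem Sizes.N_le (h : c.Sizes l β) : c.N ≤ 2 * c.n := by
  rw [h.N_eq, pow_succ, mul_comm]; exact Nat.mul_le_mul_left _ h.pow_le

theorem Sizes.lt_N (h : c.Sizes l β) : c.n < c.N := h.N_eq ▸ h.lt_pow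

theorem Sizes.G_le (h : c.Sizes l β) : c.G ≤ c.n := by
  have := h.pow_le
  have : l < 2 ^ l := Nat.lt_two_pow_self
  rw [h.G_eq]; omega

theorem Sizes.listVal_le (h : c.Sizes l β) (ht : IsText c.n c.σ c.sy) {k g e : ℕ}
    (he : e < c.listLen k g) : c.listVal k g e ≤ 2 * c.n := by
  rw [listLen] at he
  rw [listVal]
  by_cases h1 : 2 ^ g * 2 ^ k ≤ c.n
  swap
  · rw [if_neg h1] at he; omega
  rw [if_pos h1] at he
  split_ifs at he ⊢ with h2
  · refine le_trans (pack_lt fun v _ => ?_).le h.power_le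
    refine lt_of_le_of_lt ((c.stream_spec k g _).le _) ?_
    rw [h.F_eq]
    exact lt_of_lt_of_le h2 (Nat.le_self_pow (by norm_num) _)
  · rw [start]
    cases hs : c.fullSlot k g (e / (9 * 2 ^ k)) (e % (9 * 2 ^ k)) with
    | none => simp only [Option.elim_none]; omega
    | some a =>
      simp only [Option.elim_some]
      have ha := Finset.mem_toList.1 (List.mem_of_getElem? hs)
      have ha1 := Finset.mem_range.1 (Finset.mem_filter.1 ha).1
      have hu : e / (9 * 2 ^ k) ≤ c.n / (c.width g * 2 ^ k) := by
        rw [← Nat.lt_succ_iff, Nat.div_lt_iff_lt_mul (by positivity)]; exact he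
      have hy := (Nat.mul_le_mul_right (c.width g * 2 ^ k) hu).trans (Nat.div_mul_le_self _ _)
      have := rank_le_n ht ha1 (hy.trans h.lt_N.le)
      omega

theorem Sizes.arrayVal_lt (h : c.Sizes l β) (ht : IsText c.n c.σ c.sy) (hσ : c.σ ≤ 2 ^ c.w)
    (hB : c.B < 2 ^ c.w) (hn : 1000 * c.n ≤ 2 ^ c.w) {a e : ℕ} (he : e < c.arrayLen a) :
    c.arrayVal a e < 2 ^ c.w := by
  have hN := h.N_le
  have hM := h.cube_le
  have hF := h.F_le
  have hn0 := h.n_pos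
  have hb : c.b ≤ c.n := (Nat.le_self_pow (by norm_num) _).trans hM
  match a with
  | 0 =>
    have hk : 2 ^ c.kmax ≤ c.n := by
      rw [h.kmax_eq]
      exact (Nat.pow_le_pow_right (by norm_num) (min_le_right _ _)).trans h.pow_le
    have hG := h.G_le
    have hf : c.f < c.F := Nat.lt_two_pow_self
    have he' : e < 8 := he
    interval_cases e <;> simp [arrayVal] <;> omega
  | 1 =>
    have : e < c.n + 1 := he
    exact lt_of_le_of_lt (Nat.log_le_self 2 e) (by omega)
  | 2 => exact lt_of_le_of_lt keyPos_le (by omega)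
  | 3 => rcases keySym_lt_or (N := c.N) (r := e) ht with hs | hs <;> simp only [arrayVal] <;> omega
  | 4 =>
    have : e < c.n := he
    exact lt_of_le_of_lt (rank_le_n ht (ht.lt e this) (by have := h.lt_N; omega)) (by omega)
  | 5 => exact lt_of_le_of_lt (digitsBelow_le _ _ _ _) (by omega)
  | a + 6 =>
    simp only [arrayLen, arrayVal, levelLen, levelVal] at he ⊢
    have hp := h.power_le
    split_ifs at he ⊢
    · exact (pack_lt fun v _ => h.off_lt _ _).trans_le (by omega)
    · exact lt_of_le_of_lt (h.listVal_le ht he) (by omega)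

/-- The size of the memory. -/
abbrev size (c : Params) : ℕ := arrayStart (c.dir (c.kmax + 1)) c.arrayLen (c.dir (c.kmax + 1))

/-- The directory has about (log n)² entries, which is thereby O(n). -/
theorem add_four_sq_le (l : ℕ) : (l + 4) ^ 2 ≤ 16 * 2 ^ l := by
  induction l with
  | zero => norm_num
  | succ l ih =>
    have : (l + 1 + 4) ^ 2 ≤ 2 * (l + 4) ^ 2 :=
      Nat.le.intro (k := l ^ 2 + 6 * l + 7) (by ring)
    rw [pow_succ 2]
    omega

theorem Sizes.kmax_le (h : c.Sizes l β) : c.kmax ≤ l := h.kmax_eq ▸ min_le_right _ _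

theorem Sizes.dir_le (h : c.Sizes l β) : c.dir (c.kmax + 1) ≤ 22 * c.n := by
  have h1 : (c.kmax + 1) * (c.G + 3) ≤ (l + 4) * (l + 4) :=
    Nat.mul_le_mul (by have := h.kmax_le; omega) (by rw [h.G_eq])
  have h2 := add_four_sq_le l
  have h3 := h.pow_le
  have h4 := h.n_pos
  rw [pow_two] at h2
  rw [dir]; omega

theorem Sizes.mul_size_le (h : c.Sizes l β) :
    c.b * c.size ≤ c.b * (43 * c.n) + 450 * c.n * (c.kmax + 1) := by
  have h1 := h.dir_le
  have h2 : ∑ a ∈ Finset.range 6, c.arrayLen a ≤ 21 * c.n := by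
    have := h.cube_le
    have := h.table_le
    have := h.n_pos
    simp only [Finset.sum_range_succ, Finset.sum_range_zero, arrayLen]
    omega
  have h3 : c.b * ∑ k ∈ Finset.range (c.kmax + 1), ∑ r ∈ Finset.range (c.G + 3), c.levelLen k r ≤
      450 * c.n * (c.kmax + 1) := by
    rw [Finset.mul_sum]
    refine (Finset.sum_le_sum fun k _ => h.sum_levelLen_le k).trans ?_
    rw [Finset.sum_const, Finset.card_range, smul_eq_mul, mul_comm]
  rw [size, arrayStart, sum_arrayLen, ← add_assoc, Nat.mul_add]
  exact Nat.add_le_add (Nat.mul_le_mul_left _ (by omega)) h3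

/-- If there are at most b levels, the claim is trivial. Otherwise b ≤ ⌈log σ⌉, so β = log b is at
most 1 + log log σ, and the number of levels, at most 19(β + 1)b because b·log b is of order log n,
is O(b log log σ). -/
theorem Sizes.levels_le (h : c.Sizes l β) :
    ((c.kmax + 1 : ℕ) : ℝ) ≤ 57 * c.b * max 1 (Real.logb 2 (Real.logb 2 c.σ)) := by
  have hb := h.b_pos
  have hb' : (0 : ℝ) < c.b := by exact_mod_cast hb
  obtain ⟨m, hm⟩ : ∃ m, m = max 1 (Real.logb 2 (Real.logb 2 c.σ)) := ⟨_, rfl⟩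
  have hm1 : 1 ≤ m := hm ▸ le_max_left _ _
  rw [← hm]
  by_cases hA : c.kmax + 1 ≤ c.b
  · have : ((c.kmax + 1 : ℕ) : ℝ) ≤ c.b := by exact_mod_cast hA
    nlinarith
  have hl := h.l_lt
  have hkl := h.kmax_le
  have h1 : c.kmax + 1 ≤ 19 * (β + 1) * c.b := by
    have : 1 ≤ (β + 1) * c.b := Nat.mul_pos (by omega) hb
    have e1 : 19 * (β + 1) * c.b = 18 * (β + 1) * c.b + (β + 1) * c.b := by ring
    omega
  have h2 : ((c.kmax + 1 : ℕ) : ℝ) ≤ 19 * (β + 1) * c.b := by exact_mod_cast h1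
  have hclog : c.b ≤ Nat.clog 2 c.σ := by
    have : c.kmax ≤ Nat.clog 2 c.σ := h.kmax_eq ▸ min_le_left _ _
    omega
  have hσ : 1 < c.σ := by
    by_contra hh
    rw [Nat.clog_of_right_le_one (by omega)] at hclog
    omega
  have h3 : 2 ^ (c.b - 1) < c.σ := by
    by_contra hh
    have := (Nat.clog_le_iff_le_pow (b := 2) (by norm_num)).2 (not_lt.1 hh)
    omega
  have hσ' : (1 : ℝ) < c.σ := by exact_mod_cast hσ
  have h4 : ((c.b - 1 : ℕ) : ℝ) ≤ Real.logb 2 c.σ := by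
    rw [Real.le_logb_iff_rpow_le (by norm_num) (by linarith), Real.rpow_natCast]
    exact_mod_cast h3.le
  have h5 : (1 : ℝ) ≤ Real.logb 2 c.σ := by
    rw [Real.le_logb_iff_rpow_le (by norm_num) (by linarith), Real.rpow_one]
    exact_mod_cast hσ
  have h6 : (2 : ℝ) ^ β ≤ 2 * Real.logb 2 c.σ := by
    have e1 : ((c.b - 1 : ℕ) : ℝ) = (2 : ℝ) ^ β - 1 := by
      rw [Nat.cast_sub hb, h.b_eq]; norm_num
    linarith
  have h7 : (β : ℝ) ≤ 1 + Real.logb 2 (Real.logb 2 c.σ) := by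
    have e1 : Real.logb 2 ((2 : ℝ) ^ β) = β := by
      rw [← Real.rpow_natCast, Real.logb_rpow (by norm_num) (by norm_num)]
    have e2 := Real.logb_le_logb_of_le (b := 2) (by norm_num) (by positivity) h6
    rw [e1, Real.logb_mul (by norm_num) (by linarith), Real.logb_self_eq_one (by norm_num)] at e2
    exact e2
  have h8 : (β : ℝ) + 1 ≤ 3 * m := by
    have : Real.logb 2 (Real.logb 2 c.σ) ≤ m := hm ▸ le_max_right _ _
    linarith
  nlinarith

theorem Sizes.size_le (h : c.Sizes l β) : (c.size : ℝ) ≤ 26000 * nLogLog c.n c.σ := by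
  have hb' : (0 : ℝ) < c.b := by exact_mod_cast h.b_pos
  have h1 : ((c.b * c.size : ℕ) : ℝ) ≤
      ((c.b * (43 * c.n) + 450 * c.n * (c.kmax + 1) : ℕ) : ℝ) := by
    exact_mod_cast h.mul_size_le
  have h2 := h.levels_le
  rw [nLogLog]
  obtain ⟨m, hm⟩ : ∃ m, m = max 1 (Real.logb 2 (Real.logb 2 c.σ)) := ⟨_, rfl⟩
  have hm1 : 1 ≤ m := hm ▸ le_max_left _ _
  rw [← hm] at h2 ⊢
  push_cast at h1 h2
  have hn : (0 : ℝ) ≤ c.n := Nat.cast_nonneg _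
  have h3 : (450 * c.n : ℝ) * (c.kmax + 1) ≤ 450 * c.n * (57 * c.b * m) :=
    mul_le_mul_of_nonneg_left h2 (by positivity)
  have h4 : (c.b : ℝ) * (43 * c.n) ≤ c.b * (43 * (c.n * m)) := by
    refine mul_le_mul_of_nonneg_left ?_ hb'.le
    nlinarith
  refine le_of_mul_le_mul_left (a := (c.b : ℝ)) ?_ hb'
  have h5 : (0 : ℝ) ≤ c.b * (c.n * m) := by positivity
  nlinarith

end Params

/-- The largest β for which the lookup table is small enough; maximality gives the second
inequality. -/
theorem exists_scale (l : ℕ) :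
    ∃ β, 6 * β * 2 ^ β + 6 * β ≤ l ∧ l < 6 * (β + 1) * 2 ^ (β + 1) + 6 * (β + 1) := by
  classical
  have hex : ∃ β, l < 6 * (β + 1) * 2 ^ (β + 1) + 6 * (β + 1) := ⟨l, by omega⟩
  refine ⟨Nat.find hex, ?_, Nat.find_spec hex⟩
  cases hf : Nat.find hex with
  | zero => simp
  | succ β => exact not_lt.1 (Nat.find_min hex (by omega : β < Nat.find hex))

/-- The data structure exists. -/
theorem exists_full {w n σ : ℕ} {sy : ℕ → ℕ} (ht : IsText n σ sy) (hn : 0 < n) (hσ : σ ≤ 2 ^ w)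
    (hw : 30000 * nLogLog n σ ≤ (2 : ℝ) ^ w) :
    ∃ c : Params, c.Full ∧ c.w = w ∧ c.n = n ∧ c.σ = σ ∧ c.sy = sy ∧
      (c.s : ℝ) ≤ 26000 * nLogLog n σ := by
  obtain ⟨β, hβ, hβ'⟩ := exists_scale (Nat.log 2 n)
  -- Sizes and contents of the arrays do not depend on `s` and `mem`, so these have dummy values
  -- until the memory has been built.
  obtain ⟨c₀, hc₀⟩ : ∃ c₀ : Params, c₀ =
    { w := w, s := 0, n := n, σ := σ, N := 2 ^ (Nat.log 2 n + 1), b := 2 ^ β, f := 6 * β,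
      G := Nat.log 2 n + 1, kmax := min (Nat.clog 2 σ) (Nat.log 2 n), B := 2 ^ ((w - 5) / 3),
      mem := fun _ => 0, sy := sy } := ⟨_, rfl⟩
  have hsz : c₀.Sizes (Nat.log 2 n) β := by
    subst hc₀; exact ⟨hn, rfl, rfl, rfl, rfl, rfl, rfl, hβ, hβ'⟩
  have hw₀ : c₀.w = w := by rw [hc₀]
  have hn₀ : c₀.n = n := by rw [hc₀]
  have hσ₀ : c₀.σ = σ := by rw [hc₀]
  have hsy₀ : c₀.sy = sy := by rw [hc₀]
  have hB₀ : c₀.B = 2 ^ ((w - 5) / 3) := by rw [hc₀]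
  subst hw₀ hn₀ hσ₀ hsy₀
  clear hc₀
  have hsize := hsz.size_le
  have hone : (c₀.n : ℝ) ≤ nLogLog c₀.n c₀.σ := by
    rw [nLogLog]
    exact le_mul_of_one_le_right (Nat.cast_nonneg _) (le_max_left _ _)
  -- The gap between 30000 and 26000 leaves room for words that are a constant factor larger than n.
  have hsw : c₀.size + 4000 * c₀.n ≤ 2 ^ c₀.w := by
    have : ((c₀.size + 4000 * c₀.n : ℕ) : ℝ) ≤ ((2 ^ c₀.w : ℕ) : ℝ) := by
      push_cast; linarith
    exact_mod_cast this
  have hw5 : 5 ≤ c₀.w := by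
    by_contra hh
    have : 2 ^ c₀.w ≤ 2 ^ 5 := Nat.pow_le_pow_right (by norm_num) (by omega)
    omega
  have hBw : c₀.B < 2 ^ c₀.w := by
    rw [hB₀]; exact Nat.pow_lt_pow_right (by norm_num) (by omega)
  have hBle : 32 * c₀.B * c₀.B * c₀.B ≤ 2 ^ c₀.w := by
    rw [hB₀, show (32 : ℕ) = 2 ^ 5 by norm_num, ← pow_add, ← pow_add, ← pow_add]
    exact Nat.pow_le_pow_right (by norm_num) (by omega)
  have hnB : c₀.n < c₀.B * c₀.B * c₀.B := by
    -- Rounding (w - 5)/3 down loses at most two bits in B³, hence 7 = 5 + 2.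
    have h1 : 2 ^ c₀.w ≤ 2 ^ 7 * (c₀.B * c₀.B * c₀.B) := by
      rw [hB₀, ← pow_add, ← pow_add, ← pow_add]
      exact Nat.pow_le_pow_right (by norm_num) (by omega)
    omega
  obtain ⟨mem, hmem, hrd⟩ := exists_memory c₀.w (c₀.dir (c₀.kmax + 1)) c₀.arrayLen c₀.arrayVal
    (by omega) (by omega : c₀.size < _)
    (fun a _ e he => hsz.arrayVal_lt ht hσ hBw (by omega) he)
  have h6 : 6 ≤ c₀.dir (c₀.kmax + 1) := Nat.le_add_right _ _
  have hdir : ∀ k ≤ c₀.kmax, c₀.dir k + (c₀.G + 3) ≤ c₀.dir (c₀.kmax + 1) := by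
    intro k hk
    have : (k + 1) * (c₀.G + 3) ≤ (c₀.kmax + 1) * (c₀.G + 3) := Nat.mul_le_mul_right _ (by omega)
    rw [Nat.succ_mul] at this
    simp only [Params.dir]; omega
  have hlev : ∀ k ≤ c₀.kmax, ∀ r < c₀.G + 3, ∀ e < c₀.levelLen k r,
      Rd c₀.size mem (c₀.dir k + r) e (c₀.levelVal k r e) := by
    intro k hk r hr e he
    have := hdir k hk
    have h1 := hrd (c₀.dir k + r) (by omega) e (by rwa [Params.arrayLen_dir hr])
    rwa [Params.arrayVal_dir hr] at h1
  have hgG : ∀ g k, 2 ^ g * 2 ^ k ≤ c₀.n → g < c₀.G := by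
    intro g k hg
    have h1 : 2 ^ g ≤ 2 ^ g * 2 ^ k := Nat.le_mul_of_pos_right _ (by positivity)
    have h2 := hsz.lt_pow
    rw [hsz.G_eq]
    exact (Nat.pow_lt_pow_iff_right (by norm_num : 1 < 2)).1 (by omega)
  have hlist : ∀ k ≤ c₀.kmax, ∀ g, 2 ^ g * 2 ^ k ≤ c₀.n → ∀ e < c₀.listLen k g,
      Rd c₀.size mem (c₀.dir k + 3 + g) e (c₀.listVal k g e) := by
    intro k hk g hg e he
    have h1 := hgG g k hg
    have h2 := hlev k hk (3 + g) (by omega) e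
    rw [Params.levelLen, Params.levelVal, if_neg (by omega), if_neg (by omega),
      Nat.add_sub_cancel_left, ← add_assoc] at h2
    exact h2 he
  have hscal : ∀ e < 8, Rd c₀.size mem 0 e _ := fun e he => hrd 0 (by omega) e he
  have hsmem : c₀.dir (c₀.kmax + 1) ≤ c₀.size := Nat.le_add_right _ _
  refine ⟨{ c₀ with s := c₀.size, mem := mem }, ?_, rfl, rfl, rfl, rfl, hsize⟩
  have htab := hsz.table_le
  have hN := hsz.N_le
  have hM := hsz.cube_le
  exact {
    memOk := hmem
    text := ht
    lt_N := hsz.lt_N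
    dvd_N := fun k hk => by
      refine hsz.N_eq ▸ pow_dvd_pow 2 ?_
      exact (show k ≤ c₀.kmax from hk).trans (hsz.kmax_le.trans (Nat.le_succ _))
    b_pos := hsz.b_pos
    F_eq := hsz.F_eq
    big := show 64 * (c₀.n + c₀.N + c₀.M + c₀.F ^ c₀.b * (2 * c₀.F)) ≤ 2 ^ c₀.w by omega
    dir_lt := fun k hk => by
      have := hdir k hk
      change c₀.dir k + 64 ≤ 2 ^ c₀.w
      omega
    pos := fun r hr => hrd 2 (by omega) r (Nat.lt_succ_of_le hr)
    sym := fun r hr => hrd 3 (by omega) r (Nat.lt_succ_of_le hr)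
    below := fun W hW d hd => by
      have hW' : W < c₀.F ^ c₀.b := hW
      have hd' : d < 2 * c₀.F := hd
      have h1 := hrd 5 (by omega) (W * (2 * c₀.F) + d) (by
        change _ < c₀.F ^ c₀.b * (2 * c₀.F)
        have := Nat.mul_le_mul_right (2 * c₀.F) hW'
        rw [Nat.succ_mul] at this
        omega)
      simp only [Params.arrayVal] at h1
      rw [mul_comm W, Nat.mul_add_div (by omega), Nat.div_eq_of_lt hd', add_zero, Nat.mul_add_mod,
        Nat.mod_eq_of_lt hd', mul_comm _ W] at h1
      exact h1
    tree := fun k hk t ht q hq => by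
      have h1 := hlev k hk t (by omega) q
      rw [Params.levelLen, Params.levelVal, if_pos ht, if_pos ht] at h1
      refine h1 (Nat.lt_succ_of_le ((Nat.le_div_iff_mul_le ?_).2 hq))
      exact Nat.pow_pos hsz.b_pos
    B_pos := by rw [hB₀]; exact Nat.one_le_two_pow
    B_le := hBle
    n_lt_B := hnB
    big' := show 1000 * c₀.n ≤ 2 ^ c₀.w by omega
    kmax_spec := by
      change c₀.σ ≤ 2 ^ c₀.kmax ∨ c₀.n < 2 ^ (c₀.kmax + 1)
      rcases min_choice (Nat.clog 2 c₀.σ) (Nat.log 2 c₀.n) with h1 | h1 <;>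
        rw [hsz.kmax_eq, h1]
      · exact Or.inl (Nat.le_pow_clog (by norm_num) _)
      · exact Or.inr hsz.lt_pow
    scal_B := hscal 0 (by norm_num)
    scal_K := hscal 1 (by norm_num)
    scal_b := hscal 2 (by norm_num)
    scal_M := hscal 3 (by norm_num)
    scal_G := hscal 4 (by norm_num)
    scal_F := hscal 5 (by norm_num)
    scal_f := hscal 6 (by norm_num)
    scal_n := hscal 7 (by norm_num)
    log := fun v _ hv => hrd 1 (by omega) v (Nat.lt_succ_of_le hv)
    rank := fun p hp => hrd 4 (by omega) p hp
    small := fun k hk g hg hs q hq => by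
      have h1 := hlist k hk g hg q
      rw [Params.listLen, Params.listVal, if_pos hg, if_pos hs, if_pos hs] at h1
      exact h1 (Nat.lt_succ_of_le ((Nat.le_div_iff_mul_le hsz.b_pos).2 hq))
    full := fun k hk g hg hs u hu t ht => by
      have h1 := hlist k hk g hg (u * (9 * 2 ^ k) + t)
      rw [Params.listLen, Params.listVal, if_pos hg, if_neg (not_lt.2 hs),
        if_neg (not_lt.2 hs), mul_comm u, Nat.mul_add_div (by positivity), Nat.div_eq_of_lt ht,
        add_zero, Nat.mul_add_mod, Nat.mod_eq_of_lt ht, mul_comm _ u] at h1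
      have hW : 0 < c₀.width g := lt_min (by positivity) (Nat.pow_pos hsz.b_pos)
      have hu' : u ≤ c₀.n / (c₀.width g * 2 ^ k) :=
        (Nat.le_div_iff_mul_le (by positivity)).2 (le_of_lt hu)
      refine h1 ?_
      have := Nat.mul_le_mul_right (9 * 2 ^ k) (Nat.succ_le_succ hu')
      rw [Nat.succ_mul u] at this
      exact lt_of_lt_of_le (by omega) this }

end RangeMajority

/-! ### From strings and real thresholds to natural numbers -/

namespace RangeMajority
open WordRAM

set_option linter.unusedSimpArgs false

/-- The symbols of a string as a function on all positions. -/
def textOf {n σ : ℕ} (S : Fin n → Fin σ) (p : ℕ) : ℕ := if h : p < n then S ⟨p, h⟩ else σ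

theorem isText_textOf {n σ : ℕ} (S : Fin n → Fin σ) : IsText n σ (textOf S) where
  lt p hp := by rw [textOf, dif_pos hp]; exact (S _).isLt
  eq p hp := by rw [textOf, dif_neg (by omega)]

theorem occ_textOf {n σ : ℕ} (S : Fin n → Fin σ) (i j : Fin n) (a : Fin σ) :
    occ (textOf S) a i (j + 1) = ((Finset.Icc i j).filter fun k => S k = a).card := by
  rw [occ, ← Finset.card_map Fin.valEmbedding]
  congr 1
  ext p
  simp only [Finset.mem_filter, Finset.mem_Ico, Finset.mem_map, Finset.mem_Icc,
    Fin.valEmbedding_apply]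
  constructor
  · rintro ⟨⟨h1, h2⟩, h3⟩
    have hp : p < n := by omega
    rw [textOf, dif_pos hp] at h3
    exact ⟨⟨p, hp⟩, ⟨⟨h1, Nat.lt_succ_iff.1 h2⟩, Fin.ext h3⟩, rfl⟩
  · rintro ⟨q, ⟨⟨h1, h2⟩, h3⟩, rfl⟩
    refine ⟨⟨h1, Nat.lt_succ_of_le h2⟩, ?_⟩
    rw [textOf, dif_pos q.isLt, ← h3]

theorem initState_eq {w i j : ℕ} {p q : BitVec w} {work : Fin 0 → BitVec w} :
    initState [BitVec.ofNat w i, BitVec.ofNat w j, p, q] work =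
      mkState w (fun r => [i, j, p.toNat, q.toNat].getD r 0) [] := by
  simp only [initState, mkState, List.map_nil, State.mk.injEq, and_true]
  refine ⟨funext fun r => ?_, Subsingleton.elim _ _⟩
  match r with
  | 0 => rfl
  | 1 => rfl
  | 2 => simp
  | 3 => simp
  | r + 4 => simp

theorem isRangeMajority_iff {n σ : ℕ} (S : Fin n → Fin σ) {i j : Fin n} (hij : i ≤ j) {τ : ℝ}
    {p q : ℕ} (hq : 0 < q) (hτ : τ = (p : ℝ) / q) (a : Fin σ) :
    IsRangeMajority S i j τ a ↔
      p * ((j : ℕ) - i + 1) ≤ occ (textOf S) a i (j + 1) * q := by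
  have hq' : (0 : ℝ) < q := by exact_mod_cast hq
  rw [IsRangeMajority, occ_textOf, hτ, div_mul_eq_mul_div, div_le_iff₀ hq']
  have : ((j : ℝ) - (i : ℝ) + 1) = (((j : ℕ) - i + 1 : ℕ) : ℝ) := by
    rw [Nat.cast_add, Nat.cast_sub (show (i : ℕ) ≤ j from hij), Nat.cast_one]
  rw [this]
  exact_mod_cast Iff.rfl

end RangeMajority

/-- The same query program `P` and constant `c` serve all strings and all word lengths `w` for
which a symbol fits in a word and a memory of `c * nLogLog n σ` words can be addressed.  The
threshold `τ` is part of the query, as a fraction of two words. -/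
theorem mainTheorem2 :
    ∃ (P : WordRAM.Prog) (c : ℕ),
      ∀ (w n σ : ℕ) (S : Fin n → Fin σ),
        σ ≤ 2 ^ w →
        (c : ℝ) * nLogLog n σ ≤ (2 : ℝ) ^ w →
        ∃ (s m : ℕ) (D : Fin s → BitVec w),
          ((s + m : ℕ) : ℝ) ≤ (c : ℝ) * nLogLog n σ ∧
          ∀ (i j : Fin n) (τ : ℝ) (p q : BitVec w) (work : Fin m → BitVec w),
            i ≤ j → 0 < τ → τ ≤ 1 → τ = (p.toNat : ℝ) / (q.toNat : ℝ) →
            ∃ (t : ℕ) (st : WordRAM.State w m) (L : List (Fin σ)),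
              WordRAM.Exec D P
                (WordRAM.initState [BitVec.ofNat w i, BitVec.ofNat w j, p, q] work) t st ∧
              (t : ℝ) ≤ (c : ℝ) / τ ∧
              st.out = L.map (fun a : Fin σ => BitVec.ofNat w a) ∧
              L.Nodup ∧
              ∀ a : Fin σ, a ∈ L ↔ IsRangeMajority S i j τ a := by
  refine ⟨RangeMajority.queryProg, 30000, fun w n σ S hσ hw => ?_⟩
  rcases Nat.eq_zero_or_pos n with rfl | hn
  · exact ⟨0, 0, fun k => k.elim0, by simp [nLogLog], fun i => i.elim0⟩
  obtain ⟨c, hc, rfl, rfl, rfl, hsy, hs⟩ :=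
    RangeMajority.exists_full (RangeMajority.isText_textOf S) hn hσ (by exact_mod_cast hw)
  have hpos : 0 ≤ nLogLog c.n c.σ :=
    mul_nonneg (Nat.cast_nonneg _) (zero_le_one.trans (le_max_left _ _))
  -- The program never writes to memory, so the working memory is empty and its initial contents are
  -- irrelevant.
  refine ⟨c.s, 0, RangeMajority.mkData c.w c.s c.mem, by push_cast; linarith, ?_⟩
  intro i j τ p q work hij h0 h1 hτ
  -- A zero denominator would make the quotient zero, contrary to τ > 0.
  have hq : 0 < q.toNat := by
    rcases Nat.eq_zero_or_pos q.toNat with hq | hq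
    · rw [hτ, hq] at h0; simp at h0
    · exact hq
  have hq' : (0 : ℝ) < q.toNat := by exact_mod_cast hq
  have hp : 0 < p.toNat := by
    rcases Nat.eq_zero_or_pos p.toNat with hp | hp
    · rw [hτ, hp] at h0; simp at h0
    · exact hp
  have hp' : (0 : ℝ) < p.toNat := by exact_mod_cast hp
  have hpq : p.toNat ≤ q.toNat := by
    rw [hτ, div_le_one hq'] at h1; exact_mod_cast h1
  have hnw : c.n < 2 ^ c.w := by have := hc.big'; omega
  obtain ⟨t, ρ, o, hexec, -, ht, hnodup, hmem⟩ := RangeMajority.run_queryProg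
    (ρ := fun r => [(i : ℕ), j, p.toNat, q.toNat].getD r 0) hc rfl rfl rfl rfl hij j.isLt hp hpq
    (fun r => by
      match r with
      | 0 => exact i.isLt.trans hnw
      | 1 => exact j.isLt.trans hnw
      | 2 => exact p.isLt
      | 3 => exact q.isLt
      | r + 4 => exact Nat.two_pow_pos _)
  have hlt : ∀ a ∈ o, a < c.σ := fun a ha => ((hmem a).1 ha).1
  refine ⟨t, RangeMajority.mkState c.w ρ o, o.pmap Fin.mk hlt, ?_, ?_, ?_, ?_, fun a => ?_⟩
  · rw [RangeMajority.initState_eq]; exact hexec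
  · rw [hτ, div_div_eq_mul_div, le_div_iff₀ hp']
    have : ((t * p.toNat : ℕ) : ℝ) ≤ ((10000 * q.toNat : ℕ) : ℝ) := by exact_mod_cast ht
    push_cast at this ⊢
    linarith
  · simp [RangeMajority.mkState, List.map_pmap]
  · exact hnodup.pmap fun a _ b _ h => by simpa using h
  · rw [RangeMajority.isRangeMajority_iff S hij hq hτ, ← hsy]
    rw [List.mem_pmap]
    constructor
    · rintro ⟨b, hb, rfl⟩
      exact ((hmem b).1 hb).2
    · intro h
      exact ⟨a, (hmem a).2 ⟨a.isLt, h⟩, rfl⟩
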